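/- Let $A$ be a finite local (commutative) $\mathbb{C}$-algebra, i.e. a local $\mathbb{C}$-algebra of finite dimension over $\mathbb{C}$, with maximal ideal $m$, so that $A=\mathbb{C}\oplus m$ and $m$ is nilpotent. Let $X$ be a (connected) Riemann surface. An invertible meromorphic function on $X$ with coefficients in $A$ is a function $f=f_0+\sum_{i=1}^n a_if_i$ with $a_i\in m$, with meromorphic functions $f_0,\dots,f_n:X\to\mathbb{C}$ and $f_0\neq 0$; its zeros and poles are the points near which $f$ is not a holomorphic function with values in $A^\times$. Let $f,g$ be two such functions, let $D$ be the set of all zeros and poles of $f$ and $g$, let $s\in D$, and let $x$ be a uniformizer (holomorphic local coordinate) at $s$. Let $\sigma:[0,1]\to X\setminus D$ be a piecewise $C^1$ loop based at $P$ that goes once counterclockwise around $s$ and around no other point of $D$; that is, $\sigma$ is freely homotopic in $X\setminus D$ to a circle $t\mapsto re^{2\pi i t}$ in the coordinate $x$, where $r>0$ is such that the disc $|x|\le r$ is contained in the coordinate domain and contains no point of $D$ other than $s$. Integrals of $A$-valued functions are defined by linear extension from $\mathbb{C}$ to $A$, and $$\int_\sigma \frac{df}{f}\circ\frac{dg}{g}=\int_0^1\Bigl(\int_0^{t_2}\frac{(f\circ\sigma)'(t_1)}{f(\sigma(t_1))}\,dt_1\Bigr)\frac{(g\circ\sigma)'(t_2)}{g(\sigma(t_2))}\,dt_2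 .$$ For $c\in\mathbb{C}$ and $n\in m$ put $\exp(c+n)=e^c\sum_{k\ge0}n^k/k!$ (a finite sum). Theorem. The Laurent series $f_s,g_s$ of $f,g$ in powers of $x$ have product expansions in $A((x))$ $$f_s=a_0x^{\nu_f}\prod_{j=-N_f}^{-1}(1-a_jx^j)\prod_{j=1}^{\infty}(1-a_jx^j),\qquad g_s=b_0x^{\nu_g}\prod_{j=-N_g}^{-1}(1-b_jx^j)\prod_{j=1}^{\infty}(1-b_jx^j),$$ with $\nu_f,\nu_g\in\mathbb{Z}$, $a_0,b_0\in A^\times$, $a_j,b_j\in m$ for $j<0$, $a_j,b_j\in A$ for $j>0$, and $a_j=0$ for $j<-N_f$, $b_j=0$ for $j<-N_g$. For any such expansions, with the Contou-Carrère symbol $$\langle f,g\rangle_s=(-1)^{\nu_f\nu_g}\,\frac{a_0^{\nu_g}\prod_{j=1}^\infty\prod_{k=1}^\infty\bigl(1-a_j^{k/(j,k)}b_{-k}^{j/(j,k)}\bigr)^{(j,k)}}{b_0^{\nu_f}\prod_{j=1}^\infty\prod_{k=1}^\infty\bigl(1-a_{-j}^{k/(j,k)}b_{k}^{j/(j,k)}\bigr)^{(j,k)}}$$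 (only finitely many factors differ from $1$; $(j,k)$ is the greatest common divisor), one has $$\exp\Bigl(\frac1{2\pi i}\int_\sigma\frac{df}{f}\circ\frac{dg}{g}\Bigr)=\frac{g(P)^{\nu_f}}{f(P)^{\nu_g}}\,\langle f,g\rangle_s .$$ In particular, if $f(P)=g(P)=1$, then $\exp\bigl(\frac1{2\pi i}\int_\sigma\frac{df}{f}\circ\frac{dg}{g}\bigr)=\langle f,g\rangle_s$. -/

import Mathlib

open Set Filter Topology
open scoped Manifold ContDiff unitInterval

noncomputable section

namespace ContouCarrere

section Algebra

variable (A : Type*) [CommRing A] [IsLocalRing A] [Algebra ℂ A] [Module.Finite ℂ A]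

theorem ofId_residueField_bijective :
    Function.Bijective (Algebra.ofId ℂ (IsLocalRing.ResidueField A)) := by
  have : Module.Finite ℂ (IsLocalRing.ResidueField A) :=
    Module.Finite.of_surjective
      (IsScalarTower.toAlgHom ℂ A (IsLocalRing.ResidueField A)).toLinearMap
      IsLocalRing.residue_surjective
  exact IsAlgClosed.algebraMap_bijective_of_isIntegral

/-- The residue homomorphism `A → A / m = ℂ` of a finite local `ℂ`-algebra. -/
def residueMap : A →ₐ[ℂ] ℂ :=
  (AlgEquiv.ofBijective (Algebra.ofId ℂ (IsLocalRing.ResidueField A))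
      (ofId_residueField_bijective A)).symm.toAlgHom.comp
    (IsScalarTower.toAlgHom ℂ A (IsLocalRing.ResidueField A))

variable {A}

/-- The exponential on `A = ℂ ⊕ m`: for `c ∈ ℂ` and `n ∈ m` (so that `n` is nilpotent),
`exp (c + n) = exp c * ∑ k, n ^ k / k!`, a finite sum. -/
def expA (a : A) : A :=
  let n : A := a - algebraMap ℂ A (residueMap A a)
  Complex.exp (residueMap A a) •
    ∑ k ∈ Finset.range (nilpotencyClass n), ((k.factorial : ℂ)⁻¹) • n ^ k

end Algebra

section Symbol

variable {A : Type*} [CommRing A]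

/-- Integral powers `u ^ n`, `n ∈ ℤ`, of a unit `u` of `A`. -/
def unitZPow (u : A) (n : ℤ) : A :=
  if 0 ≤ n then u ^ n.toNat else Ring.inverse u ^ (-n).toNat

/-- The power series `∏_{j ≥ 1} (1 - a_j X ^ j)`. Its coefficient of `X ^ n` is that of the partial
product over `1 ≤ j ≤ n`, since the later factors are `1` modulo `X ^ (n + 1)`. -/
def posProduct (a : ℤ → A) : PowerSeries A :=
  PowerSeries.mk fun n => PowerSeries.coeff n
    (∏ j ∈ Finset.Icc 1 n, (1 - PowerSeries.C (a (j : ℤ)) * PowerSeries.X ^ j))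

/-- `F = a_0 X ^ ν * ∏_{j = -N}^{-1} (1 - a_j X ^ j) * ∏_{j = 1}^{∞} (1 - a_j X ^ j)` in `A((X))`, where
`a_0` is a unit, `a_j` lies in the maximal ideal for `j < 0`, and `a_j = 0` for `j < -N`. -/
def IsProductExpansion [IsLocalRing A] (F : LaurentSeries A) (ν : ℤ) (a : ℤ → A) : Prop :=
  IsUnit (a 0) ∧
  (∀ j : ℤ, j < 0 → a j ∈ IsLocalRing.maximalIdeal A) ∧
  ∃ N : ℕ, (∀ j : ℤ, j < -(N : ℤ) → a j = 0) ∧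
    F = HahnSeries.single ν (a 0) *
      (∏ j ∈ Finset.Icc 1 N, (1 - HahnSeries.single (-(j : ℤ)) (a (-(j : ℤ))))) *
      HahnSeries.ofPowerSeries ℤ A (posProduct a)

/-- `∏_{j ≥ 1} ∏_{k ≥ 1} (1 - a_j ^ (k / (j, k)) * b_k ^ (j / (j, k))) ^ (j, k)`. -/
def doubleProduct (a b : ℕ+ → A) : A :=
  ∏ᶠ p : ℕ+ × ℕ+,
    (1 - a p.1 ^ ((p.2 : ℕ) / Nat.gcd p.1 p.2) * b p.2 ^ ((p.1 : ℕ) / Nat.gcd p.1 p.2)) ^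
      Nat.gcd p.1 p.2

/-- The Contou-Carrère symbol `⟨F, G⟩` of two invertible Laurent series with product expansions
`(ν, a)` and `(μ, b)`. In each double product one of the two sequences is nilpotent and eventually
zero, so that only finitely many factors differ from `1`. -/
def ccSymbol (ν : ℤ) (a : ℤ → A) (μ : ℤ) (b : ℤ → A) : A :=
  unitZPow (-1) (ν * μ) *
    (unitZPow (a 0) μ * doubleProduct (fun j => a (j : ℤ)) (fun k => b (-(k : ℤ)))) *
    Ring.inverse
      (unitZPow (b 0) ν * doubleProduct (fun j => a (-(j : ℤ))) (fun k => b (k : ℤ)))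

end Symbol

section Calculus

variable {A : Type*} [CommRing A] [Algebra ℂ A] [Module.Finite ℂ A]

/-- The derivative of a function `ℝ → A`, taken in the coordinates of a `ℂ`-basis of `A`. -/
def derivA (h : ℝ → A) (t : ℝ) : A :=
  ∑ i, deriv (fun u => (Module.finBasis ℂ A).repr (h u) i) t • Module.finBasis ℂ A i

/-- The integral of a function `ℝ → A`: the linear extension of the integral of complex-valued
functions, in the coordinates of a `ℂ`-basis of `A`. -/
def integralA (h : ℝ → A) (c d : ℝ) : A :=
  ∑ i, (∫ t in c..d, (Module.finBasis ℂ A).repr (h t) i) • Module.finBasis ℂ A i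

/-- The iterated integral `∫∫_{0 ≤ t₁ ≤ t₂ ≤ 1} u(t₁) v(t₂) dt₁ dt₂` of the forms `u dt`, `v dt`. -/
def iteratedIntegral (u v : ℝ → A) : A :=
  integralA (fun t => integralA u 0 t * v t) 0 1

/-- The coefficient of `dt` in the pullback `γ^*(df / f) = d(f ∘ γ) / (f ∘ γ)`. -/
def dlogAlong {X : Type*} (f : X → A) (γ : ℝ → X) (t : ℝ) : A :=
  derivA (fun u => f (γ u)) t * Ring.inverse (f (γ t))

end Calculus

section Surface

variable {X : Type*} [TopologicalSpace X] [ChartedSpace ℂ X]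
  {A : Type*} [CommRing A] [Algebra ℂ A]

/-- `f : X → A` is holomorphic near `p`: all its coordinates are. -/
def HolomorphicNear (f : X → A) (p : X) : Prop :=
  ∀ φ : A →ₗ[ℂ] ℂ, AnalyticAt ℂ (fun z => φ (f ((chartAt ℂ p).symm z))) (chartAt ℂ p p)

/-- `f : X → A` is a meromorphic function with coefficients in `A`: all its coordinates are
meromorphic functions on `X`, and `f` is holomorphic wherever none of them has a pole (that is,
removable singularities have been removed; the values of `f` at its poles are irrelevant). -/
def IsMeromorphic (f : X → A) : Prop :=
  ∀ p : X,
    (∀ φ : A →ₗ[ℂ] ℂ,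
      MeromorphicAt (fun z => φ (f ((chartAt ℂ p).symm z))) (chartAt ℂ p p)) ∧
    ((∀ φ : A →ₗ[ℂ] ℂ,
      0 ≤ meromorphicOrderAt (fun z => φ (f ((chartAt ℂ p).symm z))) (chartAt ℂ p p)) →
      HolomorphicNear f p)

/-- `f` is an invertible meromorphic function with coefficients in `A`: it is meromorphic, and its
reduction `f_0` modulo the maximal ideal is not the zero meromorphic function. -/
def IsInvertibleMeromorphic [IsLocalRing A] [Module.Finite ℂ A] (f : X → A) : Prop :=
  IsMeromorphic f ∧
  ∃ p : X, meromorphicOrderAt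
    (fun z => residueMap A (f ((chartAt ℂ p).symm z))) (chartAt ℂ p p) ≠ ⊤

/-- The set of zeros and poles of `f`: the points near which `f` is not a holomorphic function with
values in the units of `A`. -/
def zerosAndPoles (f : X → A) : Set X :=
  {p | ¬ (HolomorphicNear f p ∧ IsUnit (f p))}

/-- `x` is a uniformizer at `s`: a holomorphic local coordinate of `X` centred at `s`. -/
def IsUniformizer (x : OpenPartialHomeomorph X ℂ) (s : X) : Prop :=
  x ∈ IsManifold.maximalAtlas 𝓘(ℂ) ω X ∧ s ∈ x.source ∧ x s = 0

/-- `F ∈ A((X))` is the Laurent series of `f` in powers of `x` (coordinatewise convergent in a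
punctured neighbourhood of the point `x = 0`). -/
def IsLaurentExpansion (f : X → A) (x : OpenPartialHomeomorph X ℂ) (F : LaurentSeries A) : Prop :=
  ∀ φ : A →ₗ[ℂ] ℂ, ∀ᶠ z in 𝓝[≠] (0 : ℂ),
    HasSum (fun n : ℤ => φ (F.coeff n) * z ^ n) (φ (f (x.symm z)))

/-- The Laurent series of `f` in powers of `x` has the product expansion given by `ν` and `a`. -/
def HasProductExpansion [IsLocalRing A] (f : X → A) (x : OpenPartialHomeomorph X ℂ)
    (ν : ℤ) (a : ℤ → A) : Prop :=
  ∃ F : LaurentSeries A, IsLaurentExpansion f x F ∧ IsProductExpansion F ν a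

/-- A path in `X` is piecewise continuously differentiable. -/
def IsPiecewiseC1 {P Q : X} (γ : Path P Q) : Prop :=
  ∃ (n : ℕ) (t : Fin (n + 1) → ℝ), Monotone t ∧ t 0 = 0 ∧ t (Fin.last n) = 1 ∧
    ∀ i : Fin n, ContMDiffOn 𝓘(ℝ, ℝ) 𝓘(ℝ, ℂ) 1 γ.extend (Icc (t i.castSucc) (t i.succ))

/-- The loop `γ` goes once counterclockwise around the centre of the coordinate `x` and around no
other point of `D`: as a loop in `X \ D` it is freely homotopic to a small circle
`t ↦ r * exp (2 π i t)` in the coordinate `x`, where the centre is the only point of the closed disc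
`|x| ≤ r` that may lie in `D`. -/
def GoesOnceAround (x : OpenPartialHomeomorph X ℂ) (D : Set X) {P : X} (γ : Path P P) : Prop :=
  ∃ r : ℝ, 0 < r ∧ Metric.closedBall (0 : ℂ) r ⊆ x.target ∧
    (∀ z ∈ Metric.closedBall (0 : ℂ) r, z ≠ 0 → x.symm z ∉ D) ∧
    ∃ H : C(I × I, X),
      (∀ t : I, H (0, t) = γ t) ∧
      (∀ t : I, H (1, t) = x.symm (r * Complex.exp (2 * Real.pi * Complex.I * (t : ℝ)))) ∧
      (∀ u : I, H (u, 0) = H (u, 1)) ∧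
      (∀ u t : I, H (u, t) ∉ D)

end Surface

end ContouCarrere

end

/-! The plan is to move the loop to a tiny circle around `s`, keep track of what this does to the
iterated integral, and evaluate everything on the circle by Fourier series. A norm on `A` turns it
into a finite-dimensional Banach algebra, so that `NormedSpace.exp` and ordinary calculus apply;
`expA` agrees with that exponential.

Homotopy. The homotopy is only continuous, so it is never differentiated; instead primitives `F` of
`df/f`, `G` of `dg/g` and `M` of `F dg/g` are continued analytically along the square. The jumps of
`F` and `G` across the loop are constant, and the jump of `M` varies like the period of `f` times
`G`. Hence a free homotopy that changes the base values of `f`, `g` by factors `exp Λf`, `exp Λg`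
changes the iterated integral by `per(f) Λg - per(g) Λf` (`exists_iteratedIntegral_eq_of_homotopy`).
As the periods are `2πi ν` and `2πi μ`, after `exp (·/2πi)` this is exactly the change of `g(P)^ν /
f(P)^μ` (`exp_iteratedIntegral_of_eq_add`).

Small circle. Near `s` one has `f = a_0 z^ν exp (∑ l_n z^n)` and `g = b_0 z^μ exp (∑ l'_n z^n)` with
`l_0 = l'_0 = 0` (`HasProductExpansion.exists_eq_exp`). With `p`, `q` the two sums, `1/2πi` times
the iterated integral over the circle equals `πi νμ + ν q(r) - μ p(r) - ∑ n l_n l'_{-n}`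
(`iteratedIntegral_circleDlog`). The first term exponentiates to `(-1)^{νμ}`; the next two to
`g(r)^ν f(r)^{-μ} a_0^μ b_0^{-ν}`, the powers of `r` cancelling.

Residue. The last sum is finite, because its negative-index factors come from nilpotents. Up to
sign, `n l_n` is `∑_{j ∣ n} j a_j^{n/j}`; in the product of two such sums the pair `(j, k)` occurs
for `n = t lcm(j,k)` with weight `jk/n = (j,k)/t`, which assembles the logarithm of `(1 -
a_j^{k/(j,k)} b_{-k}^{j/(j,k)})^{(j,k)}` (`exp_neg_sum_dlogCoeff_mul`).

Existence of expansions is successive approximation modulo powers of the nilpotent ideal `m`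
(`exists_prod_mul_ofPowerSeries_sub_mem`), then coefficient-by-coefficient factorization of a power
series. -/

section FiniteLocalAlgebra

namespace ContouCarrere

/-! ### Residue map and nilpotency of the maximal ideal -/

section Residue

variable {A : Type*} [CommRing A] [IsLocalRing A] [Algebra ℂ A] [Module.Finite ℂ A]

theorem residueMap_eq_zero_iff {a : A} :
    residueMap A a = 0 ↔ a ∈ IsLocalRing.maximalIdeal A := by
  unfold residueMap
  rw [AlgHom.comp_apply, ← IsLocalRing.residue_eq_zero_iff]
  exact EmbeddingLike.map_eq_zero_iff
    (f := (AlgEquiv.ofBijective (Algebra.ofId ℂ (IsLocalRing.ResidueField A))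
      (ofId_residueField_bijective A)).symm)

theorem isUnit_iff_residueMap_ne_zero {a : A} : IsUnit a ↔ residueMap A a ≠ 0 := by
  rw [ne_eq, residueMap_eq_zero_iff, IsLocalRing.mem_maximalIdeal, mem_nonunits_iff, not_not]

variable (A) in
theorem exists_maximalIdeal_pow_eq_bot :
    ∃ L : ℕ, 0 < L ∧ (IsLocalRing.maximalIdeal A) ^ L = ⊥ := by
  have : IsArtinianRing A := IsArtinianRing.of_finite ℂ A
  obtain ⟨L, hL⟩ := IsArtinianRing.isNilpotent_jacobson_bot (R := A)
  rw [IsLocalRing.jacobson_eq_maximalIdeal ⊥ bot_ne_top] at hL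
  -- Raising the exponent by one makes it positive, as needed where `L - 1` or `L ≠ 0` occurs.
  exact ⟨L + 1, L.succ_pos, by rw [pow_succ, hL]; simp⟩

theorem isNilpotent_of_mem_maximalIdeal {a : A} (ha : a ∈ IsLocalRing.maximalIdeal A) :
    IsNilpotent a := by
  obtain ⟨L, -, hL⟩ := exists_maximalIdeal_pow_eq_bot A
  exact ⟨L, by simpa [hL] using Ideal.pow_mem_pow ha L⟩

theorem isNilpotent_sub_residueMap (a : A) :
    IsNilpotent (a - algebraMap ℂ A (residueMap A a)) := by
  apply isNilpotent_of_mem_maximalIdeal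
  rw [← residueMap_eq_zero_iff, map_sub, AlgHom.commutes]
  simp

end Residue

/-! ### Exponentials and logarithms in a commutative Banach algebra -/

section Exponential

theorem hasDerivAt_exp {A : Type*} [NormedCommRing A] [CompleteSpace A] {𝕜 : Type*} [RCLike 𝕜] [NormedAlgebra 𝕜 A]
    {h : 𝕜 → A} {h' : A} {t : 𝕜} (hh : HasDerivAt h h' t) :
    HasDerivAt (fun t => NormedSpace.exp (h t)) (NormedSpace.exp (h t) * h') t := by
  have := (hasFDerivAt_exp (𝕂 := 𝕜) (x := h t)).comp_hasDerivAt t hh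
  simp only [smul_eq_mul, smul_apply, one_apply_eq_self] at this
  exact this

variable {A : Type*} [NormedCommRing A] [NormedAlgebra ℂ A]

theorem exp_add' [CompleteSpace A] (a b : A) :
    NormedSpace.exp (a + b) = NormedSpace.exp a * NormedSpace.exp b := by
  have : NormedAlgebra ℚ A := NormedAlgebra.restrictScalars ℚ ℂ A
  exact NormedSpace.exp_add

theorem exp_mul_exp_neg [CompleteSpace A] (a : A) :
    NormedSpace.exp a * NormedSpace.exp (-a) = 1 := by
  rw [← exp_add', add_neg_cancel, NormedSpace.exp_zero]

theorem exp_finset_sum [CompleteSpace A] {ι : Type*} (s : Finset ι) (h : ι → A) :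
    NormedSpace.exp (∑ i ∈ s, h i) = ∏ i ∈ s, NormedSpace.exp (h i) := by
  classical
  induction s using Finset.induction_on with
  | empty => simp
  | insert i s hi ih => rw [Finset.sum_insert hi, Finset.prod_insert hi, exp_add', ih]

theorem exp_natCast_mul [CompleteSpace A] (n : ℕ) (a : A) :
    NormedSpace.exp ((n : A) * a) = NormedSpace.exp a ^ n := by
  induction n with
  | zero => simp
  | succ n ih => rw [Nat.cast_succ, add_mul, one_mul, exp_add', ih, pow_succ]

theorem exp_intCast_mul [CompleteSpace A] (n : ℤ) (a : A) (u : Aˣ)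
    (hu : NormedSpace.exp a = u) :
    NormedSpace.exp ((n : A) * a) = ((u ^ n : Aˣ) : A) := by
  cases n with
  | ofNat n => simpa [hu] using exp_natCast_mul n a
  | negSucc n =>
    have h1 := exp_natCast_mul (n + 1) a
    have h2 := exp_mul_exp_neg (((n + 1 : ℕ) : A) * a)
    rw [h1, hu] at h2
    rw [zpow_negSucc]
    symm
    apply Units.inv_eq_of_mul_eq_one_right
    rw [Units.val_pow_eq_pow_val, ← h2]
    congr 2
    push_cast
    ring

theorem exp_algebraMap [CompleteSpace A] (c : ℂ) :
    NormedSpace.exp (algebraMap ℂ A c) = algebraMap ℂ A (Complex.exp c) := by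
  rw [Complex.exp_eq_exp_ℂ, NormedSpace.algebraMap_exp_comm]

theorem exp_eq_sum_of_pow_eq_zero {n : A} {N : ℕ} (hn : n ^ N = 0) :
    NormedSpace.exp n = ∑ k ∈ Finset.range N, ((k.factorial : ℂ)⁻¹) • n ^ k := by
  rw [NormedSpace.exp_eq_tsum ℂ]
  refine tsum_eq_sum fun k hk => ?_
  rw [pow_eq_zero_of_le (by simpa using hk) hn, smul_zero]

/-- Bridge from the algebraic exponential to the analytic one: the scalar part factors off, and the
exponential series of the nilpotent part terminates. -/
theorem expA_eq_exp [IsLocalRing A] [Module.Finite ℂ A] (a : A) :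
    expA a = NormedSpace.exp a := by
  have : CompleteSpace A := FiniteDimensional.complete ℂ A
  have h : a = algebraMap ℂ A (residueMap A a) + (a - algebraMap ℂ A (residueMap A a)) := by ring
  conv_rhs => rw [h, exp_add', exp_algebraMap,
    exp_eq_sum_of_pow_eq_zero (pow_nilpotencyClass (isNilpotent_sub_residueMap a))]
  simp [expA, Algebra.smul_def]

/-- `exp (log (1 - y)) = 1 - y` for nilpotent `y`. -/
theorem exp_neg_sum_pow_div [CompleteSpace A] {y : A} {N : ℕ} (hy : y ^ (N + 1) = 0) :
    NormedSpace.exp (-∑ t ∈ Finset.Icc 1 N, ((t : ℂ)⁻¹) • y ^ t) = 1 - y := by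
  -- `ℓ s` is the truncated `-log (1 - s y)`. The geometric sum telescopes and `y ^ (N + 1) = 0`, so
  -- `(1 - s y) ℓ'(s) = y` holds exactly and `(1 - s y) exp (ℓ s)` is constant.
  let ℓ : ℂ → A := fun s => ∑ t ∈ Finset.range N, (s ^ (t + 1) * ((t + 1 : ℕ) : ℂ)⁻¹) • y ^ (t + 1)
  let h : ℂ → A := fun s => (1 - s • y) * NormedSpace.exp (ℓ s)
  have hℓ (s : ℂ) : HasDerivAt ℓ (∑ t ∈ Finset.range N, s ^ t • y ^ (t + 1)) s := by
    refine HasDerivAt.fun_sum fun t _ => ?_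
    have h1 := ((hasDerivAt_pow (t + 1) s).mul_const (((t + 1 : ℕ) : ℂ)⁻¹)).smul_const (y ^ (t + 1))
    convert h1 using 2
    have : ((t + 1 : ℕ) : ℂ) ≠ 0 := by exact_mod_cast t.succ_ne_zero
    field_simp
    simp
  have hd (s : ℂ) : HasDerivAt h 0 s := by
    have h1 : HasDerivAt (fun s : ℂ => 1 - s • y) (-y) s := by
      simpa using ((hasDerivAt_id s).smul_const y).const_sub 1
    have h2 := h1.fun_mul (hasDerivAt_exp (hℓ s))
    have h3 : (1 - s • y) * ∑ t ∈ Finset.range N, s ^ t • y ^ (t + 1) = y := by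
      have h4 := mul_neg_geom_sum (s • y) N
      have h5 : y * (s • y) ^ N = 0 := by
        rw [smul_pow, mul_smul_comm, ← pow_succ', hy, smul_zero]
      have h6 : ∑ t ∈ Finset.range N, s ^ t • y ^ (t + 1)
          = (∑ t ∈ Finset.range N, (s • y) ^ t) * y := by
        rw [Finset.sum_mul]
        exact Finset.sum_congr rfl fun t _ => by rw [smul_pow, smul_mul_assoc, pow_succ]
      rw [h6, ← mul_assoc, h4, sub_mul, one_mul, mul_comm _ y, h5, sub_zero]
    convert h2 using 1
    rw [mul_left_comm (1 - s • y), h3]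
    ring
  have hc : h 1 = h 0 :=
    is_const_of_deriv_eq_zero (fun s => (hd s).differentiableAt) (fun s => (hd s).deriv) 1 0
  have h0 : h 0 = 1 := by simp [h, ℓ]
  have h1 : ℓ 1 = ∑ t ∈ Finset.Icc 1 N, ((t : ℂ)⁻¹) • y ^ t := by
    simp only [ℓ, one_pow, one_mul]
    rw [Finset.range_eq_Ico, Finset.sum_Ico_add' (fun t : ℕ => ((t : ℂ)⁻¹) • y ^ t)]
    rfl
  rw [h0] at hc
  rw [← h1]
  calc _ = h 1 * NormedSpace.exp (-ℓ 1) := by rw [hc, one_mul]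
    _ = 1 - y := by
      simp only [h, one_smul]
      rw [mul_assoc, exp_mul_exp_neg, mul_one]

end Exponential

/-! ### Coordinatewise derivatives and integrals -/

section Calculus

variable {A : Type*} [NormedCommRing A] [NormedAlgebra ℂ A] [Module.Finite ℂ A]

/-- The coordinates of `A` with respect to the basis `Module.finBasis ℂ A` are continuous. -/
noncomputable def coordCLM (i : Fin (Module.finrank ℂ A)) : A →L[ℂ] ℂ :=
  LinearMap.toContinuousLinearMap ((Module.finBasis ℂ A).coord i)

theorem derivA_eq {h : ℝ → A} {h' : A} {t : ℝ} (hh : HasDerivAt h h' t) : derivA h t = h' := by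
  unfold derivA
  have h1 (i : Fin (Module.finrank ℂ A)) : deriv (fun u => (Module.finBasis ℂ A).repr (h u) i) t
      = (Module.finBasis ℂ A).repr h' i :=
    (((coordCLM i).restrictScalars ℝ).hasFDerivAt.comp_hasDerivAt t hh).deriv
  simp_rw [h1]
  exact (Module.finBasis ℂ A).sum_repr h'

theorem integralA_eq {h : ℝ → A} {c d : ℝ}
    (hh : IntervalIntegrable h MeasureTheory.volume c d) : integralA h c d = ∫ t in c..d, h t := by
  have : CompleteSpace A := FiniteDimensional.complete ℂ A
  unfold integralA
  have h1 (i : Fin (Module.finrank ℂ A)) : ∫ t in c..d, (Module.finBasis ℂ A).repr (h t) i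
      = (Module.finBasis ℂ A).repr (∫ t in c..d, h t) i :=
    (coordCLM i).intervalIntegral_comp_comm hh
  simp_rw [h1]
  exact (Module.finBasis ℂ A).sum_repr _

end Calculus

end ContouCarrere

end FiniteLocalAlgebra

/-! ### Gluing local functions on the square -/

section Gluing

namespace ContouCarrere

theorem IsPreconnected.eq_of_eventually_eq {T B : Type*} [TopologicalSpace T] {s : Set T}
    (hs : IsPreconnected s) {k : T → B} (hk : ∀ p ∈ s, ∀ᶠ q in 𝓝 p, k q = k p) {p q : T}
    (hp : p ∈ s) (hq : q ∈ s) : k p = k q :=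
  hs.induction₂ (fun x y => k x = k y)
    (fun x hx => (hk x hx).filter_mono nhdsWithin_le_nhds |>.mono fun _ h => h.symm)
    (fun _ _ _ _ _ _ h1 h2 => h1.trans h2) (fun _ _ _ _ h => h.symm) hp hq

/-- In the maximum metric balls are boxes, so two of them meet in a box, a product of intervals. -/
theorem isPreconnected_ball_inter_ball (x y : I × I) (δ : ℝ) :
    IsPreconnected (Metric.ball x δ ∩ Metric.ball y δ) := by
  have h1 (a b : I) : IsPreconnected (Metric.ball a δ ∩ Metric.ball b δ) := by
    have h2 (a : I) : OrdConnected (Metric.ball a δ) := by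
      have : Metric.ball a δ = (Subtype.val : I → ℝ) ⁻¹' Metric.ball (a : ℝ) δ := rfl
      rw [this, Real.ball_eq_Ioo]
      exact ordConnected_Ioo.preimage_mono (Subtype.mono_coe _)
    exact ((h2 a).inter (h2 b)).isPreconnected
  have h3 : Metric.ball x δ ∩ Metric.ball y δ
      = (Metric.ball x.1 δ ∩ Metric.ball y.1 δ) ×ˢ (Metric.ball x.2 δ ∩ Metric.ball y.2 δ) := by
    rw [← Set.prod_inter_prod, ball_prod_same, ball_prod_same]
  rw [h3]
  exact (h1 _ _).prod (h1 _ _)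

/-- On the square, functions given locally up to constants in a compatible way glue to a
function. -/
theorem exists_glue_of_locally_compatible {B : Type*} [AddCommGroup B] (n : I × I → I × I → B)
    (hn : ∀ p, ∀ᶠ q in 𝓝 p, ∀ᶠ r in 𝓝 q, n q r - n q q = n p r - n p q) :
    ∃ h : I × I → B, ∀ p, ∀ᶠ q in 𝓝 p, h q - h p = n p q - n p p := by
  have h1 (p : I × I) : ∃ ε > 0, ∀ q ∈ Metric.ball p ε, ∀ᶠ r in 𝓝 q,
      n q r - n q q = n p r - n p q := Metric.eventually_nhds_iff_ball.1 (hn p)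
  choose ε hε hball using h1
  -- Lebesgue number: every `δ`-ball lies in the domain of one local function, the one with centre
  -- `c x`.
  obtain ⟨δ, hδ, hL⟩ := lebesgue_number_lemma_of_metric (isCompact_univ (X := I × I))
    (c := fun p => Metric.ball p (ε p)) (fun _ => Metric.isOpen_ball)
    (fun p _ => mem_iUnion.2 ⟨p, Metric.mem_ball_self (hε p)⟩)
  choose! c hc using fun x => hL x (mem_univ x)
  have hA (x y q r : I × I) (hq : q ∈ Metric.ball x δ ∩ Metric.ball y δ)
      (hr : r ∈ Metric.ball x δ ∩ Metric.ball y δ) :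
      n (c x) r - n (c x) q = n (c y) r - n (c y) q := by
    have := IsPreconnected.eq_of_eventually_eq (isPreconnected_ball_inter_ball x y δ)
      (k := fun z => n (c x) z - n (c y) z) (fun z hz => by
        filter_upwards [hball _ z (hc x hz.1), hball _ z (hc y hz.2)] with w h1 h2
        rw [sub_eq_sub_iff_sub_eq_sub, ← h1, ← h2]) hq hr
    rw [sub_eq_sub_iff_sub_eq_sub] at this
    rw [← neg_sub, ← neg_sub (n (c y) q), this]
  -- `d p q` is the increment from `p` to `q`, read off from the local function chosen at `p`. It is
  -- additive on triples of mutually `δ`-close points.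
  let d : I × I → I × I → B := fun p q => n (c p) q - n (c p) p
  have hd {p q r : I × I} (h1 : dist p q < δ) (h2 : dist p r < δ) (h3 : dist q r < δ) :
      d p q + d q r = d p r := by
    have := hA p q q r ⟨by rwa [Metric.mem_ball, dist_comm], Metric.mem_ball_self hδ⟩
      ⟨by rwa [Metric.mem_ball, dist_comm], by rwa [Metric.mem_ball, dist_comm]⟩
    simp only [d]
    rw [← this]
    abel
  obtain ⟨N, hN⟩ := exists_nat_gt (2 / δ)
  have hN0 : (0 : ℝ) < N := (by positivity : (0 : ℝ) < 2 / δ).trans hN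
  let κ : ℕ → I := fun i => projIcc 0 1 zero_le_one ((i : ℝ) / N)
  have hκ0 : κ 0 = 0 := by simp [κ]
  have hκN : κ N = 1 := by simp [κ, div_self hN0.ne']
  have hκ (i : ℕ) : dist (κ i) (κ (i + 1)) < δ / 2 := by
    refine (LipschitzWith.projIcc (zero_le_one (α := ℝ))).dist_le_mul _ _ |>.trans_lt ?_
    rw [NNReal.coe_one, one_mul, Real.dist_eq, ← sub_div]
    push_cast
    rw [sub_add_cancel_left, abs_div, abs_neg, abs_one, Nat.abs_cast, div_lt_iff₀ hN0]
    rw [div_lt_iff₀ hδ] at hN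
    linarith
  -- Radial contraction to the corner `(0, 0)` in `N` steps, each shorter than `δ / 2`.
  let π : ℕ → I × I → I × I := fun i p => (κ i * p.1, κ i * p.2)
  have hI1 (s s' a : I) : dist (s * a) (s' * a) ≤ dist s s' := by
    rw [Subtype.dist_eq, Subtype.dist_eq, Real.dist_eq, Real.dist_eq]
    push_cast
    rw [← sub_mul, abs_mul]
    exact mul_le_of_le_one_right (abs_nonneg _) (by rw [abs_of_nonneg a.2.1]; exact a.2.2)
  have hπ1 (i : ℕ) (p) : dist (π i p) (π (i + 1) p) < δ / 2 := by
    rw [Prod.dist_eq]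
    exact max_lt ((hI1 _ _ _).trans_lt (hκ i)) ((hI1 _ _ _).trans_lt (hκ i))
  have hπ2 (i : ℕ) (p q) : dist (π i p) (π i q) ≤ dist p q := by
    simp only [Prod.dist_eq, π]
    rw [mul_comm _ p.1, mul_comm _ q.1, mul_comm _ p.2, mul_comm _ q.2]
    have hI2 (s a b : I) : dist (a * s) (b * s) ≤ dist a b := hI1 a b s
    exact max_le_max (hI2 _ _ _) (hI2 _ _ _)
  -- The glued function adds up the increments along the radial path from the corner to `p`.
  refine ⟨fun p => ∑ i ∈ Finset.range N, d (π i p) (π (i + 1) p), fun p => ?_⟩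
  filter_upwards [hball _ p (hc p (Metric.mem_ball_self hδ)),
    Metric.ball_mem_nhds p (half_pos hδ)] with q hq1 hq2
  rw [Metric.mem_ball, dist_comm] at hq2
  rw [hq1, ← Finset.sum_sub_distrib]
  -- Two radial paths bound a strip of small quadrilaterals. Additivity on the two triangles of each
  -- one makes the difference telescope to the increment `d p q` at the far end, the corner
  -- contributing zero.
  have hkey (i : ℕ) : d (π i q) (π (i + 1) q) - d (π i p) (π (i + 1) p)
      = d (π (i + 1) p) (π (i + 1) q) - d (π i p) (π i q) := by
    have e1 := hπ1 i p
    have e2 := hπ1 i q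
    have e3 := (hπ2 i p q).trans_lt hq2
    have e4 := (hπ2 (i + 1) p q).trans_lt hq2
    have e5 : dist (π i p) (π (i + 1) q) < δ := by
      linarith [dist_triangle (π i p) (π i q) (π (i + 1) q)]
    have f1 := hd (by linarith) e5 (by linarith : dist (π i q) (π (i + 1) q) < δ)
    have f2 := hd (by linarith) e5 (by linarith : dist (π (i + 1) p) (π (i + 1) q) < δ)
    rw [sub_eq_sub_iff_add_eq_add, add_comm (d (π i q) _), f1, add_comm (d (π (i + 1) p) _), f2]
  rw [Finset.sum_congr rfl fun i _ => hkey i,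
    Finset.sum_range_sub (fun i => d (π i p) (π i q))]
  simp [π, hκ0, hκN, d]

end ContouCarrere

end Gluing

/-! ### Derivatives in charts and analytic continuation of primitives -/

section ChartDerivative

namespace ContouCarrere

variable {X : Type*} [TopologicalSpace X] [ChartedSpace ℂ X]

/-- `F : X → V` has derivative `D` at `p`, with respect to the preferred coordinate at `p`. -/
def HasChartDeriv {V : Type*} [NormedAddCommGroup V] [NormedSpace ℂ V] (F : X → V) (D : V)
    (p : X) : Prop :=
  HasDerivAt (fun z => F ((chartAt ℂ p).symm z)) D (chartAt ℂ p p)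

/-- `F : X → V` is complex differentiable at `p`. -/
def ChartDiff {V : Type*} [NormedAddCommGroup V] [NormedSpace ℂ V] (F : X → V) (p : X) : Prop :=
  DifferentiableAt ℂ (fun z => F ((chartAt ℂ p).symm z)) (chartAt ℂ p p)

/-- The coefficient of `dg / g` at `p`, with respect to the preferred coordinate at `p`. -/
noncomputable def dlogAt {A : Type*} [NormedCommRing A] [NormedAlgebra ℂ A] (g : X → A) (p : X) :
    A :=
  deriv (fun z => g ((chartAt ℂ p).symm z)) (chartAt ℂ p p) * Ring.inverse (g p)

section Basic

variable {V : Type*} [NormedAddCommGroup V] [NormedSpace ℂ V] {F G : X → V} {D D' : V} {p : X}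

theorem HasChartDeriv.chartDiff (h : HasChartDeriv F D p) : ChartDiff F p :=
  HasDerivAt.differentiableAt h

theorem ChartDiff.hasChartDeriv (h : ChartDiff F p) :
    HasChartDeriv F (deriv (fun z => F ((chartAt ℂ p).symm z)) (chartAt ℂ p p)) p :=
  DifferentiableAt.hasDerivAt h

theorem HasChartDeriv.sub (h : HasChartDeriv F D p) (h' : HasChartDeriv G D' p) :
    HasChartDeriv (fun x => F x - G x) (D - D') p :=
  HasDerivAt.fun_sub h h'

theorem HasChartDeriv.add_const (h : HasChartDeriv F D p) (c : V) :
    HasChartDeriv (fun x => F x + c) D p :=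
  HasDerivAt.add_const c h

theorem eventually_chartAt_symm {P : X → Prop} (h : ∀ᶠ x in 𝓝 p, P x) :
    ∀ᶠ z in 𝓝 (chartAt ℂ p p), P ((chartAt ℂ p).symm z) := by
  have h1 := (chartAt ℂ p).continuousAt_symm (mem_chart_target ℂ p)
  rw [ContinuousAt, (chartAt ℂ p).left_inv (mem_chart_source ℂ p)] at h1
  exact h1.eventually h

theorem eventually_of_chartAt_symm {P : X → Prop}
    (h : ∀ᶠ z in 𝓝 (chartAt ℂ p p), P ((chartAt ℂ p).symm z)) : ∀ᶠ x in 𝓝 p, P x := by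
  have h1 := (chartAt ℂ p).continuousAt (mem_chart_source ℂ p)
  filter_upwards [h1.eventually h, (chartAt ℂ p).open_source.mem_nhds (mem_chart_source ℂ p)]
    with x hx hx'
  rwa [(chartAt ℂ p).left_inv hx'] at hx

theorem HasChartDeriv.continuousAt (h : HasChartDeriv F D p) : ContinuousAt F p := by
  have h1 : ContinuousAt (fun z => F ((chartAt ℂ p).symm z)) (chartAt ℂ p p) :=
    HasDerivAt.continuousAt h
  have h2 := h1.comp ((chartAt ℂ p).continuousAt (mem_chart_source ℂ p))
  refine h2.congr ?_
  filter_upwards [(chartAt ℂ p).open_source.mem_nhds (mem_chart_source ℂ p)] with x hx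
  simp [(chartAt ℂ p).left_inv hx]

theorem contDiffAt_transition {e e' : OpenPartialHomeomorph X ℂ}
    (he : e ∈ IsManifold.maximalAtlas 𝓘(ℂ) ω X) (he' : e' ∈ IsManifold.maximalAtlas 𝓘(ℂ) ω X)
    (hp : p ∈ e.source) (hp' : p ∈ e'.source) :
    ContDiffAt ℂ ω (fun z => e (e'.symm z)) (e' p) := by
  rw [← contMDiffAt_iff_contDiffAt]
  have h1 := contMDiffAt_symm_of_mem_maximalAtlas he' (e'.map_source hp')
  have h2 : ContMDiffAt 𝓘(ℂ) 𝓘(ℂ) ω e (e'.symm (e' p)) := by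
    rw [e'.left_inv hp']
    exact contMDiffAt_of_mem_maximalAtlas he hp
  exact h2.comp (e' p) h1

/-- `chartAt ℂ p` varies with `p`, so derivatives at all points of a neighbourhood must be carried
to one chart. They transform by the derivative of the transition map, which is also how coefficients
of one-forms transform. -/
theorem hasDerivAt_comp_symm_of_mem_maximalAtlas {e e' : OpenPartialHomeomorph X ℂ}
    (he : e ∈ IsManifold.maximalAtlas 𝓘(ℂ) ω X) (he' : e' ∈ IsManifold.maximalAtlas 𝓘(ℂ) ω X)
    (hp : p ∈ e.source) (hp' : p ∈ e'.source)
    (h : HasDerivAt (fun z => F (e.symm z)) D (e p)) :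
    HasDerivAt (fun z => F (e'.symm z)) (deriv (fun z => e (e'.symm z)) (e' p) • D) (e' p) := by
  have h1 : HasDerivAt (fun z => e (e'.symm z)) (deriv (fun z => e (e'.symm z)) (e' p)) (e' p) :=
    ((contDiffAt_transition he he' hp hp').differentiableAt (by simp)).hasDerivAt
  have h2 := h.scomp_of_eq (e' p) h1 (by rw [e'.left_inv hp'])
  refine h2.congr_of_eventuallyEq ?_
  have h3 : ∀ᶠ z in 𝓝 (e' p), e'.symm z ∈ e.source := by
    have h4 := e'.continuousAt_symm (e'.map_source hp')
    rw [ContinuousAt, e'.left_inv hp'] at h4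
    exact h4.eventually (e.open_source.mem_nhds hp)
  filter_upwards [h3] with z hz
  simp [e.left_inv hz]

variable [IsManifold 𝓘(ℂ) ω X]

theorem HasChartDeriv.hasDerivAt_symm {e : OpenPartialHomeomorph X ℂ}
    (he : e ∈ IsManifold.maximalAtlas 𝓘(ℂ) ω X) (hp : p ∈ e.source) (h : HasChartDeriv F D p) :
    HasDerivAt (fun z => F (e.symm z)) (deriv (fun z => chartAt ℂ p (e.symm z)) (e p) • D) (e p) :=
  hasDerivAt_comp_symm_of_mem_maximalAtlas (IsManifold.chart_mem_maximalAtlas p) he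
    (mem_chart_source ℂ p) hp h

theorem hasChartDeriv_of_hasDerivAt_symm {e : OpenPartialHomeomorph X ℂ}
    (he : e ∈ IsManifold.maximalAtlas 𝓘(ℂ) ω X) (hp : p ∈ e.source)
    (h : HasDerivAt (fun z => F (e.symm z)) D (e p)) :
    HasChartDeriv F (deriv (fun z => e ((chartAt ℂ p).symm z)) (chartAt ℂ p p) • D) p :=
  hasDerivAt_comp_symm_of_mem_maximalAtlas he (IsManifold.chart_mem_maximalAtlas p) hp
    (mem_chart_source ℂ p) h

/-- Vanishing of the derivative is independent of the chart, so it can be tested on a disc in one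
chart, which is convex. -/
theorem eventually_eq_of_hasChartDeriv_zero (h : ∀ᶠ x in 𝓝 p, HasChartDeriv F 0 x) :
    ∀ᶠ x in 𝓝 p, F x = F p := by
  apply eventually_of_chartAt_symm
  have h1 := (eventually_chartAt_symm h).and
    ((chartAt ℂ p).open_target.mem_nhds (mem_chart_target ℂ p))
  obtain ⟨ε, hε, hball⟩ := Metric.eventually_nhds_iff_ball.1 h1
  filter_upwards [Metric.ball_mem_nhds _ hε] with z hz
  have h2 (z) (hz : z ∈ Metric.ball (chartAt ℂ p p) ε) :
      HasDerivAt (fun z => F ((chartAt ℂ p).symm z)) 0 z := by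
    obtain ⟨h3, h4⟩ := hball z hz
    have h5 := h3.hasDerivAt_symm (IsManifold.chart_mem_maximalAtlas p)
      ((chartAt ℂ p).map_target h4)
    rwa [(chartAt ℂ p).right_inv h4, smul_zero] at h5
  have h6 := (convex_ball (chartAt ℂ p p) ε).is_const_of_fderivWithin_eq_zero (𝕜 := ℂ)
    (f := fun z => F ((chartAt ℂ p).symm z))
    (fun z hz => (h2 z hz).differentiableAt.differentiableWithinAt)
    (fun z hz => by
      rw [fderivWithin_of_isOpen Metric.isOpen_ball hz]
      simpa using (h2 z hz).hasFDerivAt.fderiv)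
    hz (Metric.mem_ball_self hε)
  simpa [(chartAt ℂ p).left_inv (mem_chart_source ℂ p)] using h6

end Basic

section GermField

/-- A family of functions near the points `k p`, depending on `p` in such a way that its germs form
a section of the sheaf of germs pulled back along `k`. -/
def IsGermField {T V : Type*} [TopologicalSpace T] (k : T → X) (G : T → X → V) : Prop :=
  ∀ p, ∀ᶠ q in 𝓝 p, G q =ᶠ[𝓝 (k q)] G p

/-- The principle behind all the invariance statements below: a locally constant germ, continued
over a connected parameter space, keeps its value. -/
theorem IsGermField.eq_of_hasChartDeriv_zero [IsManifold 𝓘(ℂ) ω X] {T V : Type*}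
    [TopologicalSpace T] [PreconnectedSpace T] [NormedAddCommGroup V] [NormedSpace ℂ V]
    {k : T → X} (hk : Continuous k) {G : T → X → V}
    (hG : IsGermField k G) (h0 : ∀ p, ∀ᶠ x in 𝓝 (k p), HasChartDeriv (G p) 0 x) (p q : T) :
    G p (k p) = G q (k q) := by
  refine IsPreconnected.eq_of_eventually_eq (k := fun p => G p (k p)) isPreconnected_univ
    (fun p _ => ?_) (mem_univ p) (mem_univ q)
  filter_upwards [hG p, hk.continuousAt.eventually (eventually_eq_of_hasChartDeriv_zero (h0 p))]
    with q h1 h2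
  rw [← h2, h1.self_of_nhds]

variable {A : Type*} [NormedCommRing A] [NormedAlgebra ℂ A] [CompleteSpace A]

/-- In the chart at `y` the form `u dg / g` is holomorphic on a disc, hence exact there. Passing to
the charts at nearby points multiplies both sides by the same transition derivative. -/
theorem exists_local_primitive [IsManifold 𝓘(ℂ) ω X] {u g : X → A} {y : X}
    (hu : ∀ᶠ x in 𝓝 y, ChartDiff u x) (hg : ∀ᶠ x in 𝓝 y, ChartDiff g x ∧ IsUnit (g x)) :
    ∃ N : X → A, ∀ᶠ x in 𝓝 y, HasChartDeriv N (u x * dlogAt g x) x := by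
  set φ := chartAt ℂ y with hφ
  have hφm : φ ∈ IsManifold.maximalAtlas 𝓘(ℂ) ω X := IsManifold.chart_mem_maximalAtlas y
  obtain ⟨ε, hε, hball⟩ := Metric.eventually_nhds_iff_ball.1
    ((eventually_chartAt_symm (hu.and hg)).and (φ.open_target.mem_nhds (mem_chart_target ℂ y)))
  set B := Metric.ball (φ y) ε
  have hd {F : X → A} {z : ℂ} (hz : z ∈ B) (h : ChartDiff F (φ.symm z)) :
      DifferentiableAt ℂ (fun z => F (φ.symm z)) z := by
    have h1 := (h.hasChartDeriv.hasDerivAt_symm hφm (φ.map_target (hball z hz).2)).differentiableAt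
    rwa [φ.right_inv (hball z hz).2] at h1
  have hgd : DifferentiableOn ℂ (fun z => g (φ.symm z)) B := fun z hz =>
    (hd hz (hball z hz).1.2.1).differentiableWithinAt
  have hud : DifferentiableOn ℂ (fun z => u (φ.symm z)) B := fun z hz =>
    (hd hz (hball z hz).1.1).differentiableWithinAt
  obtain ⟨W, hW⟩ := DifferentiableOn.isExactOn_ball
    (hud.fun_mul ((hgd.deriv Metric.isOpen_ball).fun_mul
      (hgd.inverse fun z hz => (hball z hz).1.2.2)))
  refine ⟨fun x => W (φ x), ?_⟩
  apply eventually_of_chartAt_symm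
  filter_upwards [Metric.ball_mem_nhds _ hε] with z hz
  have hzt := (hball z hz).2
  have h1 : HasDerivAt (fun z => W (φ (φ.symm z)))
      (u (φ.symm z) * (deriv (fun z => g (φ.symm z)) z * Ring.inverse (g (φ.symm z)))) z := by
    refine (hW z hz).congr_of_eventuallyEq ?_
    filter_upwards [φ.open_target.mem_nhds hzt] with w hw
    rw [φ.right_inv hw]
  have h2 := (hgd.differentiableAt (Metric.isOpen_ball.mem_nhds hz)).hasDerivAt
  rw [← φ.right_inv hzt] at h1 h2
  rw [φ.left_inv (φ.map_target hzt)] at h1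
  have h3 := hasChartDeriv_of_hasDerivAt_symm (F := fun x => W (φ x)) hφm (φ.map_target hzt) h1
  have h4 := hasChartDeriv_of_hasDerivAt_symm (F := g) hφm (φ.map_target hzt) h2
  unfold HasChartDeriv at h4
  rw [dlogAt, h4.deriv]
  convert h3 using 1
  simp only [smul_mul_assoc, mul_smul_comm]
  rfl

/-- Analytic continuation, along a map from the square, of a primitive of `u * dg / g`. -/
theorem exists_primitive_along [IsManifold 𝓘(ℂ) ω X] {k : I × I → X} (hk : Continuous k)
    {u : I × I → X → A} (hu : IsGermField k u) (hud : ∀ p, ∀ᶠ x in 𝓝 (k p), ChartDiff (u p) x)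
    {g : X → A} (hg : ∀ p, ∀ᶠ x in 𝓝 (k p), ChartDiff g x ∧ IsUnit (g x)) :
    ∃ M : I × I → X → A, IsGermField k M ∧
      ∀ p, ∀ᶠ x in 𝓝 (k p), HasChartDeriv (M p) (u p x * dlogAt g x) x := by
  choose N hN using fun p => exists_local_primitive (hud p) (hg p)
  -- Two local primitives of the same form differ by a local constant; this is the compatibility
  -- needed for gluing.
  have h1 (p) : ∀ᶠ q in 𝓝 p, ∀ᶠ x in 𝓝 (k q), N q x - N q (k q) = N p x - N p (k q) := by
    filter_upwards [hu p, hk.continuousAt.eventually (hN p).eventually_nhds] with q h2 h3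
    have h4 : ∀ᶠ x in 𝓝 (k q), HasChartDeriv (fun x => N q x - N p x) 0 x := by
      filter_upwards [h2, h3, hN q] with x e1 e2 e3
      have := e3.sub e2
      rwa [e1, sub_self] at this
    filter_upwards [eventually_eq_of_hasChartDeriv_zero h4] with x hx
    rw [sub_eq_sub_iff_sub_eq_sub, hx]
  obtain ⟨h, hh⟩ := exists_glue_of_locally_compatible (fun p q => N p (k q))
    (fun p => (h1 p).mono fun q hq => hk.continuousAt.eventually hq)
  -- Each local primitive is shifted so that its value at `k p` is the glued value `h p`.
  refine ⟨fun p x => N p x + (h p - N p (k p)), fun p => ?_, fun p => ?_⟩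
  · filter_upwards [h1 p, hh p] with q e1 e2
    filter_upwards [e1] with x e3
    linear_combination e3 + e2
  · exact (hN p).mono fun x hx => hx.add_const _

end GermField

end ContouCarrere

end ChartDerivative

/-! ### Iterated integrals under free homotopy -/

section LoopInvariance

namespace ContouCarrere

variable {X : Type*} [TopologicalSpace X]

/-- The path `t ↦ H (s, t)`, extended to the real line by constants. -/
noncomputable def rowPath (H : I × I → X) (s : I) (t : ℝ) : X := H (s, projIcc 0 1 zero_le_one t)

theorem continuous_rowPath {H : I × I → X} (hH : Continuous H) (s : I) :
    Continuous (rowPath H s) :=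
  hH.comp (Continuous.prodMk continuous_const continuous_projIcc)

variable [ChartedSpace ℂ X]

theorem HasChartDeriv.comp_path {V : Type*} [NormedAddCommGroup V] [NormedSpace ℂ V]
    {F : X → V} {D : V} {γ : ℝ → X} {t : ℝ}
    (hF : HasChartDeriv F D (γ t)) (hc : ContinuousAt γ t)
    (hd : DifferentiableAt ℝ (fun t' => chartAt ℂ (γ t) (γ t')) t) :
    HasDerivAt (fun t' => F (γ t')) (deriv (fun t' => chartAt ℂ (γ t) (γ t')) t • D) t := by
  have h1 := HasDerivAt.scomp (h := fun t' => chartAt ℂ (γ t) (γ t')) t hF hd.hasDerivAt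
  refine h1.congr_of_eventuallyEq ?_
  filter_upwards [hc.eventually ((chartAt ℂ (γ t)).open_source.mem_nhds (mem_chart_source ℂ _))]
    with t' ht'
  simp [(chartAt ℂ (γ t)).left_inv ht']

variable {A : Type*} [NormedCommRing A] [NormedAlgebra ℂ A] [Module.Finite ℂ A]

theorem dlogAlong_eq {f : X → A} {γ : ℝ → X} {t : ℝ} (hf : ChartDiff f (γ t))
    (hc : ContinuousAt γ t) (hd : DifferentiableAt ℝ (fun t' => chartAt ℂ (γ t) (γ t')) t) :
    dlogAlong f γ t = deriv (fun t' => chartAt ℂ (γ t) (γ t')) t • dlogAt f (γ t) := by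
  rw [dlogAlong, derivA_eq (hf.hasChartDeriv.comp_path hc hd), dlogAt, smul_mul_assoc]

theorem intervalIntegral_const_mul {v : ℝ → A} {c d : ℝ}
    (hv : IntervalIntegrable v MeasureTheory.volume c d) (a : A) :
    ∫ t in c..d, a * v t = a * ∫ t in c..d, v t := by
  have : CompleteSpace A := FiniteDimensional.complete ℂ A
  exact (ContinuousLinearMap.mul ℝ A a).intervalIntegral_comp_comm hv

theorem iteratedIntegral_eq {u v L : ℝ → A}
    (hu : IntervalIntegrable u MeasureTheory.volume 0 1)
    (hv : IntervalIntegrable v MeasureTheory.volume 0 1)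
    (hLc : ContinuousOn L (Icc 0 1)) (hL : ∀ t ∈ Icc (0 : ℝ) 1, ∫ t' in (0 : ℝ)..t, u t' = L t - L 0) :
    iteratedIntegral u v = (∫ t in (0 : ℝ)..1, L t * v t) - L 0 * ∫ t in (0 : ℝ)..1, v t := by
  have hI : uIcc (0 : ℝ) 1 = Icc 0 1 := uIcc_of_le zero_le_one
  have h1 (t : ℝ) (ht : t ∈ uIcc (0 : ℝ) 1) : integralA u 0 t * v t = (L t - L 0) * v t := by
    rw [integralA_eq (hu.mono_set (uIcc_subset_uIcc_left ht)), hL t (hI ▸ ht)]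
  have h2 : IntervalIntegrable (fun t => (L t - L 0) * v t) MeasureTheory.volume 0 1 :=
    hv.continuousOn_mul (by rw [hI]; exact hLc.sub continuousOn_const)
  have h3 : IntervalIntegrable (fun t => L t * v t) MeasureTheory.volume 0 1 :=
    hv.continuousOn_mul (by rw [hI]; exact hLc)
  unfold iteratedIntegral
  rw [integralA_eq (h2.congr fun t ht => (h1 t (uIoc_subset_uIcc ht)).symm), intervalIntegral.integral_congr h1]
  simp_rw [sub_mul]
  rw [intervalIntegral.integral_sub h3 (hv.const_mul _), intervalIntegral_const_mul hv]

/-- The path `γ` is differentiable outside a countable set. -/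
def IsAlmostDifferentiable (γ : ℝ → X) : Prop :=
  ∃ Z : Set ℝ, Z.Countable ∧
    ∀ t ∈ Ioo (0 : ℝ) 1 \ Z, DifferentiableAt ℝ (fun t' => chartAt ℂ (γ t) (γ t')) t

theorem IsGermField.continuous_eval {T V : Type*} [TopologicalSpace T] [NormedAddCommGroup V]
    [NormedSpace ℂ V] {k : T → X} (hk : Continuous k) {G : T → X → V} (hG : IsGermField k G)
    (hd : ∀ p, ∀ᶠ x in 𝓝 (k p), ChartDiff (G p) x) : Continuous fun p => G p (k p) := by
  rw [continuous_iff_continuousAt]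
  intro p
  refine ContinuousAt.congr (f := fun q => G p (k q)) ?_ ?_
  · exact ContinuousAt.comp (g := G p) (hd p).self_of_nhds.hasChartDeriv.continuousAt
      hk.continuousAt
  · exact (hG p).mono fun q hq => hq.self_of_nhds.symm

theorem hasDerivAt_eval_rowPath {H : I × I → X} (hH : Continuous H)
    {u M : I × I → X → A} (hM : IsGermField H M) {g : X → A}
    (hMd : ∀ p, ∀ᶠ x in 𝓝 (H p), HasChartDeriv (M p) (u p x * dlogAt g x) x)
    (hg : ∀ p, ∀ᶠ x in 𝓝 (H p), ChartDiff g x ∧ IsUnit (g x)) (s : I) {t : ℝ}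
    (hd : DifferentiableAt ℝ
      (fun t' => chartAt ℂ (rowPath H s t) (rowPath H s t')) t) :
    HasDerivAt (fun t => M (s, projIcc 0 1 zero_le_one t) (rowPath H s t))
      (u (s, projIcc 0 1 zero_le_one t) (rowPath H s t) * dlogAlong g (rowPath H s) t) t := by
  set p : I × I := (s, projIcc 0 1 zero_le_one t)
  have hc := (continuous_rowPath hH s).continuousAt (x := t)
  have h1 : HasChartDeriv (M p) (u p (rowPath H s t) * dlogAt g (rowPath H s t)) (rowPath H s t) :=
    (hMd p).self_of_nhds
  have h2 := h1.comp_path hc hd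
  rw [dlogAlong_eq (hg p).self_of_nhds.1 hc hd, mul_smul_comm]
  refine h2.congr_of_eventuallyEq ?_
  have h3 : ContinuousAt (fun t => (s, projIcc (0 : ℝ) 1 zero_le_one t)) t :=
    (Continuous.prodMk continuous_const continuous_projIcc).continuousAt
  filter_upwards [h3.eventually (hM p)] with t' ht'
  exact ht'.self_of_nhds

/-- The fundamental theorem of calculus for a continuous function differentiable off a countable
set, which accommodates the corners of a piecewise smooth loop. -/
theorem integral_eq_eval_sub {H : I × I → X} (hH : Continuous H)
    {u M : I × I → X → A} (hM : IsGermField H M) {g : X → A}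
    (hMd : ∀ p, ∀ᶠ x in 𝓝 (H p), HasChartDeriv (M p) (u p x * dlogAt g x) x)
    (hu : Continuous fun p => u p (H p))
    (hg : ∀ p, ∀ᶠ x in 𝓝 (H p), ChartDiff g x ∧ IsUnit (g x)) (s : I)
    (hγ : IsAlmostDifferentiable (rowPath H s))
    (hi : IntervalIntegrable (dlogAlong g (rowPath H s)) MeasureTheory.volume 0 1)
    {t : ℝ} (ht : t ∈ Icc (0 : ℝ) 1) :
    ∫ t' in (0 : ℝ)..t, u (s, projIcc 0 1 zero_le_one t') (rowPath H s t') *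
        dlogAlong g (rowPath H s) t'
      = M (s, projIcc 0 1 zero_le_one t) (rowPath H s t)
        - M (s, projIcc 0 1 zero_le_one 0) (rowPath H s 0) := by
  have : CompleteSpace A := FiniteDimensional.complete ℂ A
  obtain ⟨Z, hZ, hd⟩ := hγ
  have hr : Continuous fun t : ℝ => (s, projIcc (0 : ℝ) 1 zero_le_one t) :=
    Continuous.prodMk continuous_const continuous_projIcc
  refine MeasureTheory.integral_eq_of_hasDerivAt_off_countable_of_le
    (fun t => M (s, projIcc 0 1 zero_le_one t) (rowPath H s t)) _ ht.1 hZ ?_ ?_ ?_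
  · exact ((hM.continuous_eval hH fun p => (hMd p).mono fun x hx => hx.chartDiff).comp
      hr).continuousOn
  · exact fun t' ht' => hasDerivAt_eval_rowPath hH hM hMd hg s
      (hd t' ⟨⟨ht'.1.1, ht'.1.2.trans_le ht.2⟩, ht'.2⟩)
  · refine IntervalIntegrable.continuousOn_mul (hi.mono_set ?_) (hu.comp hr).continuousOn
    exact uIcc_subset_uIcc_left (by rwa [uIcc_of_le zero_le_one])

/-- With `L` a primitive of `df / f`, the product `f * exp (-L)` has zero derivative, so its value
is constant over the square. -/
theorem exists_exp_eq_of_log_primitive [IsManifold 𝓘(ℂ) ω X] {H : I × I → X} (hH : Continuous H)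
    {L : I × I → X → A} (hL : IsGermField H L) {f : X → A}
    (hLd : ∀ p, ∀ᶠ x in 𝓝 (H p), HasChartDeriv (L p) (dlogAt f x) x)
    (hf : ∀ p, ∀ᶠ x in 𝓝 (H p), ChartDiff f x ∧ IsUnit (f x)) (p q : I × I) :
    f (H q) = f (H p) * NormedSpace.exp (L q (H q) - L p (H p)) := by
  have : CompleteSpace A := FiniteDimensional.complete ℂ A
  have h1 : IsGermField H fun p x => f x * NormedSpace.exp (-L p x) := fun p =>
    (hL p).mono fun q hq => hq.mono fun x hx => by simp only [hx]
  have h2 := h1.eq_of_hasChartDeriv_zero hH (fun p => by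
    filter_upwards [hLd p, hf p] with x h3 h4
    have h5 := HasDerivAt.fun_mul h4.1.hasChartDeriv (hasDerivAt_exp (HasDerivAt.neg h3))
    refine HasDerivAt.congr_deriv h5 ?_
    have h6 : f ((chartAt ℂ x).symm (chartAt ℂ x x)) = f x := by
      rw [(chartAt ℂ x).left_inv (mem_chart_source ℂ x)]
    rw [h6, dlogAt, mul_neg, mul_neg, mul_left_comm, mul_comm (f x), mul_assoc,
      Ring.inverse_mul_cancel _ h4.2]
    simp only [Pi.neg_apply]
    ring) p q
  rw [sub_eq_add_neg, exp_add', mul_left_comm, h2, mul_left_comm, exp_mul_exp_neg, mul_one]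

/-- The dependence of the periods and the iterated integral of `df / f` and `dg / g` on a loop, under
free homotopy. -/
theorem exists_iteratedIntegral_eq_of_homotopy [IsManifold 𝓘(ℂ) ω X] {H : I × I → X}
    (hH : Continuous H) (hloop : ∀ s, H (s, 0) = H (s, 1)) {f g : X → A}
    (hf : ∀ p, ∀ᶠ x in 𝓝 (H p), ChartDiff f x ∧ IsUnit (f x))
    (hg : ∀ p, ∀ᶠ x in 𝓝 (H p), ChartDiff g x ∧ IsUnit (g x))
    (hd0 : IsAlmostDifferentiable (rowPath H 0)) (hd1 : IsAlmostDifferentiable (rowPath H 1))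
    (hf0 : IntervalIntegrable (dlogAlong f (rowPath H 0)) MeasureTheory.volume 0 1)
    (hf1 : IntervalIntegrable (dlogAlong f (rowPath H 1)) MeasureTheory.volume 0 1)
    (hg0 : IntervalIntegrable (dlogAlong g (rowPath H 0)) MeasureTheory.volume 0 1)
    (hg1 : IntervalIntegrable (dlogAlong g (rowPath H 1)) MeasureTheory.volume 0 1) :
    ∃ Λf Λg : A,
      f (H (1, 0)) = f (H (0, 0)) * NormedSpace.exp Λf ∧
      g (H (1, 0)) = g (H (0, 0)) * NormedSpace.exp Λg ∧
      ∫ t in (0 : ℝ)..1, dlogAlong f (rowPath H 0) t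
        = ∫ t in (0 : ℝ)..1, dlogAlong f (rowPath H 1) t ∧
      ∫ t in (0 : ℝ)..1, dlogAlong g (rowPath H 0) t
        = ∫ t in (0 : ℝ)..1, dlogAlong g (rowPath H 1) t ∧
      iteratedIntegral (dlogAlong f (rowPath H 1)) (dlogAlong g (rowPath H 1))
        = iteratedIntegral (dlogAlong f (rowPath H 0)) (dlogAlong g (rowPath H 0))
          + (∫ t in (0 : ℝ)..1, dlogAlong f (rowPath H 0) t) * Λg
          - (∫ t in (0 : ℝ)..1, dlogAlong g (rowPath H 0) t) * Λf := by
  have : CompleteSpace A := FiniteDimensional.complete ℂ A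
  have hone : IsGermField H fun _ _ => (1 : A) := fun p => .of_forall fun q => .rfl
  have honed : ∀ p, ∀ᶠ x in 𝓝 (H p), ChartDiff (fun _ => (1 : A)) x := fun p =>
    .of_forall fun x => differentiableAt_const _
  -- `F` and `G` continue `log f` and `log g`; `M` continues the primitive of `F dg / g`.
  obtain ⟨F, hF, hFd⟩ := exists_primitive_along hH hone honed hf
  obtain ⟨G, hG, hGd⟩ := exists_primitive_along hH hone honed hg
  obtain ⟨M, hM, hMd⟩ := exists_primitive_along hH hF
    (fun p => (hFd p).mono fun x hx => hx.chartDiff) hg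
  have hFc := hF.continuous_eval hH fun p => (hFd p).mono fun x hx => hx.chartDiff
  have hk : Continuous fun s : I => H (s, 0) :=
    hH.comp (Continuous.prodMk continuous_id continuous_const)
  have hc0 (s : I) : ContinuousAt (fun s : I => (s, (0 : I))) s := by fun_prop
  have hc1 (s : I) : ContinuousAt (fun s : I => (s, (1 : I))) s := by fun_prop
  -- The sides `t = 0` and `t = 1` of the square trace the same path in `X`. The difference of the
  -- two continuations along it has derivative zero, so periods do not depend on `s`.
  have hper {L : I × I → X → A} {f : X → A} (hL : IsGermField H L)
      (hLd : ∀ p, ∀ᶠ x in 𝓝 (H p), HasChartDeriv (L p) (1 * dlogAt f x) x) (s s' : I) :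
      L (s, 1) (H (s, 1)) - L (s, 0) (H (s, 0)) = L (s', 1) (H (s', 1)) - L (s', 0) (H (s', 0)) := by
    have h1 : IsGermField (fun s : I => H (s, 0)) fun s x => L (s, 1) x - L (s, 0) x := by
      intro s
      filter_upwards [(hc0 s).eventually (hL (s, 0)), (hc1 s).eventually (hL (s, 1))]
        with s' h2 h3
      rw [← hloop] at h3
      filter_upwards [h2, h3] with x h4 h5
      rw [h4, h5]
    have h2 := h1.eq_of_hasChartDeriv_zero hk (fun s => by
      have h3 := hLd (s, 1)
      rw [← hloop] at h3
      filter_upwards [hLd (s, 0), h3] with x h4 h5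
      simpa using h5.sub h4) s s'
    simpa only [hloop] using h2
  -- The jump of `M` has derivative `c dg / g`, with `c` the period of `f`. Only after subtracting
  -- `c * G` does it become constant; this is where the correction term in `Λg` arises.
  have hperM (s s' : I) :
      M (s, 1) (H (s, 1)) - M (s, 0) (H (s, 0))
          - (F (0, 1) (H (0, 1)) - F (0, 0) (H (0, 0))) * G (s, 0) (H (s, 0))
        = M (s', 1) (H (s', 1)) - M (s', 0) (H (s', 0))
          - (F (0, 1) (H (0, 1)) - F (0, 0) (H (0, 0))) * G (s', 0) (H (s', 0)) := by
    set c := F (0, 1) (H (0, 1)) - F (0, 0) (H (0, 0)) with hcdef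
    have h1 : IsGermField (fun s : I => H (s, 0))
        fun s x => M (s, 1) x - M (s, 0) x - c * G (s, 0) x := by
      intro s
      filter_upwards [(hc0 s).eventually (hM (s, 0)), (hc1 s).eventually (hM (s, 1)),
        (hc0 s).eventually (hG (s, 0))] with s' h2 h3 h6
      rw [← hloop] at h3
      filter_upwards [h2, h3, h6] with x h4 h5 h7
      rw [h4, h5, h7]
    have h2 := h1.eq_of_hasChartDeriv_zero hk (fun s => by
      have h3 := hMd (s, 1)
      have h3' := hFd (s, 1)
      rw [← hloop] at h3 h3'
      have h8 := eventually_eq_of_hasChartDeriv_zero (F := fun x => F (s, 1) x - F (s, 0) x) (by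
        filter_upwards [h3', hFd (s, 0)] with x e1 e2
        simpa using e1.sub e2)
      filter_upwards [hMd (s, 0), h3, hGd (s, 0), h8] with x h4 h5 h6 h7
      have h9 : HasChartDeriv (fun x => c * G (s, 0) x) (c * (1 * dlogAt g x)) x :=
        HasDerivAt.const_mul c h6
      have h10 := (h5.sub h4).sub h9
      have h11 : F (s, 1) x - F (s, 0) x = c := by
        rw [h7, hcdef, ← hper hF hFd s 0, ← hloop]
      convert h10 using 1
      linear_combination (-dlogAt g x) * h11) s s'
    simpa only [hloop] using h2
  have hr0 (s : I) : rowPath H s 0 = H (s, 0) := by simp [rowPath]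
  have hr1 (s : I) : rowPath H s 1 = H (s, 1) := by simp [rowPath]
  have hp0 : projIcc (0 : ℝ) 1 zero_le_one 0 = 0 := projIcc_left _
  have hp1 : projIcc (0 : ℝ) 1 zero_le_one 1 = 1 := projIcc_right _
  have hintF (s : I) (hd : IsAlmostDifferentiable (rowPath H s))
      (hi : IntervalIntegrable (dlogAlong f (rowPath H s)) MeasureTheory.volume 0 1)
      (t : ℝ) (ht : t ∈ Icc (0 : ℝ) 1) :
      ∫ t' in (0 : ℝ)..t, dlogAlong f (rowPath H s) t'
        = F (s, projIcc 0 1 zero_le_one t) (rowPath H s t)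
          - F (s, projIcc 0 1 zero_le_one 0) (rowPath H s 0) := by
    have := integral_eq_eval_sub hH hF hFd continuous_const hf s hd hi ht
    simpa only [one_mul] using this
  have hintG (s : I) (hd : IsAlmostDifferentiable (rowPath H s))
      (hi : IntervalIntegrable (dlogAlong g (rowPath H s)) MeasureTheory.volume 0 1) :
      ∫ t' in (0 : ℝ)..1, dlogAlong g (rowPath H s) t'
        = G (s, 1) (H (s, 1)) - G (s, 0) (H (s, 0)) := by
    have := integral_eq_eval_sub hH hG hGd continuous_const hg s hd hi (right_mem_Icc.2 zero_le_one)
    simpa only [one_mul, hp0, hp1, hr0, hr1] using this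
  have hintF1 (s : I) (hd : IsAlmostDifferentiable (rowPath H s))
      (hi : IntervalIntegrable (dlogAlong f (rowPath H s)) MeasureTheory.volume 0 1) :
      ∫ t' in (0 : ℝ)..1, dlogAlong f (rowPath H s) t'
        = F (s, 1) (H (s, 1)) - F (s, 0) (H (s, 0)) := by
    simpa only [hp0, hp1, hr0, hr1] using hintF s hd hi 1 (right_mem_Icc.2 zero_le_one)
  have hiter (s : I) (hd : IsAlmostDifferentiable (rowPath H s))
      (hif : IntervalIntegrable (dlogAlong f (rowPath H s)) MeasureTheory.volume 0 1)
      (hig : IntervalIntegrable (dlogAlong g (rowPath H s)) MeasureTheory.volume 0 1) :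
      iteratedIntegral (dlogAlong f (rowPath H s)) (dlogAlong g (rowPath H s))
        = M (s, 1) (H (s, 1)) - M (s, 0) (H (s, 0))
          - F (s, 0) (H (s, 0)) * (G (s, 1) (H (s, 1)) - G (s, 0) (H (s, 0))) := by
    have h1 := integral_eq_eval_sub hH hM hMd hFc hg s hd hig (right_mem_Icc.2 zero_le_one)
    simp only [hp0, hp1, hr0, hr1] at h1
    rw [iteratedIntegral_eq hif hig (hFc.comp (Continuous.prodMk continuous_const
      continuous_projIcc)).continuousOn (hintF s hd hif), hintG s hd hig]
    simp only [Function.comp_apply, hp0]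
    rw [← h1]
    rfl
  refine ⟨F (1, 0) (H (1, 0)) - F (0, 0) (H (0, 0)), G (1, 0) (H (1, 0)) - G (0, 0) (H (0, 0)),
    ?_, ?_, ?_, ?_, ?_⟩
  · exact exists_exp_eq_of_log_primitive hH hF (by simpa only [one_mul] using hFd) hf _ _
  · exact exists_exp_eq_of_log_primitive hH hG (by simpa only [one_mul] using hGd) hg _ _
  · rw [hintF1 0 hd0 hf0, hintF1 1 hd1 hf1, hper hF hFd]
  · rw [hintG 0 hd0 hg0, hintG 1 hd1 hg1, hper hG hGd]
  · rw [hiter 0 hd0 hf0 hg0, hiter 1 hd1 hf1 hg1, hintF1 0 hd0 hf0, hintG 0 hd0 hg0]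
    have h1 := hperM 0 1
    have h2 := hper hG hGd 0 1
    linear_combination F (1, 0) (H (1, 0)) * h2 - h1

end ContouCarrere

end LoopInvariance

/-! ### The double product as the exponential of a finite sum -/

section DoubleProduct

namespace ContouCarrere

/-- The coefficients `∑_{j ∣ n} j α_j ^ (n / j)` of `- x U' / U` for `U = ∏ (1 - α_j x ^ j)`. -/
def dlogCoeff {A : Type*} [CommRing A] (α : ℕ → A) (n : ℕ) : A :=
  ∑ j ∈ n.divisors, (j : A) * α j ^ (n / j)

theorem sum_Icc_filter_dvd {B : Type*} [AddCommMonoid B] {m : ℕ} (hm : 0 < m) (M : ℕ)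
    (F : ℕ → B) :
    ∑ n ∈ Finset.Icc 1 M with m ∣ n, F n = ∑ t ∈ Finset.Icc 1 (M / m), F (t * m) := by
  symm
  refine Finset.sum_bij (fun t _ => t * m) ?_ ?_ ?_ fun _ _ => rfl
  · intro t ht
    rw [Finset.mem_Icc] at ht
    rw [Finset.mem_filter, Finset.mem_Icc]
    exact ⟨⟨Nat.mul_pos ht.1 hm, (Nat.le_div_iff_mul_le hm).1 ht.2⟩, dvd_mul_left _ _⟩
  · exact fun t _ t' _ h => Nat.eq_of_mul_eq_mul_right hm h
  · rintro n hn
    rw [Finset.mem_filter, Finset.mem_Icc] at hn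
    obtain ⟨⟨h1, h2⟩, t, rfl⟩ := hn
    refine ⟨t, ?_, mul_comm _ _⟩
    rw [Finset.mem_Icc, Nat.le_div_iff_mul_le hm]
    exact ⟨Nat.pos_of_mul_pos_left h1, by rwa [mul_comm]⟩

theorem dlogCoeff_eq_sum_Icc {A : Type*} [CommRing A] (α : ℕ → A) {n M : ℕ} (hn : 0 < n)
    (hM : n ≤ M) :
    dlogCoeff α n = ∑ j ∈ Finset.Icc 1 M, if j ∣ n then (j : A) * α j ^ (n / j) else 0 := by
  rw [dlogCoeff, ← Finset.sum_filter]
  refine Finset.sum_congr ?_ fun _ _ => rfl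
  ext j
  rw [Nat.mem_divisors, Finset.mem_filter, Finset.mem_Icc]
  exact ⟨fun h => ⟨⟨Nat.pos_of_dvd_of_pos h.1 hn, (Nat.le_of_dvd hn h.1).trans hM⟩, h.1⟩,
    fun h => ⟨h.2, hn.ne'⟩⟩

section Swap

variable {A : Type*} [CommRing A]

/-- The base `α_j ^ (k / (j, k)) * β_k ^ (j / (j, k))` of the factors of `doubleProduct`. -/
def pairBase (α β : ℕ → A) (j k : ℕ) : A :=
  α j ^ (k / Nat.gcd j k) * β k ^ (j / Nat.gcd j k)

theorem doubleProduct_swap (α β : ℕ+ → A) : doubleProduct α β = doubleProduct β α := by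
  unfold doubleProduct
  rw [← finprod_comp_equiv (Equiv.prodComm ℕ+ ℕ+)]
  refine finprod_congr fun p => ?_
  simp only [Equiv.prodComm_apply, Prod.fst_swap, Prod.snd_swap]
  rw [Nat.gcd_comm, mul_comm (α _ ^ _)]

/-- The `t`-th power of the base contains `β_k` to the power `t lcm(j,k) / k`. For `k ≤ N` and `t
lcm(j,k) > M ≥ N L` this exceeds `L`. Thus the logarithm of the factor may be cut off at `M /
lcm(j,k)`. -/
theorem pairBase_pow_eq_zero {α β : ℕ → A} {N L M j k : ℕ} (hβL : ∀ k, 0 < k → β k ^ L = 0)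
    (hβN : ∀ k, N < k → β k = 0) (hM : N * L ≤ M) (hj : 0 < j) (hk : 0 < k) :
    pairBase α β j k ^ (M / Nat.lcm j k + 1) = 0 := by
  have hg : 0 < Nat.gcd j k := Nat.gcd_pos_of_pos_left _ hj
  have hjd : 0 < j / Nat.gcd j k := Nat.div_pos (Nat.gcd_le_left _ hj) hg
  rw [pairBase, mul_pow, ← pow_mul (β k)]
  rcases lt_or_ge N k with h | h
  · rw [hβN k h, zero_pow (Nat.mul_pos hjd (Nat.succ_pos _)).ne', mul_zero]
  · have h1 : Nat.lcm j k = j / Nat.gcd j k * k := by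
      rw [Nat.lcm, Nat.div_mul_right_comm (Nat.gcd_dvd_left j k)]
    have h2 : M < Nat.lcm j k * (M / Nat.lcm j k + 1) :=
      Nat.lt_mul_div_succ _ (Nat.lcm_pos hj hk)
    have h3 : k * L < k * (j / Nat.gcd j k * (M / Nat.lcm j k + 1)) :=
      calc k * L ≤ N * L := Nat.mul_le_mul_right _ h
        _ ≤ M := hM
        _ < _ := h2
        _ = _ := by nth_rw 1 [h1]; ring
    rw [pow_eq_zero_of_le (Nat.lt_of_mul_lt_mul_left h3).le (hβL k hk), mul_zero]

theorem doubleProduct_eq_prod {α β : ℕ → A} {N L M : ℕ} (hβL : ∀ k, 0 < k → β k ^ L = 0)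
    (hβN : ∀ k, N < k → β k = 0) (hM : N * L ≤ M) :
    doubleProduct (fun j : ℕ+ => α j) (fun k : ℕ+ => β k)
      = ∏ p ∈ Finset.Icc 1 M ×ˢ Finset.Icc 1 M,
          (1 - pairBase α β p.1 p.2) ^ Nat.gcd p.1 p.2 := by
  let e : ℕ+ × ℕ+ ↪ ℕ × ℕ := ⟨fun p => (p.1, p.2), fun p q h => by
    simp only [Prod.mk.injEq, PNat.coe_inj] at h
    exact Prod.ext h.1 h.2⟩
  let s : Finset (ℕ+ × ℕ+) := (Finset.Icc 1 M ×ˢ Finset.Icc 1 M).preimage e e.injective.injOn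
  have h1 : doubleProduct (fun j : ℕ+ => α j) (fun k : ℕ+ => β k)
      = ∏ p ∈ s, (1 - pairBase α β p.1 p.2) ^ Nat.gcd p.1 p.2 := by
    refine finprod_eq_prod_of_mulSupport_subset _ fun p hp => ?_
    by_contra hps
    apply hp
    -- Outside the square the lcm exceeds `M`, so the exponent `M / lcm + 1` is `1` and the base
    -- itself vanishes.
    have h2 : M < Nat.lcm p.1 p.2 := by
      have hps' : ¬ ((1 ≤ (p.1 : ℕ) ∧ (p.1 : ℕ) ≤ M) ∧ 1 ≤ (p.2 : ℕ) ∧ (p.2 : ℕ) ≤ M) :=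
        fun h => hps (by
          simp only [s, Finset.coe_preimage, mem_preimage, Finset.mem_coe]
          exact Finset.mem_product.2 ⟨Finset.mem_Icc.2 h.1, Finset.mem_Icc.2 h.2⟩)
      have h3 := Nat.le_of_dvd (Nat.lcm_pos p.1.pos p.2.pos) (Nat.dvd_lcm_left p.1 p.2)
      have h4 := Nat.le_of_dvd (Nat.lcm_pos p.1.pos p.2.pos) (Nat.dvd_lcm_right p.1 p.2)
      have := p.1.pos
      have := p.2.pos
      omega
    have h5 := pairBase_pow_eq_zero (α := α) hβL hβN hM p.1.pos p.2.pos
    rw [Nat.div_eq_of_lt h2, zero_add, pow_one] at h5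
    change (1 - pairBase α β p.1 p.2) ^ Nat.gcd p.1 p.2 = 1
    rw [h5, sub_zero, one_pow]
  rw [h1]
  refine Finset.prod_preimage e _ e.injective.injOn
    (fun p => (1 - pairBase α β p.1 p.2) ^ Nat.gcd p.1 p.2) ?_
  rintro ⟨j, k⟩ hp hp'
  rw [Finset.mem_product, Finset.mem_Icc, Finset.mem_Icc] at hp
  exact absurd ⟨(⟨j, hp.1.1⟩, ⟨k, hp.2.1⟩), rfl⟩ hp'

end Swap

/-- A pair `(j, k)` contributes to the index `n` exactly when `lcm(j,k) ∣ n`. Putting `n = t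
lcm(j,k)` and using `gcd * lcm = j k`, its weight `j k / n` becomes `gcd / t`. -/
theorem sum_inv_smul_dlogCoeff_mul {A : Type*} [CommRing A] [Algebra ℂ A] {α β : ℕ → A} {M : ℕ} :
    ∑ n ∈ Finset.Icc 1 M, (n : ℂ)⁻¹ • (dlogCoeff α n * dlogCoeff β n)
      = ∑ p ∈ Finset.Icc 1 M ×ˢ Finset.Icc 1 M, (Nat.gcd p.1 p.2 : A) *
          ∑ t ∈ Finset.Icc 1 (M / Nat.lcm p.1 p.2), (t : ℂ)⁻¹ • pairBase α β p.1 p.2 ^ t := by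
  have h1 (n : ℕ) (hn : n ∈ Finset.Icc 1 M) :
      (n : ℂ)⁻¹ • (dlogCoeff α n * dlogCoeff β n)
        = ∑ p ∈ Finset.Icc 1 M ×ˢ Finset.Icc 1 M, if Nat.lcm p.1 p.2 ∣ n then
            (n : ℂ)⁻¹ • ((p.1 : A) * α p.1 ^ (n / p.1) * ((p.2 : A) * β p.2 ^ (n / p.2)))
          else 0 := by
    rw [Finset.mem_Icc] at hn
    rw [dlogCoeff_eq_sum_Icc α hn.1 hn.2, dlogCoeff_eq_sum_Icc β hn.1 hn.2, Finset.sum_mul_sum,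
      ← Finset.sum_product', Finset.smul_sum]
    refine Finset.sum_congr rfl fun p _ => ?_
    rw [ite_zero_mul_ite_zero, smul_ite, smul_zero]
    simp only [Nat.lcm_dvd_iff]
  rw [Finset.sum_congr rfl h1, Finset.sum_comm]
  refine Finset.sum_congr rfl fun p hp => ?_
  obtain ⟨j, k⟩ := p
  rw [Finset.mem_product, Finset.mem_Icc, Finset.mem_Icc] at hp
  have hj : 0 < j := hp.1.1
  have hk : 0 < k := hp.2.1
  rw [← Finset.sum_filter, sum_Icc_filter_dvd (Nat.lcm_pos hj hk), Finset.mul_sum]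
  refine Finset.sum_congr rfl fun t ht => ?_
  rw [Finset.mem_Icc] at ht
  simp only [pairBase]
  obtain ⟨j', k', -, hj', hk'⟩ := Nat.exists_coprime j k
  have hd : 0 < Nat.gcd j k := Nat.gcd_pos_of_pos_left _ hj
  have hlcm := Nat.gcd_mul_lcm j k
  set d := Nat.gcd j k
  set m := Nat.lcm j k
  have hm : m = k' * j := Nat.eq_of_mul_eq_mul_left hd (by linear_combination hlcm + j * hk')
  have hm' : m = j' * k := Nat.eq_of_mul_eq_mul_left hd (by linear_combination hlcm + k * hj')
  have e1 : t * m / j = k' * t := by rw [hm, ← mul_assoc, Nat.mul_div_cancel _ hj, mul_comm]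
  have e2 : t * m / k = j' * t := by rw [hm', ← mul_assoc, Nat.mul_div_cancel _ hk, mul_comm]
  have e3 : k / d = k' := Nat.div_eq_of_eq_mul_left hd hk'
  have e4 : j / d = j' := Nat.div_eq_of_eq_mul_left hd hj'
  rw [e1, e2, e3, e4, mul_pow, ← pow_mul, ← pow_mul]
  have e5 : ((t * m : ℕ) : ℂ)⁻¹ * (j * k) = d * (t : ℂ)⁻¹ := by
    have ht0 : (t : ℂ) ≠ 0 := by exact_mod_cast (Nat.pos_of_ne_zero (by omega)).ne'
    have hm0 : (m : ℂ) ≠ 0 := by exact_mod_cast (Nat.lcm_pos hj hk).ne'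
    have : (d : ℂ) * m = j * k := by exact_mod_cast hlcm
    push_cast
    field_simp
    rw [← this, mul_comm]
  have e6 := congrArg (algebraMap ℂ A) e5
  simp only [map_mul, map_natCast] at e6
  rw [Algebra.smul_def, Algebra.smul_def]
  linear_combination (α j ^ (k' * t) * β k ^ (j' * t)) * e6

variable {A : Type*} [NormedCommRing A] [NormedAlgebra ℂ A] [CompleteSpace A]

/-- The double product as the exponential of a residue. -/
theorem exp_neg_sum_dlogCoeff_mul {α β : ℕ → A} {N L M : ℕ} (hβL : ∀ k, 0 < k → β k ^ L = 0)
    (hβN : ∀ k, N < k → β k = 0) (hM : N * L ≤ M) :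
    NormedSpace.exp (-∑ n ∈ Finset.Icc 1 M, (n : ℂ)⁻¹ • (dlogCoeff α n * dlogCoeff β n))
      = doubleProduct (fun j : ℕ+ => α j) (fun k : ℕ+ => β k) := by
  rw [doubleProduct_eq_prod hβL hβN hM, sum_inv_smul_dlogCoeff_mul, ← Finset.sum_neg_distrib,
    exp_finset_sum]
  refine Finset.prod_congr rfl fun p hp => ?_
  rw [Finset.mem_product, Finset.mem_Icc, Finset.mem_Icc] at hp
  rw [← mul_neg, exp_natCast_mul,
    exp_neg_sum_pow_div (pairBase_pow_eq_zero hβL hβN hM hp.1.1 hp.2.1)]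

end ContouCarrere

end DoubleProduct

/-! ### Formal infinite products and their logarithmic derivatives -/

section PosProduct

namespace ContouCarrere

open PowerSeries

variable {A : Type*} [CommRing A]

/-- The partial product `∏_{1 ≤ j ≤ n} (1 - a_j X ^ j)`. -/
noncomputable def partialProduct (a : ℕ → A) (n : ℕ) : PowerSeries A :=
  ∏ j ∈ Finset.Icc 1 n, (1 - C (a j) * X ^ j)

theorem partialProduct_succ (a : ℕ → A) (n : ℕ) :
    partialProduct a (n + 1) = partialProduct a n * (1 - C (a (n + 1)) * X ^ (n + 1)) :=
  Finset.prod_Icc_succ_top (Nat.succ_pos n) _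

theorem coeff_partialProduct_of_le (a : ℕ → A) {i n m : ℕ} (hi : i ≤ n) (hn : n ≤ m) :
    coeff i (partialProduct a m) = coeff i (partialProduct a n) := by
  induction m, hn using Nat.le_induction with
  | base => rfl
  | succ m hm ih =>
    rw [partialProduct_succ, mul_sub, mul_one, map_sub, ih, ← mul_assoc, coeff_mul_X_pow',
      if_neg (by omega), sub_zero]

theorem coeff_posProduct (a : ℤ → A) {i n : ℕ} (hi : i ≤ n) :
    coeff i (posProduct a) = coeff i (partialProduct (fun j => a j) n) := by
  rw [posProduct, coeff_mk, coeff_partialProduct_of_le _ le_rfl hi]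
  rfl

theorem constantCoeff_posProduct (a : ℤ → A) : constantCoeff (posProduct a) = 1 := by
  rw [← coeff_zero_eq_constantCoeff_apply, coeff_posProduct a le_rfl]
  simp [partialProduct]

/-- The geometric series `∑_{l ≥ 1} (c X ^ j) ^ l`. -/
noncomputable def geomSeries (c : A) (j : ℕ) : PowerSeries A :=
  mk fun m => if j ∣ m ∧ 0 < m then c ^ (m / j) else 0

theorem one_sub_mul_geomSeries (c : A) {j : ℕ} (hj : 0 < j) :
    (1 - C c * X ^ j) * geomSeries c j = C c * X ^ j := by
  ext m
  rw [sub_mul, one_mul, map_sub, mul_assoc, coeff_C_mul, coeff_C_mul, coeff_X_pow_mul', coeff_X_pow]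
  simp only [geomSeries, coeff_mk]
  rcases lt_trichotomy m j with h | rfl | h
  · have h1 : ¬ (j ∣ m ∧ 0 < m) := fun h1 => absurd (Nat.le_of_dvd h1.2 h1.1) (by omega)
    rw [if_neg h1, if_neg (by omega), if_neg (by omega)]
    simp
  · simp [hj, Nat.div_self hj]
  · rw [if_pos h.le, if_neg (by omega : ¬ m = j)]
    obtain ⟨k, rfl⟩ := Nat.exists_eq_add_of_le h.le
    have hk : 0 < k := by omega
    have hdk : j ∣ j + k ↔ j ∣ k := Nat.dvd_add_right (dvd_refl j)
    rw [Nat.add_sub_cancel_left]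
    by_cases h1 : j ∣ k
    · rw [if_pos ⟨hdk.2 h1, by omega⟩, if_pos ⟨h1, hk⟩, Nat.add_div_left _ hj, pow_succ']
      simp
    · rw [if_neg fun h => h1 (hdk.1 h.1), if_neg fun h => h1 h.1]
      simp

/-- The logarithmic derivative in multiplied-out form: `1 - a_j X ^ j` contributes `-j ∑_{l ≥ 1}
(a_j X ^ j) ^ l`. -/
theorem X_mul_derivative_partialProduct (a : ℕ → A) (n : ℕ) :
    X * d⁄dX A (partialProduct a n)
      = partialProduct a n * ∑ j ∈ Finset.Icc 1 n, -((j : PowerSeries A) * geomSeries (a j) j) := by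
  induction n with
  | zero => simp [partialProduct]
  | succ n ih =>
    rw [Finset.sum_Icc_succ_top (Nat.succ_pos n), partialProduct_succ, Derivation.leibniz,
      smul_eq_mul, smul_eq_mul, mul_add, mul_left_comm X (1 - _), ih]
    have h1 : X * d⁄dX A (1 - C (a (n + 1)) * X ^ (n + 1))
        = -(((n + 1 : ℕ) : PowerSeries A) * (C (a (n + 1)) * X ^ (n + 1))) := by
      rw [map_sub, Derivation.leibniz, Derivation.leibniz_pow]
      simp only [derivative_C, derivative_X, Derivation.map_one_eq_zero, smul_eq_mul]
      simp
      ring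
    have h2 := one_sub_mul_geomSeries (a (n + 1)) (Nat.succ_pos n)
    rw [Nat.succ_eq_add_one] at h2
    linear_combination partialProduct a n * h1 + ((n + 1 : ℕ) : PowerSeries A) * partialProduct a n * h2

/-- `x U' = U W` for `U = ∏ (1 - a_j x ^ j)`. -/
theorem natCast_mul_coeff_posProduct (a : ℤ → A) (n : ℕ) :
    (n : A) * coeff n (posProduct a)
      = ∑ p ∈ Finset.HasAntidiagonal.antidiagonal n, coeff p.1 (posProduct a) * -dlogCoeff (fun j => a j) p.2 := by
  have h1 (U : PowerSeries A) : coeff n (X * d⁄dX A U) = n * coeff n U := by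
    cases n with
    | zero => simp
    | succ n => rw [coeff_succ_X_mul, coeff_derivative, mul_comm]; push_cast; rfl
  rw [coeff_posProduct a le_rfl, ← h1, X_mul_derivative_partialProduct, coeff_mul]
  refine Finset.sum_congr rfl fun p hp => ?_
  rw [Finset.HasAntidiagonal.mem_antidiagonal] at hp
  rw [coeff_posProduct a (show p.1 ≤ n by omega)]
  congr 1
  rw [map_sum]
  simp only [map_neg, Finset.sum_neg_distrib]
  congr 1
  rcases Nat.eq_zero_or_pos p.2 with h | h
  · rw [h]
    simp [dlogCoeff, geomSeries]
  · rw [dlogCoeff_eq_sum_Icc _ h (show p.2 ≤ n by omega)]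
    refine Finset.sum_congr rfl fun j _ => ?_
    rw [← map_natCast C j, coeff_C_mul, geomSeries, coeff_mk]
    simp [h]

/-- Factors are chosen greedily. The partial product has constant term `1`, so a new factor `1 - a X
^ (n + 1)` lowers the coefficient of `X ^ (n + 1)` by exactly `a` and leaves the earlier ones alone.
The values of `a'` off the positive integers stay free for the other factors of an expansion. -/
theorem exists_posProduct_eq (U : PowerSeries A) (hU : constantCoeff U = 1) :
    ∃ a : ℕ → A, ∀ a' : ℤ → A, (∀ j : ℕ, 0 < j → a' j = a j) → posProduct a' = U := by
  let P : ℕ → PowerSeries A := fun n => Nat.rec 1 (fun n P =>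
    P * (1 - C (coeff (n + 1) P - coeff (n + 1) U) * X ^ (n + 1))) n
  let a : ℕ → A := fun j => coeff j (P (j - 1)) - coeff j U
  have hP (n : ℕ) : partialProduct a n = P n := by
    induction n with
    | zero => simp [partialProduct, P]
    | succ n ih => rw [partialProduct_succ, ih]; rfl
  refine ⟨a, fun a' ha' => ?_⟩
  ext n
  have h1 : partialProduct (fun j => a' j) n = P n := by
    rw [← hP]
    refine Finset.prod_congr rfl fun j hj => ?_
    rw [Finset.mem_Icc] at hj
    simp only [ha' j hj.1]
  rw [coeff_posProduct a' le_rfl, h1]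
  cases n with
  | zero => simp [P, hU]
  | succ n =>
    change coeff (n + 1) (P n * (1 - C (coeff (n + 1) (P n) - coeff (n + 1) U) * X ^ (n + 1))) = _
    have h0 : constantCoeff (P n) = 1 := by
      rw [← hP, partialProduct, map_prod]
      refine Finset.prod_eq_one fun j hj => ?_
      rw [Finset.mem_Icc] at hj
      simp [show j ≠ 0 by omega]
    rw [mul_sub, mul_one, map_sub, ← mul_assoc, coeff_mul_X_pow', if_pos le_rfl, Nat.sub_self,
      coeff_mul_C, coeff_zero_eq_constantCoeff_apply, h0]
    ring

end ContouCarrere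

end PosProduct

/-! ### Existence of product expansions -/

section ExistsProductExpansion

namespace ContouCarrere

/-- The ideal of the Laurent series all of whose coefficients lie in `Ia`. -/
def coeffIdeal {A : Type*} [CommRing A] (Ia : Ideal A) : Ideal (LaurentSeries A) where
  carrier := {F | ∀ n, F.coeff n ∈ Ia}
  add_mem' hF hG n := by
    rw [HahnSeries.coeff_add]
    exact Ia.add_mem (hF n) (hG n)
  zero_mem' n := by simp
  smul_mem' G F hF n := by
    rw [smul_eq_mul, HahnSeries.coeff_mul]
    exact Ia.sum_mem fun p _ => Ia.mul_mem_left _ (hF _)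

section

variable {A : Type*} [CommRing A] {Ia Ja : Ideal A}

theorem mul_mem_coeffIdeal {F G : LaurentSeries A} (hF : F ∈ coeffIdeal Ia)
    (hG : G ∈ coeffIdeal Ja) : F * G ∈ coeffIdeal (Ia * Ja) := by
  intro n
  rw [HahnSeries.coeff_mul]
  exact Ideal.sum_mem _ fun p _ => Ideal.mul_mem_mul (hF _) (hG _)

theorem single_mem_coeffIdeal {c : A} (hc : c ∈ Ia) (n : ℤ) :
    (HahnSeries.single n c : LaurentSeries A) ∈ coeffIdeal Ia := by
  intro k
  rw [HahnSeries.coeff_single]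
  split_ifs
  exacts [hc, Ia.zero_mem]

theorem coeff_ofPowerSeries (U : PowerSeries A) (n : ℤ) :
    (HahnSeries.ofPowerSeries ℤ A U).coeff n = if n < 0 then 0 else PowerSeries.coeff n.natAbs U :=
  PowerSeries.coeff_coe U n

theorem ofPowerSeries_mem_coeffIdeal {U : PowerSeries A} (hU : ∀ n, PowerSeries.coeff n U ∈ Ia) :
    HahnSeries.ofPowerSeries ℤ A U ∈ coeffIdeal Ia := by
  intro n
  rw [coeff_ofPowerSeries]
  split_ifs
  exacts [Ia.zero_mem, hU _]

/-- Linearization of the finite product: since it is `1` modulo `Ia`, perturbing the `y i` by `ε i`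
changes it by `∑ ε i` up to terms in `Ia * Ja`. -/
theorem prod_sub_prod_sub_sum_mem_coeffIdeal {ι : Type*} (s : Finset ι) {y ε : ι → LaurentSeries A}
    (hJI : Ja ≤ Ia) (hy : ∀ i, y i ∈ coeffIdeal Ia) (hε : ∀ i, ε i ∈ coeffIdeal Ja) :
    ∏ i ∈ s, (1 - y i) - 1 ∈ coeffIdeal Ia ∧
      ∏ i ∈ s, (1 - (y i - ε i)) - ∏ i ∈ s, (1 - y i) - ∑ i ∈ s, ε i ∈ coeffIdeal (Ia * Ja) := by
  classical
  induction s using Finset.induction_on with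
  | empty => simp
  | insert i s hi ih =>
    rw [Finset.prod_insert hi, Finset.prod_insert hi, Finset.sum_insert hi]
    set P := ∏ i ∈ s, (1 - y i)
    set P' := ∏ i ∈ s, (1 - (y i - ε i))
    set S := ∑ i ∈ s, ε i
    have hS : S ∈ coeffIdeal Ja := Ideal.sum_mem _ fun i _ => hε i
    constructor
    · have : (1 - y i) * P - 1 = (1 - y i) * (P - 1) - y i := by ring
      rw [this]
      exact Ideal.sub_mem _ (Ideal.mul_mem_left _ _ ih.1) (hy i)
    · have : (1 - (y i - ε i)) * P' - (1 - y i) * P - (ε i + S)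
          = (P - 1) * ε i + (ε i - y i) * S + (1 - (y i - ε i)) * (P' - P - S) := by ring
      rw [this]
      refine Ideal.add_mem _ (Ideal.add_mem _ (mul_mem_coeffIdeal ih.1 (hε i))
        (mul_mem_coeffIdeal (Ideal.sub_mem _ (fun n => hJI (hε i n)) (hy i)) hS))
        (Ideal.mul_mem_left _ _ ih.2)

/-- The principal part and the regular part of a Laurent series. -/
theorem exists_eq_sum_single_add_ofPowerSeries (E : LaurentSeries A) :
    ∃ N : ℕ, (∀ j : ℕ, N < j → E.coeff (-(j : ℤ)) = 0) ∧ ∀ M, N ≤ M →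
      E = ∑ j ∈ Finset.Icc 1 M, HahnSeries.single (-(j : ℤ)) (E.coeff (-(j : ℤ))) +
        HahnSeries.ofPowerSeries ℤ A (PowerSeries.mk fun n => E.coeff n) := by
  have h0 : ∃ N : ℕ, ∀ j : ℕ, N < j → E.coeff (-(j : ℤ)) = 0 := by
    refine ⟨E.order.natAbs, fun j hj => HahnSeries.coeff_eq_zero_of_lt_order ?_⟩
    omega
  obtain ⟨N, hN⟩ := h0
  refine ⟨N, hN, fun M hM => ?_⟩
  ext n
  rw [HahnSeries.coeff_add, HahnSeries.coeff_sum, coeff_ofPowerSeries]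
  simp only [HahnSeries.coeff_single, PowerSeries.coeff_mk]
  split_ifs with hn
  · obtain ⟨j, rfl⟩ : ∃ j : ℕ, n = -(j : ℤ) := ⟨n.natAbs, by omega⟩
    have hj : 1 ≤ j := by omega
    simp only [neg_inj, Nat.cast_inj, add_zero]
    rw [Finset.sum_ite_eq (Finset.Icc 1 M) j fun j : ℕ => E.coeff (-(j : ℤ))]
    split_ifs with h
    · rfl
    · rw [Finset.mem_Icc] at h
      exact hN j (by omega)
  · rw [Finset.sum_eq_zero, zero_add]
    · congr 1
      omega
    · intro j hj
      rw [Finset.mem_Icc] at hj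
      rw [if_neg (by omega)]

end

variable {A : Type*} [CommRing A] [IsLocalRing A]

open IsLocalRing in
-- Successive approximation modulo powers of the maximal ideal. The principal part of the error is
-- absorbed into the `α j`, the regular part into `U`, and the new error gains one power of the
-- ideal. Modulo the ideal itself `V` is a power series, which starts the induction.
theorem exists_prod_mul_ofPowerSeries_sub_mem (V : LaurentSeries A) (h0 : IsUnit (V.coeff 0))
    (hneg : ∀ n < 0, V.coeff n ∈ maximalIdeal A) (k : ℕ) :
    ∃ (N : ℕ) (α : ℕ → A) (U : PowerSeries A), (∀ j, α j ∈ maximalIdeal A) ∧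
      (∀ j, N < j → α j = 0) ∧ IsUnit U ∧
      V - (∏ j ∈ Finset.Icc 1 N, (1 - HahnSeries.single (-(j : ℤ)) (α j))) *
        HahnSeries.ofPowerSeries ℤ A U ∈ coeffIdeal (maximalIdeal A ^ (k + 1)) := by
  induction k with
  | zero =>
    refine ⟨0, 0, PowerSeries.mk fun n => V.coeff n, fun _ => Ideal.zero_mem _, fun _ _ => rfl, ?_, ?_⟩
    · rw [PowerSeries.isUnit_iff_constantCoeff, ← PowerSeries.coeff_zero_eq_constantCoeff_apply]
      simpa using h0
    · intro n
      rw [Finset.Icc_eq_empty (by norm_num), Finset.prod_empty, one_mul, HahnSeries.coeff_sub,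
        coeff_ofPowerSeries, zero_add, pow_one]
      split_ifs with hn
      · simpa using hneg n hn
      · rw [PowerSeries.coeff_mk, Int.natAbs_of_nonneg (by omega), sub_self]
        exact Ideal.zero_mem _
  | succ k ih =>
    obtain ⟨N, α, U, hα, hαN, hU, hΔ⟩ := ih
    obtain ⟨u, rfl⟩ := hU
    set Ia := maximalIdeal A
    set Ja := Ia ^ (k + 1)
    have hJI : Ja ≤ Ia := Ideal.pow_le_self k.succ_ne_zero
    set ι := HahnSeries.ofPowerSeries ℤ A
    have hu : ι u * ι ↑u⁻¹ = 1 := by rw [← map_mul, Units.mul_inv, map_one]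
    set P := ∏ j ∈ Finset.Icc 1 N, (1 - HahnSeries.single (-(j : ℤ)) (α j)) with hPdef
    -- The error relative to the unit `u`; its negative coefficients correct `α`, the remaining ones
    -- give the factor `1 + Pp`.
    set E := (V - P * ι u) * ι ↑u⁻¹ with hEdef
    have hE : E ∈ coeffIdeal Ja := Ideal.mul_mem_right _ _ hΔ
    obtain ⟨N', hN', hdecomp⟩ := exists_eq_sum_single_add_ofPowerSeries E
    set M := max N N'
    set Pp := PowerSeries.mk fun n : ℕ => E.coeff n with hPp
    have hPpJ : ι Pp ∈ coeffIdeal Ja :=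
      ofPowerSeries_mem_coeffIdeal fun n => by rw [hPp, PowerSeries.coeff_mk]; exact hE n
    have hPM : P = ∏ j ∈ Finset.Icc 1 M, (1 - HahnSeries.single (-(j : ℤ)) (α j)) := by
      refine Finset.prod_subset (Finset.Icc_subset_Icc_right (le_max_left _ _)) fun j hj hj' => ?_
      rw [Finset.mem_Icc] at hj hj'
      rw [hαN j (by omega)]
      simp
    obtain ⟨h1, h2⟩ := prod_sub_prod_sub_sum_mem_coeffIdeal (Finset.Icc 1 M)
      (y := fun j : ℕ => HahnSeries.single (-(j : ℤ)) (α j))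
      (ε := fun j : ℕ => HahnSeries.single (-(j : ℤ)) (E.coeff (-(j : ℤ)))) hJI
      (fun j => single_mem_coeffIdeal (hα j) _) (fun j => single_mem_coeffIdeal (hE _) _)
    rw [← hPM] at h1 h2
    have h3 := hdecomp M (le_max_right _ _)
    have hSJ : ∑ j ∈ Finset.Icc 1 M, HahnSeries.single (-(j : ℤ)) (E.coeff (-(j : ℤ)))
        ∈ coeffIdeal Ja := Ideal.sum_mem _ fun j _ => single_mem_coeffIdeal (hE _) _
    refine ⟨M, fun j => α j - E.coeff (-(j : ℤ)), u * (1 + Pp), fun j =>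
      Ideal.sub_mem _ (hα j) (hJI (hE _)), fun j hj => ?_, ?_, ?_⟩
    · change α j - _ = 0
      rw [hαN j ((le_max_left _ _).trans_lt hj), hN' j ((le_max_right _ _).trans_lt hj), sub_zero]
    · refine u.isUnit.mul ?_
      rw [PowerSeries.isUnit_iff_constantCoeff, map_add, map_one, hPp,
        ← PowerSeries.coeff_zero_eq_constantCoeff_apply, PowerSeries.coeff_mk, ← sub_neg_eq_add]
      exact isUnit_one_sub_self_of_mem_nonunits _ ((mem_maximalIdeal _).1
        ((maximalIdeal A).neg_mem (hJI (hE _))))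
    · have hsub (j : ℕ) : (HahnSeries.single (-(j : ℤ)) (α j - E.coeff (-(j : ℤ))) : LaurentSeries A)
          = HahnSeries.single (-(j : ℤ)) (α j) - HahnSeries.single (-(j : ℤ)) (E.coeff (-(j : ℤ))) := by
        ext n
        simp only [HahnSeries.coeff_sub, HahnSeries.coeff_single]
        split_ifs <;> simp
      simp only [hsub]
      set S := ∑ j ∈ Finset.Icc 1 M, HahnSeries.single (-(j : ℤ)) (E.coeff (-(j : ℤ)))
      set P' := ∏ j ∈ Finset.Icc 1 M, (1 - (HahnSeries.single (-(j : ℤ)) (α j) -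
        HahnSeries.single (-(j : ℤ)) (E.coeff (-(j : ℤ)))))
      have h4 : V = P * ι u + (S + ι Pp) * ι u := by
        rw [← h3, hEdef]
        linear_combination (P * ι u - V) * hu
      -- The terms linear in the error cancel, and each remaining product has one factor in `Ia` and
      -- one in `Ja`, or is the linearization remainder.
      have h5 : V - P' * ι (u * (1 + Pp))
          = -(ι u * ((P - 1) * ι Pp + (1 + ι Pp) * (P' - P - S) + S * ι Pp)) := by
        rw [h4, map_mul, map_add, map_one]
        ring
      rw [h5, pow_succ']
      refine neg_mem (Ideal.mul_mem_left _ _ (Ideal.add_mem _ (Ideal.add_mem _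
        (mul_mem_coeffIdeal h1 hPpJ) (Ideal.mul_mem_left _ _ h2))
        (mul_mem_coeffIdeal (fun n => hJI (hSJ n)) hPpJ)))

/-- Laurent series whose reduction modulo the maximal ideal is not zero have product expansions. -/
theorem exists_isProductExpansion {L : ℕ} (hL : 0 < L)
    (hm : IsLocalRing.maximalIdeal A ^ L = ⊥) (F : LaurentSeries A) (ν : ℤ)
    (hν : IsUnit (F.coeff ν)) (hlt : ∀ n < ν, F.coeff n ∈ IsLocalRing.maximalIdeal A) :
    ∃ a : ℤ → A, IsProductExpansion F ν a := by
  have hcoeff (n : ℤ) : (HahnSeries.single (-ν) 1 * F).coeff n = F.coeff (n + ν) := by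
    have := HahnSeries.coeff_single_mul_add (r := (1 : A)) (x := F) (a := n + ν) (b := -ν)
    rwa [add_neg_cancel_right, one_mul] at this
  -- Depth `L - 1` puts the error in the `L`-th power of the maximal ideal, which is zero: the
  -- factorization is exact.
  obtain ⟨N, α, U, hα, hαN, hU, hV⟩ := exists_prod_mul_ofPowerSeries_sub_mem
    (HahnSeries.single (-ν) 1 * F) (by rw [hcoeff]; simpa using hν)
    (fun n hn => by rw [hcoeff]; exact hlt _ (by omega)) (L - 1)
  rw [Nat.sub_add_cancel hL, hm] at hV
  have hV' := sub_eq_zero.1 (HahnSeries.ext (funext fun n => by simpa using hV n) :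
    HahnSeries.single (-ν) 1 * F - _ = 0)
  rw [PowerSeries.isUnit_iff_constantCoeff] at hU
  obtain ⟨c, hc⟩ := hU
  obtain ⟨p, hp⟩ := exists_posProduct_eq (PowerSeries.C (↑c⁻¹ : A) * U)
    (by rw [map_mul, PowerSeries.constantCoeff_C, ← hc, Units.inv_mul])
  let a : ℤ → A := fun j => if j = 0 then c else if 0 < j then p j.toNat else α (-j).toNat
  have ha : posProduct a = PowerSeries.C (↑c⁻¹ : A) * U := hp a fun j hj => by
    simp only [a]
    rw [if_neg (by omega), if_pos (by omega), Int.toNat_natCast]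
  have ha' (j : ℕ) (hj : 0 < j) : a (-(j : ℤ)) = α j := by
    simp only [a]
    rw [if_neg (by omega), if_neg (by omega), neg_neg, Int.toNat_natCast]
  refine ⟨a, by simp [a], fun j hj => ?_, N, fun j hj => ?_, ?_⟩
  · obtain ⟨i, rfl⟩ : ∃ i : ℕ, j = -(i : ℤ) := ⟨j.natAbs, by omega⟩
    rw [ha' i (by omega)]
    exact hα i
  · obtain ⟨i, rfl⟩ : ∃ i : ℕ, j = -(i : ℤ) := ⟨j.natAbs, by omega⟩
    rw [ha' i (by omega)]
    exact hαN i (by omega)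
  · have h1 : (HahnSeries.single ν 1 : LaurentSeries A) * HahnSeries.single (-ν) 1 = 1 := by
      rw [HahnSeries.single_mul_single, add_neg_cancel, one_mul]
      rfl
    have h2 : (HahnSeries.single ν (a 0) : LaurentSeries A)
        = HahnSeries.single ν 1 * HahnSeries.ofPowerSeries ℤ A (PowerSeries.C (c : A)) := by
      rw [HahnSeries.ofPowerSeries_C, HahnSeries.C_apply, HahnSeries.single_mul_single]
      simp [a]
    have h3 : HahnSeries.ofPowerSeries ℤ A (PowerSeries.C (c : A)) *
        HahnSeries.ofPowerSeries ℤ A (posProduct a) = HahnSeries.ofPowerSeries ℤ A U := by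
      rw [ha, ← map_mul, ← mul_assoc, ← map_mul, Units.mul_inv, map_one, one_mul]
    have h4 : ∏ j ∈ Finset.Icc 1 N, (1 - HahnSeries.single (-(j : ℤ)) (a (-(j : ℤ))))
        = ∏ j ∈ Finset.Icc 1 N, (1 - HahnSeries.single (-(j : ℤ)) (α j)) :=
      Finset.prod_congr rfl fun j hj => by rw [ha' j (Finset.mem_Icc.1 hj).1]
    rw [h2, h4]
    linear_combination -h1 * F + HahnSeries.single ν 1 * hV' - HahnSeries.single ν 1 *
      (∏ j ∈ Finset.Icc 1 N, (1 - HahnSeries.single (-(j : ℤ)) (α j))) * h3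

end ContouCarrere

end ExistsProductExpansion

/-! ### Evaluating convergent Laurent series -/

section Evaluation

namespace ContouCarrere

variable {A : Type*} [NormedCommRing A] [NormedAlgebra ℂ A]

theorem hasSum_of_hasSum_of_eq {ι B : Type*} [AddCommMonoid B] [TopologicalSpace B] {F G : ι → B}
    {v : B} (h : HasSum F v) (e : ∀ n, G n = F n) : HasSum G v := by
  rwa [funext e]

/-- The Laurent series `F` converges to `v` at `z`. -/
def EvalsTo (F : LaurentSeries A) (z : ℂ) (v : A) : Prop :=
  HasSum (fun n : ℤ => z ^ n • F.coeff n) v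

/-- Multiplication by `Q` preserves convergence at `z`, and multiplies the sum by `q`. -/
def EvalsMul (Q : LaurentSeries A) (z : ℂ) (q : A) : Prop :=
  ∀ F v, EvalsTo F z v → EvalsTo (Q * F) z (q * v)

variable {z : ℂ} {Q R : LaurentSeries A} {q r : A}

theorem EvalsMul.mul (hQ : EvalsMul Q z q) (hR : EvalsMul R z r) : EvalsMul (Q * R) z (q * r) := by
  intro F v h
  rw [mul_assoc, mul_assoc]
  exact hQ _ _ (hR _ _ h)

theorem EvalsMul.add (hQ : EvalsMul Q z q) (hR : EvalsMul R z r) : EvalsMul (Q + R) z (q + r) := by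
  intro F v h
  rw [add_mul, add_mul]
  unfold EvalsTo
  simp only [HahnSeries.coeff_add, smul_add]
  exact (hQ F v h).add (hR F v h)

theorem EvalsMul.sub (hQ : EvalsMul Q z q) (hR : EvalsMul R z r) : EvalsMul (Q - R) z (q - r) := by
  intro F v h
  rw [sub_mul, sub_mul]
  unfold EvalsTo
  simp only [HahnSeries.coeff_sub, smul_sub]
  exact (hQ F v h).sub (hR F v h)

theorem evalsMul_one : EvalsMul (1 : LaurentSeries A) z 1 := by
  intro F v h
  rwa [one_mul, one_mul]

theorem evalsMul_zero : EvalsMul (0 : LaurentSeries A) z 0 := by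
  intro F v h
  rw [zero_mul, zero_mul]
  unfold EvalsTo
  simp

theorem evalsMul_prod {ι : Type*} (s : Finset ι) {Q : ι → LaurentSeries A} {q : ι → A}
    (h : ∀ i ∈ s, EvalsMul (Q i) z (q i)) : EvalsMul (∏ i ∈ s, Q i) z (∏ i ∈ s, q i) := by
  classical
  induction s using Finset.induction_on with
  | empty => simpa using evalsMul_one
  | insert i s hi ih =>
    rw [Finset.prod_insert hi, Finset.prod_insert hi]
    exact (h i (Finset.mem_insert_self i s)).mul
      (ih fun j hj => h j (Finset.mem_insert_of_mem hj))

theorem evalsMul_sum {ι : Type*} (s : Finset ι) {Q : ι → LaurentSeries A} {q : ι → A}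
    (h : ∀ i ∈ s, EvalsMul (Q i) z (q i)) : EvalsMul (∑ i ∈ s, Q i) z (∑ i ∈ s, q i) := by
  classical
  induction s using Finset.induction_on with
  | empty => simpa using evalsMul_zero
  | insert i s hi ih =>
    rw [Finset.sum_insert hi, Finset.sum_insert hi]
    exact (h i (Finset.mem_insert_self i s)).add
      (ih fun j hj => h j (Finset.mem_insert_of_mem hj))

theorem evalsMul_single (hz : z ≠ 0) (m : ℤ) (c : A) :
    EvalsMul (HahnSeries.single m c) z (z ^ m • c) := by
  intro F v h
  unfold EvalsTo at h ⊢
  rw [← (Equiv.addRight m).hasSum_iff]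
  have h1 := (h.mul_left c).const_smul (z ^ m)
  rw [smul_mul_assoc]
  refine hasSum_of_hasSum_of_eq h1 fun n => ?_
  rw [Function.comp_apply, Equiv.coe_addRight, HahnSeries.coeff_single_mul_add, zpow_add₀ hz,
    mul_comm, mul_smul, mul_smul_comm]

theorem evalsTo_one : EvalsTo (1 : LaurentSeries A) z 1 := by
  unfold EvalsTo
  convert hasSum_ite_eq (0 : ℤ) (1 : A) using 2 with n
  rw [HahnSeries.coeff_one]
  split_ifs with h
  · simp [h]
  · simp

theorem EvalsMul.mul_eq_one (hQ : EvalsMul Q z q) (hR : EvalsMul R z r) (h : Q * R = 1) :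
    q * r = 1 := by
  have h1 := hQ.mul hR 1 1 evalsTo_one
  rw [h, mul_one, mul_one] at h1
  exact h1.unique evalsTo_one

theorem EvalsTo.ofPowerSeries {U : PowerSeries A} {w : A}
    (h : EvalsTo (HahnSeries.ofPowerSeries ℤ A U) z w) :
    HasSum (fun n : ℕ => z ^ n • PowerSeries.coeff n U) w := by
  unfold EvalsTo at h
  rw [← (Nat.cast_injective (R := ℤ)).hasSum_iff] at h
  · convert h using 2 with n
    simp [coeff_ofPowerSeries]
  · intro n hn
    have : n < 0 := by
      by_contra h
      exact hn ⟨n.toNat, by simpa using h⟩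
    rw [coeff_ofPowerSeries, if_pos this, smul_zero]

/-- The factorization of the sum of a Laurent series with a product expansion. -/
theorem exists_eq_mul_of_evalsTo (hz : z ≠ 0) {ν : ℤ} {a : ℤ → A} (ha0 : IsUnit (a 0))
    {N : ℕ} (hneg : ∀ j : ℕ, 0 < j → IsNilpotent (a (-(j : ℤ)))) {v : A} {U : PowerSeries A}
    (h : EvalsTo (HahnSeries.single ν (a 0) *
      (∏ j ∈ Finset.Icc 1 N, (1 - HahnSeries.single (-(j : ℤ)) (a (-(j : ℤ))))) *
      HahnSeries.ofPowerSeries ℤ A U) z v) :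
    ∃ w, HasSum (fun n : ℕ => z ^ n • PowerSeries.coeff n U) w ∧
      v = z ^ ν • a 0 * (∏ j ∈ Finset.Icc 1 N, (1 - z ^ (-(j : ℤ)) • a (-(j : ℤ)))) * w := by
  obtain ⟨c, hc⟩ := ha0
  choose! L hL using hneg
  set y : ℕ → LaurentSeries A := fun j => HahnSeries.single (-(j : ℤ)) (a (-(j : ℤ)))
  have hR : EvalsMul (HahnSeries.single ν (a 0) * ∏ j ∈ Finset.Icc 1 N, (1 - y j)) z
      (z ^ ν • a 0 * (∏ j ∈ Finset.Icc 1 N, (1 - z ^ (-(j : ℤ)) • a (-(j : ℤ))))) :=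
    (evalsMul_single hz _ _).mul
      (evalsMul_prod _ fun j _ => evalsMul_one.sub (evalsMul_single hz _ _))
  -- The factors in front of `U` are inverted by finite geometric sums, as the `a_j` with `j < 0`
  -- are nilpotent. The inverse is a Laurent polynomial, so multiplying by it preserves convergence
  -- and isolates the series of `U`.
  have hQ := (evalsMul_single hz (-ν) (↑c⁻¹ : A)).mul
    (evalsMul_prod (Finset.Icc 1 N) fun j _ =>
      evalsMul_sum (Finset.range (L j)) fun l _ =>
        evalsMul_prod (Finset.range l) fun _ _ => evalsMul_single hz (-(j : ℤ)) (a (-(j : ℤ))))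
  have hy (j : ℕ) (hj : j ∈ Finset.Icc 1 N) :
      (∑ l ∈ Finset.range (L j), ∏ _i ∈ Finset.range l, y j) * (1 - y j) = 1 := by
    have h1 : y j ^ L j = 0 := by
      simp only [y]
      rw [HahnSeries.single_pow, hL j (Finset.mem_Icc.1 hj).1, HahnSeries.single_eq_zero]
    simp only [Finset.prod_const, Finset.card_range]
    rw [geom_sum_mul_neg, h1, sub_zero]
  have hQR : HahnSeries.single (-ν) (↑c⁻¹ : A) *
      (∏ j ∈ Finset.Icc 1 N, ∑ l ∈ Finset.range (L j), ∏ _i ∈ Finset.range l, y j) *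
      (HahnSeries.single ν (a 0) * ∏ j ∈ Finset.Icc 1 N, (1 - y j)) = 1 := by
    rw [mul_mul_mul_comm, ← Finset.prod_mul_distrib, Finset.prod_congr rfl hy, Finset.prod_const_one,
      mul_one, HahnSeries.single_mul_single, ← hc, Units.inv_mul, neg_add_cancel]
    rfl
  have h1 := hQ _ _ h
  rw [← mul_assoc, hQR, one_mul] at h1
  refine ⟨_, h1.ofPowerSeries, ?_⟩
  rw [← mul_assoc, mul_comm (_ * _) (_ * _), hQ.mul_eq_one hR hQR, one_mul]

theorem HasProductExpansion.exists_eq_mul [IsLocalRing A] [Module.Finite ℂ A] {X : Type*}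
    [TopologicalSpace X] {f : X → A} {x : OpenPartialHomeomorph X ℂ} {ν : ℤ} {a : ℤ → A}
    (h : HasProductExpansion f x ν a) :
    IsUnit (a 0) ∧ (∀ j : ℤ, j < 0 → a j ∈ IsLocalRing.maximalIdeal A) ∧
    ∃ N : ℕ, (∀ j : ℤ, j < -(N : ℤ) → a j = 0) ∧ ∀ᶠ z in 𝓝[≠] (0 : ℂ),
      ∃ w, HasSum (fun n : ℕ => z ^ n • PowerSeries.coeff n (posProduct a)) w ∧
        f (x.symm z) =
          z ^ ν • a 0 * (∏ j ∈ Finset.Icc 1 N, (1 - z ^ (-(j : ℤ)) • a (-(j : ℤ)))) * w := by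
  obtain ⟨F, hF, ha0, hneg, N, hN, rfl⟩ := h
  refine ⟨ha0, hneg, N, hN, ?_⟩
  have h1 := eventually_all.2 fun i => hF ((Module.finBasis ℂ A).coord i)
  filter_upwards [h1, self_mem_nhdsWithin] with z h2 hz
  refine exists_eq_mul_of_evalsTo hz ha0
    (fun j hj => isNilpotent_of_mem_maximalIdeal (hneg _ (by omega))) ?_
  have h3 := hasSum_sum fun i (_ : i ∈ Finset.univ) => (h2 i).smul_const (Module.finBasis ℂ A i)
  simp only [Module.Basis.coord_apply, (Module.finBasis ℂ A).sum_repr] at h3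
  refine hasSum_of_hasSum_of_eq h3 fun n => ?_
  simp only [mul_comm _ (z ^ n), mul_smul]
  rw [← Finset.smul_sum, (Module.finBasis ℂ A).sum_repr]

end ContouCarrere

end Evaluation

/-! ### Convergence of the logarithm of a product expansion -/

section LogarithmSeries

namespace ContouCarrere

variable {A : Type*} [NormedCommRing A] [NormedAlgebra ℂ A]

theorem eqOn_ball_of_hasDerivAt_zero {V : Type*} [NormedAddCommGroup V] [NormedSpace ℂ V]
    {h : ℂ → V} {ρ : ℝ} (hd : ∀ z ∈ Metric.ball (0 : ℂ) ρ, HasDerivAt h 0 z) {z w : ℂ}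
    (hz : z ∈ Metric.ball (0 : ℂ) ρ) (hw : w ∈ Metric.ball (0 : ℂ) ρ) : h z = h w :=
  (convex_ball (0 : ℂ) ρ).is_const_of_fderivWithin_eq_zero (𝕜 := ℂ)
    (fun z hz => (hd z hz).differentiableAt.differentiableWithinAt)
    (fun z hz => by
      rw [fderivWithin_of_isOpen Metric.isOpen_ball hz]
      simpa using (hd z hz).hasFDerivAt.fderiv) hz hw

/-- The usual bound `C / ‖z‖ ^ n`, with the constant absorbed into the base; this is possible
because `n > 0`. -/
theorem exists_norm_le_pow_of_summable {u : ℕ → A} {z : ℂ} (hz : z ≠ 0)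
    (h : Summable fun n => z ^ n • u n) : ∃ R : ℝ, 1 ≤ R ∧ ∀ n, 0 < n → ‖u n‖ ≤ R ^ n := by
  obtain ⟨C, hC⟩ := h.tendsto_atTop_zero.norm.bddAbove_range
  have hz' : 0 < ‖z‖ := norm_pos_iff.2 hz
  refine ⟨max 1 (max 1 C / ‖z‖), le_max_left _ _, fun n hn => ?_⟩
  have h1 : ‖z‖ ^ n * ‖u n‖ ≤ C := by
    have := hC (mem_range_self n)
    rwa [norm_smul, norm_pow] at this
  have h2 : C ≤ (max 1 C) ^ n := (le_max_right 1 C).trans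
    (le_self_pow₀ (le_max_left _ _) hn.ne')
  calc ‖u n‖ ≤ (max 1 C) ^ n / ‖z‖ ^ n := by
        rw [le_div_iff₀ (by positivity), mul_comm]
        exact h1.trans h2
    _ = (max 1 C / ‖z‖) ^ n := (div_pow _ _ _).symm
    _ ≤ _ := pow_le_pow_left₀ (by positivity) (le_max_right _ _) n

theorem add_sum_four_pow_le (n : ℕ) : (n : ℝ) + ∑ j ∈ Finset.range n, (4 : ℝ) ^ j ≤ 4 ^ n := by
  induction n with
  | zero => simp
  | succ n ih =>
    rw [Finset.sum_range_succ, pow_succ]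
    push_cast
    have : (1 : ℝ) ≤ 4 ^ n := one_le_pow₀ (by norm_num)
    linarith

/-- Gives the logarithmic derivative a positive radius of convergence from that of `U` alone, with
no growth assumption on the `a_j`. Solving the recursion for `w n`, induction closes because `n +
∑_{j < n} 4 ^ j ≤ 4 ^ n`. -/
theorem norm_le_pow_of_antidiagonal {A : Type*} [NormedCommRing A] {u w : ℕ → A} (hu0 : u 0 = 1) (hw0 : w 0 = 0)
    (h : ∀ n : ℕ, (n : A) * u n
      = ∑ p ∈ Finset.HasAntidiagonal.antidiagonal n, u p.1 * w p.2)
    {R : ℝ} (hR : 1 ≤ R) (hu : ∀ n, 0 < n → ‖u n‖ ≤ R ^ n) (n : ℕ) : ‖w n‖ ≤ (4 * R) ^ n := by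
  induction n using Nat.strong_induction_on with
  | _ n ih =>
    rcases Nat.eq_zero_or_pos n with rfl | hn
    · simp [hw0]
    have h1 : w n = (n : A) * u n - ∑ k ∈ Finset.range n, u (k + 1) * w (n - (k + 1)) := by
      rw [h, Finset.Nat.sum_antidiagonal_eq_sum_range_succ (fun i j => u i * w j),
        Finset.sum_range_succ', hu0, one_mul, Nat.sub_zero, add_sub_cancel_left]
    have h2 : ‖(n : A) * u n‖ ≤ n * R ^ n := by
      rw [← nsmul_eq_mul]
      exact (norm_nsmul_le).trans (by gcongr; exact hu n hn)
    have h3 (k : ℕ) (hk : k ∈ Finset.range n) :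
        ‖u (k + 1) * w (n - (k + 1))‖ ≤ R ^ n * 4 ^ (n - 1 - k) := by
      rw [Finset.mem_range] at hk
      calc _ ≤ R ^ (k + 1) * (4 * R) ^ (n - (k + 1)) := (norm_mul_le _ _).trans
            (mul_le_mul (hu _ k.succ_pos) (ih _ (by omega)) (norm_nonneg _) (by positivity))
        _ = R ^ n * 4 ^ (n - 1 - k) := by
            rw [mul_pow, mul_left_comm, ← pow_add, Nat.add_sub_cancel' hk, mul_comm,
              show n - (k + 1) = n - 1 - k by omega]
    have h4 : ‖∑ k ∈ Finset.range n, u (k + 1) * w (n - (k + 1))‖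
        ≤ R ^ n * ∑ j ∈ Finset.range n, (4 : ℝ) ^ j := by
      rw [← Finset.sum_range_reflect (fun j => (4 : ℝ) ^ j), Finset.mul_sum]
      exact norm_sum_le_of_le _ h3
    calc ‖w n‖ ≤ n * R ^ n + R ^ n * ∑ j ∈ Finset.range n, (4 : ℝ) ^ j := by
          rw [h1]
          exact (norm_sub_le _ _).trans (add_le_add h2 h4)
      _ = R ^ n * (n + ∑ j ∈ Finset.range n, (4 : ℝ) ^ j) := by ring
      _ ≤ R ^ n * 4 ^ n := by gcongr; exact add_sum_four_pow_le n
      _ = _ := by rw [mul_pow, mul_comm]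

section PowerSums

variable {b : ℕ → A} {C K : ℝ}

theorem summable_norm_pow_smul (hb : ∀ n, ‖b n‖ ≤ C * K ^ n) (hK : 0 ≤ K) {z : ℂ}
    (hz : ‖z‖ * K < 1) : Summable fun n => ‖z ^ n • b n‖ := by
  refine Summable.of_nonneg_of_le (fun _ => norm_nonneg _) (fun n => ?_)
    ((summable_geometric_of_lt_one (by positivity) hz).mul_left C)
  rw [norm_smul, norm_pow, mul_pow, mul_left_comm]
  gcongr
  exact hb n

theorem hasDerivAt_tsum_pow_smul [CompleteSpace A] (hb : ∀ n, ‖b n‖ ≤ C * K ^ n) (hK : 0 < K)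
    {z : ℂ} (hz : ‖z‖ * K < 1) :
    HasDerivAt (fun z : ℂ => ∑' n, z ^ n • b n) (∑' n : ℕ, z ^ n • ((n + 1 : ℂ) • b (n + 1))) z := by
  -- A radius strictly between `‖z‖` and `1 / K` gives a summable bound for the derivatives that is
  -- uniform on a ball.
  obtain ⟨ρ, hρ1, hρ2⟩ := exists_between ((lt_div_iff₀ hK).2 hz)
  rw [lt_div_iff₀ hK] at hρ2
  have hρ0 : 0 ≤ ρ := (norm_nonneg z).trans hρ1.le
  have hC : 0 ≤ C := by simpa using (norm_nonneg _).trans (hb 0)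
  have hs : Summable fun n : ℕ => (n : ℝ) * ρ ^ (n - 1) * (C * K ^ n) := by
    rw [← summable_nat_add_iff 1]
    have h1 := (summable_pow_mul_geometric_of_norm_lt_one 1
      (by rwa [Real.norm_of_nonneg (by positivity)] : ‖ρ * K‖ < 1)).add
        (summable_geometric_of_lt_one (by positivity) hρ2)
    refine (h1.mul_left (C * K)).congr fun n => ?_
    push_cast
    rw [mul_pow, pow_succ K]
    ring
  have h2 := hasDerivAt_tsum_of_isPreconnected hs Metric.isOpen_ball
    (convex_ball (0 : ℂ) ρ).isPreconnected (g := fun n z => z ^ n • b n)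
    (g' := fun n z => ((n : ℂ) * z ^ (n - 1)) • b n) (y₀ := 0) (y := z)
    (fun n y _ => (hasDerivAt_pow n y).smul_const (b n))
    (fun n y hy => by
      rw [norm_smul, norm_mul, norm_pow, Complex.norm_natCast]
      have : ‖y‖ ≤ ρ := by simpa using (Metric.mem_ball.1 hy).le
      gcongr
      exact hb n)
    (by simpa using (norm_nonneg z).trans_lt hρ1)
    (summable_norm_pow_smul hb hK.le (by simp)).of_norm (by simpa using hρ1)
  refine h2.congr_deriv ?_
  have h3 : Summable fun n : ℕ => ((n : ℂ) * z ^ (n - 1)) • b n := by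
    refine Summable.of_norm_bounded hs fun n => ?_
    rw [norm_smul, norm_mul, norm_pow, Complex.norm_natCast]
    gcongr
    exact hb n
  rw [h3.tsum_eq_zero_add]
  simp only [Nat.cast_zero, zero_mul, zero_smul, zero_add, Nat.add_sub_cancel, smul_smul]
  push_cast
  simp only [mul_comm]

end PowerSums

/-- `U = exp (∑ (w_n / n) z ^ n)` when `z U' = U W`. -/
theorem tsum_eq_exp_of_antidiagonal [CompleteSpace A] {u w : ℕ → A} (hu0 : u 0 = 1) (hw0 : w 0 = 0)
    (h : ∀ n : ℕ, (n : A) * u n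
      = ∑ p ∈ Finset.HasAntidiagonal.antidiagonal n, u p.1 * w p.2)
    {C K : ℝ} (hK : 1 ≤ K) (hu : ∀ n, ‖u n‖ ≤ C * K ^ n) (hw : ∀ n, ‖w n‖ ≤ K ^ n) {z : ℂ}
    (hz : ‖z‖ * K < 1) :
    ∑' n, z ^ n • u n = NormedSpace.exp (∑' n : ℕ, z ^ n • ((n : ℂ)⁻¹ • w n)) := by
  have hK0 : 0 < K := by linarith
  have hc (n : ℕ) : ‖(n : ℂ)⁻¹ • w n‖ ≤ 1 * K ^ n := by
    rw [norm_smul, norm_inv, Complex.norm_natCast]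
    refine mul_le_mul ?_ (hw n) (norm_nonneg _) zero_le_one
    exact Nat.cast_inv_le_one n
  let U : ℂ → A := fun z => ∑' n, z ^ n • u n
  let ℓ : ℂ → A := fun z => ∑' n : ℕ, z ^ n • ((n : ℂ)⁻¹ • w n)
  -- `V` is the derivative of `ℓ`. The recursion, read as a Cauchy product, says `U' = U V`, so `U *
  -- exp (-ℓ)` is constant on the disc.
  let V : ℂ → A := fun z => ∑' n : ℕ, z ^ n • w (n + 1)
  have hmem {z : ℂ} : z ∈ Metric.ball (0 : ℂ) K⁻¹ ↔ ‖z‖ * K < 1 := by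
    rw [mem_ball_zero_iff, ← one_div, lt_div_iff₀ hK0]
  have hℓ (z : ℂ) (hz : ‖z‖ * K < 1) : HasDerivAt ℓ (V z) z := by
    refine (hasDerivAt_tsum_pow_smul hc hK0 hz).congr_deriv (Eq.symm ?_)
    refine tsum_congr fun n => ?_
    have : (n + 1 : ℂ) ≠ 0 := by exact_mod_cast n.succ_ne_zero
    push_cast
    rw [smul_smul (n + 1 : ℂ), mul_inv_cancel₀ this, one_smul]
  have hU (z : ℂ) (hz : ‖z‖ * K < 1) : HasDerivAt U (U z * V z) z := by
    refine (hasDerivAt_tsum_pow_smul hu hK0 hz).congr_deriv (Eq.symm ?_)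
    have hw1 (n : ℕ) : ‖w (n + 1)‖ ≤ K * K ^ n := by rw [← pow_succ']; exact hw _
    rw [tsum_mul_tsum_eq_tsum_sum_antidiagonal_of_summable_norm
      (summable_norm_pow_smul hu hK0.le hz) (summable_norm_pow_smul hw1 hK0.le hz)]
    refine tsum_congr fun n => ?_
    have h1 : (n + 1 : ℂ) • u (n + 1) = ((n + 1 : ℕ) : A) * u (n + 1) := by
      rw [← nsmul_eq_mul, ← Nat.cast_smul_eq_nsmul ℂ]
      push_cast
      rfl
    rw [h1, h, Finset.Nat.sum_antidiagonal_succ', hw0, mul_zero, zero_add, Finset.smul_sum]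
    refine Finset.sum_congr rfl fun p hp => ?_
    rw [Finset.HasAntidiagonal.mem_antidiagonal] at hp
    rw [smul_mul_smul_comm, ← pow_add, hp]
  have hd (z : ℂ) (hz : z ∈ Metric.ball (0 : ℂ) K⁻¹) :
      HasDerivAt (fun z => U z * NormedSpace.exp (-ℓ z)) 0 z := by
    rw [hmem] at hz
    refine ((hU z hz).fun_mul (hasDerivAt_exp (hℓ z hz).fun_neg)).congr_deriv ?_
    ring
  have h0 : (0 : ℂ) ∈ Metric.ball (0 : ℂ) K⁻¹ := by simpa using hK0
  have h1 := eqOn_ball_of_hasDerivAt_zero hd (hmem.2 hz) h0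
  have hU0 : U 0 = 1 := by
    simp only [U]
    rw [tsum_eq_single 0 fun n hn => by simp [hn]]
    simp [hu0]
  have hℓ0 : ℓ 0 = 0 := by
    simp only [ℓ]
    rw [tsum_eq_single 0 fun n hn => by simp [hn]]
    simp
  simp only [hU0, hℓ0, neg_zero, NormedSpace.exp_zero, mul_one] at h1
  change U z = NormedSpace.exp (ℓ z)
  calc U z = U z * (NormedSpace.exp (ℓ z) * NormedSpace.exp (-ℓ z)) := by
        rw [exp_mul_exp_neg, mul_one]
    _ = U z * NormedSpace.exp (-ℓ z) * NormedSpace.exp (ℓ z) := by ring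
    _ = _ := by rw [h1, one_mul]

/-- Near `0`, a convergent product `∏ (1 - a_j z ^ j)` is the exponential of its logarithm. -/
theorem exists_posProduct_eq_exp [CompleteSpace A] (a : ℤ → A) {z₀ : ℂ} (hz₀ : z₀ ≠ 0)
    (h : Summable fun n => z₀ ^ n • PowerSeries.coeff n (posProduct a)) :
    ∃ K : ℝ, 1 ≤ K ∧ (∀ n : ℕ, ‖dlogCoeff (fun j => a j) n‖ ≤ K ^ n) ∧
      ∀ (z : ℂ) (w : A), ‖z‖ * K < 1 →
        HasSum (fun n : ℕ => z ^ n • PowerSeries.coeff n (posProduct a)) w →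
        w = NormedSpace.exp (∑' n : ℕ, z ^ n • ((n : ℂ)⁻¹ • -dlogCoeff (fun j => a j) n)) := by
  obtain ⟨R, hR, hu⟩ := exists_norm_le_pow_of_summable hz₀ h
  have hu0 : PowerSeries.coeff 0 (posProduct a) = 1 := by
    rw [PowerSeries.coeff_zero_eq_constantCoeff_apply, constantCoeff_posProduct]
  have hw0 : -dlogCoeff (fun j : ℕ => a j) 0 = 0 := by simp [dlogCoeff]
  have hw := norm_le_pow_of_antidiagonal (w := fun n => -dlogCoeff (fun j : ℕ => a j) n) hu0 hw0
    (natCast_mul_coeff_posProduct a) hR hu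
  refine ⟨4 * R, by linarith, fun n => by simpa using hw n, fun z w hz hzw => ?_⟩
  rw [← hzw.tsum_eq]
  refine tsum_eq_exp_of_antidiagonal (w := fun n => -dlogCoeff (fun j : ℕ => a j) n)
    -- The norm of `1` is not assumed to be `1`, and the coefficient for `n = 0` is `1`.
    (C := max 1 ‖(1 : A)‖) hu0 hw0 (natCast_mul_coeff_posProduct a) (by linarith) (fun n => ?_) hw hz
  rcases Nat.eq_zero_or_pos n with rfl | hn
  · rw [hu0, pow_zero, mul_one]
    exact le_max_right _ _
  · calc _ ≤ R ^ n := hu n hn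
      _ ≤ (4 * R) ^ n := by gcongr; linarith
      _ ≤ _ := le_mul_of_one_le_left (by positivity) (le_max_left _ _)

/-- A finite product `∏ (1 - α_j ζ ^ j)` with nilpotent `α_j` is the exponential of its logarithm. -/
theorem prod_one_sub_eq_exp [CompleteSpace A] {α : ℕ → A} {N L M : ℕ} (hL : 0 < L)
    (hαL : ∀ j, 0 < j → α j ^ L = 0) (hαN : ∀ j, N < j → α j = 0) (hM : N * L ≤ M) (ζ : ℂ) :
    ∏ j ∈ Finset.Icc 1 N, (1 - ζ ^ j • α j)
      = NormedSpace.exp (-∑ m ∈ Finset.Icc 1 M, ζ ^ m • ((m : ℂ)⁻¹ • dlogCoeff α m)) := by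
  have hNM : N ≤ M := (Nat.le_mul_of_pos_right N hL).trans hM
  have h1 : ∏ j ∈ Finset.Icc 1 N, (1 - ζ ^ j • α j) = ∏ j ∈ Finset.Icc 1 M, (1 - ζ ^ j • α j) := by
    refine Finset.prod_subset (Finset.Icc_subset_Icc_right hNM) fun j hj hj' => ?_
    rw [Finset.mem_Icc] at hj hj'
    rw [hαN j (by omega)]
    simp
  have h2 (j : ℕ) (hj : j ∈ Finset.Icc 1 M) : (ζ ^ j • α j) ^ (M / j + 1) = 0 := by
    rw [Finset.mem_Icc] at hj
    rw [smul_pow]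
    rcases lt_or_ge N j with h | h
    · rw [hαN j h, zero_pow (Nat.succ_ne_zero _), smul_zero]
    · have h3 : L ≤ M / j := (Nat.le_div_iff_mul_le hj.1).2
        (((mul_comm L j).trans_le (Nat.mul_le_mul_right L h)).trans hM)
      rw [pow_eq_zero_of_le (by omega) (hαL j hj.1), smul_zero]
  rw [h1, ← Finset.prod_congr rfl fun j hj => exp_neg_sum_pow_div (h2 j hj), ← exp_finset_sum,
    Finset.sum_neg_distrib]
  congr 2
  have h3 (j : ℕ) (hj : j ∈ Finset.Icc 1 M) :
      ∑ t ∈ Finset.Icc 1 (M / j), (t : ℂ)⁻¹ • (ζ ^ j • α j) ^ t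
        = ∑ m ∈ Finset.Icc 1 M, if j ∣ m then
            ζ ^ m • ((m : ℂ)⁻¹ • ((j : A) * α j ^ (m / j))) else 0 := by
    have hj0 := (Finset.mem_Icc.1 hj).1
    rw [← Finset.sum_filter, sum_Icc_filter_dvd hj0]
    refine Finset.sum_congr rfl fun t ht => ?_
    rw [Nat.mul_div_cancel _ hj0, smul_pow, ← pow_mul, mul_comm j t, smul_comm]
    congr 1
    have : (j : ℂ) ≠ 0 := by exact_mod_cast (Nat.pos_iff_ne_zero.1 hj0)
    rw [← nsmul_eq_mul, ← Nat.cast_smul_eq_nsmul ℂ, smul_smul]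
    congr 1
    push_cast
    rw [mul_inv, mul_assoc, inv_mul_cancel₀ this, mul_one]
  rw [Finset.sum_congr rfl h3, Finset.sum_comm]
  refine Finset.sum_congr rfl fun m hm => ?_
  rw [Finset.mem_Icc] at hm
  rw [dlogCoeff_eq_sum_Icc α hm.1 hm.2, Finset.smul_sum, Finset.smul_sum]
  refine Finset.sum_congr rfl fun j _ => ?_
  split_ifs <;> simp

end ContouCarrere

end LogarithmSeries

/-! ### Fourier series on a circle and their iterated integrals -/

section FourierSums

namespace ContouCarrere

/-- The circle `t ↦ r * exp (2 π i t)`. -/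
noncomputable def circlePath (r : ℝ) (t : ℝ) : ℂ := r * Complex.exp (2 * Real.pi * Complex.I * t)

theorem norm_circlePath {r : ℝ} (hr : 0 < r) (t : ℝ) : ‖circlePath r t‖ = r := by
  have : 2 * (Real.pi : ℂ) * Complex.I * t = ((2 * Real.pi * t : ℝ) : ℂ) * Complex.I := by
    push_cast; ring
  rw [circlePath, norm_mul, this, Complex.norm_exp_ofReal_mul_I, mul_one, Complex.norm_real,
    Real.norm_of_nonneg hr.le]

theorem circlePath_ne_zero {r : ℝ} (hr : 0 < r) (t : ℝ) : circlePath r t ≠ 0 := by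
  rw [← norm_pos_iff, norm_circlePath hr]
  exact hr

theorem circlePath_zero (r : ℝ) : circlePath r 0 = r := by simp [circlePath]

theorem circlePath_one (r : ℝ) : circlePath r 1 = r := by simp [circlePath]

theorem hasDerivAt_circlePath (r t : ℝ) :
    HasDerivAt (circlePath r) (2 * Real.pi * Complex.I * circlePath r t) t := by
  have h1 : HasDerivAt (fun t : ℝ => 2 * (Real.pi : ℂ) * Complex.I * t)
      (2 * Real.pi * Complex.I) t := by
    simpa using (hasDerivAt_id t).ofReal_comp.const_mul (2 * (Real.pi : ℂ) * Complex.I)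
  refine (h1.cexp.const_mul (r : ℂ)).congr_deriv ?_
  rw [circlePath]
  ring

theorem continuous_circlePath (r : ℝ) : Continuous (circlePath r) :=
  continuous_iff_continuousAt.2 fun t => (hasDerivAt_circlePath r t).continuousAt

theorem hasDerivAt_circlePath_zpow {r : ℝ} (hr : 0 < r) (n : ℤ) (t : ℝ) :
    HasDerivAt (fun t => circlePath r t ^ n)
      (2 * Real.pi * Complex.I * n * circlePath r t ^ n) t := by
  have h1 := (hasDerivAt_zpow n (circlePath r t) (Or.inl (circlePath_ne_zero hr t))).comp_of_eq t
    (hasDerivAt_circlePath r t) rfl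
  refine h1.congr_deriv ?_
  rw [zpow_sub_one₀ (circlePath_ne_zero hr t)]
  field_simp [circlePath_ne_zero hr t]

theorem continuous_circlePath_zpow {r : ℝ} (hr : 0 < r) (n : ℤ) :
    Continuous fun t => circlePath r t ^ n :=
  continuous_iff_continuousAt.2 fun t => (hasDerivAt_circlePath_zpow hr n t).continuousAt

theorem integral_circlePath_zpow {r : ℝ} (hr : 0 < r) (n : ℤ) :
    ∫ t in (0 : ℝ)..1, circlePath r t ^ n = if n = 0 then 1 else 0 := by
  split_ifs with h
  · simp [h]
  · have hn : 2 * (Real.pi : ℂ) * Complex.I * n ≠ 0 := by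
      simp [Real.pi_ne_zero, h]
    have h1 := intervalIntegral.integral_eq_sub_of_hasDerivAt (a := 0) (b := 1)
      (fun t _ => hasDerivAt_circlePath_zpow hr n t)
      (((continuous_circlePath_zpow hr n).const_mul _).intervalIntegrable _ _)
    rw [circlePath_zero, circlePath_one, sub_self, intervalIntegral.integral_const_mul] at h1
    exact (mul_eq_zero.1 h1).resolve_left hn

variable {A : Type*} [NormedCommRing A] [NormedAlgebra ℂ A]

/-- The sum `∑ b_n z ^ n` on the circle of radius `r`. -/
noncomputable def fourierSum (r : ℝ) (b : ℤ → A) (t : ℝ) : A := ∑' n : ℤ, circlePath r t ^ n • b n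

variable {r : ℝ} {b d : ℤ → A}

theorem norm_circlePath_zpow_smul (hr : 0 < r) (n : ℤ) (t : ℝ) (v : A) :
    ‖circlePath r t ^ n • v‖ = r ^ n * ‖v‖ := by
  rw [norm_smul, norm_zpow, norm_circlePath hr]

theorem fourierSum_one (r : ℝ) (b : ℤ → A) : fourierSum r b 1 = fourierSum r b 0 := by
  simp only [fourierSum, circlePath_zero, circlePath_one]

/-- The weight `|n| + 1` controls both the series and its termwise derivative. -/
theorem summable_of_weighted {A : Type*} [NormedCommRing A] {r : ℝ} {b : ℤ → A} (hr : 0 < r)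
    (hb : Summable fun n : ℤ => (|(n : ℝ)| + 1) * (r ^ n * ‖b n‖)) :
    Summable fun n : ℤ => r ^ n * ‖b n‖ :=
  hb.of_nonneg_of_le (fun n => by positivity) fun n =>
    le_mul_of_one_le_left (by positivity) (by linarith [abs_nonneg (n : ℝ)])

theorem summable_deriv_of_weighted (hr : 0 < r)
    (hb : Summable fun n : ℤ => (|(n : ℝ)| + 1) * (r ^ n * ‖b n‖)) :
    Summable fun n : ℤ => r ^ n * ‖(2 * Real.pi * Complex.I * n : ℂ) • b n‖ := by
  refine (hb.mul_left (2 * Real.pi)).of_nonneg_of_le (fun n => by positivity) fun n => ?_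
  have h1 : ‖(2 * Real.pi * Complex.I * n : ℂ)‖ = 2 * Real.pi * |(n : ℝ)| := by
    rw [norm_mul, norm_mul, norm_mul, Complex.norm_I, Complex.norm_real,
      Real.norm_of_nonneg Real.pi_pos.le, Complex.norm_intCast]
    simp
  rw [norm_smul, h1]
  have h2 : 0 ≤ 2 * Real.pi * (r ^ n * ‖b n‖) := by positivity
  linarith

variable [CompleteSpace A]

theorem hasSum_fourierSum (hr : 0 < r) (hb : Summable fun n : ℤ => r ^ n * ‖b n‖) (t : ℝ) :
    HasSum (fun n : ℤ => circlePath r t ^ n • b n) (fourierSum r b t) :=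
  (Summable.of_norm (by simpa only [norm_circlePath_zpow_smul hr] using hb)).hasSum

theorem continuous_fourierSum (hr : 0 < r) (hb : Summable fun n : ℤ => r ^ n * ‖b n‖) :
    Continuous (fourierSum r b) :=
  continuous_tsum (fun n => (continuous_circlePath_zpow hr n).smul continuous_const) hb
    fun n t => (norm_circlePath_zpow_smul hr n t _).le

theorem hasDerivAt_fourierSum (hr : 0 < r)
    (hb : Summable fun n : ℤ => (|(n : ℝ)| + 1) * (r ^ n * ‖b n‖)) (t : ℝ) :
    HasDerivAt (fourierSum r b)
      (fourierSum r (fun n => (2 * Real.pi * Complex.I * n : ℂ) • b n) t) t := by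
  have h1 := hasDerivAt_tsum (summable_deriv_of_weighted hr hb)
    (g := fun (n : ℤ) (t : ℝ) => circlePath r t ^ n • b n)
    (g' := fun n t => circlePath r t ^ n • ((2 * Real.pi * Complex.I * n : ℂ) • b n))
    (fun n t => ?_) (fun n t => (norm_circlePath_zpow_smul hr n t _).le) (y₀ := 0)
    (hasSum_fourierSum hr (summable_of_weighted hr hb) 0).summable t
  · exact h1
  · refine ((hasDerivAt_circlePath_zpow hr n t).smul_const (b n)).congr_deriv ?_
    rw [smul_smul, mul_comm]

theorem hasSum_integral_circlePath (hr : 0 < r) (hb : Summable fun n : ℤ => r ^ n * ‖b n‖)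
    {G : ℝ → A} (hG : Continuous G) :
    HasSum (fun n : ℤ => b n * ∫ t in (0 : ℝ)..1, circlePath r t ^ n • G t)
      (∫ t in (0 : ℝ)..1, fourierSum r b t * G t) := by
  have hcont (n : ℤ) : Continuous fun t => circlePath r t ^ n • G t :=
    (continuous_circlePath_zpow hr n).smul hG
  have h1 := intervalIntegral.hasSum_integral_of_dominated_convergence (μ := MeasureTheory.volume)
    (a := 0) (b := 1)
    (F := fun (n : ℤ) t => b n * (circlePath r t ^ n • G t)) (f := fun t => fourierSum r b t * G t)
    (fun n t => r ^ n * ‖b n‖ * ‖G t‖)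
    (fun n => ((hcont n).const_mul (b n)).aestronglyMeasurable)
    (fun n => .of_forall fun t _ => ?_)
    (.of_forall fun t _ => hb.mul_right _)
    ?_ (.of_forall fun t _ => ?_)
  · refine hasSum_of_hasSum_of_eq h1 fun n => ?_
    exact ((ContinuousLinearMap.mul ℝ A (b n)).intervalIntegral_comp_comm
      ((hcont n).intervalIntegrable 0 1)).symm
  · rw [mul_smul_comm, ← smul_mul_assoc]
    exact (norm_mul_le _ _).trans (by rw [norm_circlePath_zpow_smul hr])
  · simp_rw [tsum_mul_right]
    exact (hG.norm.const_mul _).intervalIntegrable _ _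
  · refine hasSum_of_hasSum_of_eq ((hasSum_fourierSum hr hb t).mul_right (G t)) fun n => ?_
    rw [mul_smul_comm, ← smul_mul_assoc]

theorem integral_zpow_smul_fourierSum (hr : 0 < r) (hb : Summable fun n : ℤ => r ^ n * ‖b n‖)
    (m : ℤ) : ∫ t in (0 : ℝ)..1, circlePath r t ^ m • fourierSum r b t = b (-m) := by
  have h1 := hasSum_integral_circlePath hr hb (G := fun t => circlePath r t ^ m • (1 : A))
    ((continuous_circlePath_zpow hr m).smul continuous_const)
  have h2 (n : ℤ) : b n * ∫ t in (0 : ℝ)..1, circlePath r t ^ n • circlePath r t ^ m • (1 : A)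
      = if n = -m then b n else 0 := by
    simp_rw [smul_smul, ← zpow_add₀ (circlePath_ne_zero hr _)]
    rw [intervalIntegral.integral_smul_const, integral_circlePath_zpow hr]
    by_cases h : n = -m
    · simp [h]
    · rw [if_neg h, if_neg (by omega), zero_smul, mul_zero]
  have h3 := h1.tsum_eq
  simp_rw [h2, tsum_ite_eq, mul_smul_comm, mul_one] at h3
  exact h3.symm

theorem integral_fourierSum (hr : 0 < r) (hb : Summable fun n : ℤ => r ^ n * ‖b n‖) :
    ∫ t in (0 : ℝ)..1, fourierSum r b t = b 0 := by
  simpa using integral_zpow_smul_fourierSum hr hb 0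

theorem integral_fourierSum_mul_fourierSum (hr : 0 < r)
    (hb : Summable fun n : ℤ => r ^ n * ‖b n‖) (hd : Summable fun n : ℤ => r ^ n * ‖d n‖) :
    ∫ t in (0 : ℝ)..1, fourierSum r b t * fourierSum r d t = ∑' n : ℤ, b n * d (-n) := by
  rw [← (hasSum_integral_circlePath hr hb (continuous_fourierSum hr hd)).tsum_eq]
  exact tsum_congr fun n => by rw [integral_zpow_smul_fourierSum hr hd]

/-- The derivative of `2 π i ν t + ∑ b_n z ^ n` along the circle of radius `r`. -/
noncomputable def circleDlog (r : ℝ) (ν : ℤ) (b : ℤ → A) (t : ℝ) : A :=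
  (2 * Real.pi * Complex.I * ν : ℂ) • 1 +
    fourierSum r (fun n => (2 * Real.pi * Complex.I * n : ℂ) • b n) t

theorem hasDerivAt_add_fourierSum (hr : 0 < r) (ν : ℤ)
    (hb : Summable fun n : ℤ => (|(n : ℝ)| + 1) * (r ^ n * ‖b n‖)) (t : ℝ) :
    HasDerivAt (fun t : ℝ => (2 * Real.pi * Complex.I * ν * t : ℂ) • (1 : A) + fourierSum r b t)
      (circleDlog r ν b t) t := by
  refine HasDerivAt.fun_add ?_ (hasDerivAt_fourierSum hr hb t)
  have h1 : HasDerivAt (fun t : ℝ => (2 * Real.pi * Complex.I * ν * t : ℂ))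
      (2 * Real.pi * Complex.I * ν) t := by
    simpa using (hasDerivAt_id t).ofReal_comp.const_mul (2 * (Real.pi : ℂ) * Complex.I * ν)
  exact h1.smul_const (1 : A)

theorem continuous_circleDlog (hr : 0 < r) (ν : ℤ)
    (hb : Summable fun n : ℤ => (|(n : ℝ)| + 1) * (r ^ n * ‖b n‖)) :
    Continuous (circleDlog r ν b) :=
  continuous_const.add (continuous_fourierSum hr (summable_deriv_of_weighted hr hb))

theorem integral_circleDlog (hr : 0 < r) (ν : ℤ)
    (hb : Summable fun n : ℤ => (|(n : ℝ)| + 1) * (r ^ n * ‖b n‖)) {s : ℝ} :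
    ∫ t in (0 : ℝ)..s, circleDlog r ν b t
      = ((2 * Real.pi * Complex.I * ν * s : ℂ) • 1 + fourierSum r b s) - fourierSum r b 0 := by
  rw [intervalIntegral.integral_eq_sub_of_hasDerivAt
    (fun t _ => hasDerivAt_add_fourierSum hr ν hb t)
    ((continuous_circleDlog hr ν hb).intervalIntegrable _ _)]
  simp

/-- Expand `(ϖ ν t + p) (ϖ μ + q')`, where `ϖ = 2πi`. The term in `t` gives half of `ϖ² ν μ`,
integration by parts turns `t q'` into `q 0` because `q` has mean zero, `p` has mean zero too, and
`p q'` gives the residue sum. The term in `p 0` comes from the lower limit of the inner integral. -/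
theorem iteratedIntegral_circleDlog [Module.Finite ℂ A] (hr : 0 < r) (ν μ : ℤ)
    (hb : Summable fun n : ℤ => (|(n : ℝ)| + 1) * (r ^ n * ‖b n‖))
    (hd : Summable fun n : ℤ => (|(n : ℝ)| + 1) * (r ^ n * ‖d n‖)) (hb0 : b 0 = 0)
    (hd0 : d 0 = 0) :
    (1 / (2 * (Real.pi : ℂ) * Complex.I)) •
        iteratedIntegral (circleDlog r ν b) (circleDlog r μ d)
      = (Real.pi * Complex.I * (ν * μ) : ℂ) • (1 : A) + (ν : ℂ) • fourierSum r d 0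
        - (μ : ℂ) • fourierSum r b 0 + ∑' n : ℤ, (-n : ℂ) • (b n * d (-n)) := by
  set ϖ : ℂ := 2 * Real.pi * Complex.I with hϖ
  have hϖ0 : ϖ ≠ 0 := by simp [hϖ, Real.pi_ne_zero]
  set p := fourierSum r b
  set q := fourierSum r d
  set q' := fourierSum r (fun n => (ϖ * n : ℂ) • d n)
  have hpc : Continuous p := continuous_fourierSum hr (summable_of_weighted hr hb)
  have hqc : Continuous q := continuous_fourierSum hr (summable_of_weighted hr hd)
  have hq'c : Continuous q' := continuous_fourierSum hr (summable_deriv_of_weighted hr hd)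
  let L : ℝ → A := fun t => (ϖ * ν * t : ℂ) • (1 : A) + p t
  have hLd (t : ℝ) : HasDerivAt L (circleDlog r ν b t) t := hasDerivAt_add_fourierSum hr ν hb t
  have h1 := iteratedIntegral_eq (L := L)
    ((continuous_circleDlog hr ν hb).intervalIntegrable 0 1)
    ((continuous_circleDlog hr μ hd).intervalIntegrable 0 1)
    (fun t _ => (hLd t).continuousAt.continuousWithinAt)
    (fun t _ => intervalIntegral.integral_eq_sub_of_hasDerivAt (fun t _ => hLd t)
      ((continuous_circleDlog hr ν hb).intervalIntegrable _ _))
  -- An antiderivative of `ϖ² ν μ t + ϖ ν t q'` together with the extra term `ϖ ν q`, which is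
  -- subtracted again in `h2`.
  let W : ℝ → A := fun t => (ϖ ^ 2 * ν * μ * t ^ 2 / 2 : ℂ) • (1 : A) + (ϖ * ν * t : ℂ) • q t
  have hW (t : ℝ) : HasDerivAt W ((ϖ ^ 2 * ν * μ * t : ℂ) • (1 : A) +
      ((ϖ * ν * t : ℂ) • q' t + (ϖ * ν : ℂ) • q t)) t := by
    have e1 : HasDerivAt (fun t : ℝ => (ϖ ^ 2 * ν * μ * t ^ 2 / 2 : ℂ)) (ϖ ^ 2 * ν * μ * t) t := by
      refine ((((hasDerivAt_id t).ofReal_comp.pow 2).const_mul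
        (ϖ ^ 2 * ν * μ)).div_const 2).congr_deriv ?_
      simp
      ring
    have e2 : HasDerivAt (fun t : ℝ => (ϖ * ν * t : ℂ)) (ϖ * ν) t := by
      simpa using (hasDerivAt_id t).ofReal_comp.const_mul (ϖ * ν)
    exact (e1.smul_const (1 : A)).fun_add (e2.fun_smul (hasDerivAt_fourierSum hr hd t))
  have hWc : Continuous fun t : ℝ => (ϖ ^ 2 * ν * μ * t : ℂ) • (1 : A) +
      ((ϖ * ν * t : ℂ) • q' t + (ϖ * ν : ℂ) • q t) := by fun_prop
  have hWi := intervalIntegral.integral_eq_sub_of_hasDerivAt (a := 0) (b := 1) (fun t _ => hW t)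
    (hWc.intervalIntegrable _ _)
  have h2 : ∫ t in (0 : ℝ)..1, L t * circleDlog r μ d t
      = (W 1 - W 0) - (ϖ * ν : ℂ) • (∫ t in (0 : ℝ)..1, q t) + (ϖ * μ : ℂ) • (∫ t in (0 : ℝ)..1, p t)
        + ∫ t in (0 : ℝ)..1, p t * q' t := by
    have i1 : IntervalIntegrable _ MeasureTheory.volume (0 : ℝ) 1 := hWc.intervalIntegrable 0 1
    have i2 : IntervalIntegrable (fun t => (ϖ * ν : ℂ) • q t) MeasureTheory.volume (0 : ℝ) 1 :=
      (hqc.const_smul _).intervalIntegrable 0 1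
    have i3 : IntervalIntegrable (fun t => (ϖ * μ : ℂ) • p t) MeasureTheory.volume (0 : ℝ) 1 :=
      (hpc.const_smul _).intervalIntegrable 0 1
    have i4 : IntervalIntegrable (fun t => p t * q' t) MeasureTheory.volume (0 : ℝ) 1 :=
      (hpc.mul hq'c).intervalIntegrable 0 1
    rw [← hWi, ← intervalIntegral.integral_smul, ← intervalIntegral.integral_smul,
      ← intervalIntegral.integral_sub i1 i2, ← intervalIntegral.integral_add (i1.sub i2) i3,
      ← intervalIntegral.integral_add ((i1.sub i2).add i3) i4]
    refine intervalIntegral.integral_congr fun t _ => ?_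
    change ((ϖ * ν * t : ℂ) • (1 : A) + p t) * ((ϖ * μ : ℂ) • 1 + q' t) = _
    simp only [Algebra.smul_def, map_mul, map_pow]
    ring
  rw [integral_fourierSum hr (summable_of_weighted hr hb),
    integral_fourierSum hr (summable_of_weighted hr hd), hb0, hd0,
    integral_fourierSum_mul_fourierSum hr (summable_of_weighted hr hb)
      (summable_deriv_of_weighted hr hd)] at h2
  have h3 : ∑' n : ℤ, b n * ((ϖ * ((-n : ℤ) : ℂ)) • d (-n))
      = ϖ • ∑' n : ℤ, (-n : ℂ) • (b n * d (-n)) := by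
    rw [← tsum_const_smul'' ϖ]
    refine tsum_congr fun n => ?_
    rw [mul_smul_comm, mul_smul]
    push_cast
    rfl
  rw [h1, h2, h3, integral_circleDlog hr μ hd]
  have e1 : q 1 = q 0 := fourierSum_one r d
  have e2 : L 0 = p 0 := by simp [L]
  have e3 : W 1 - W 0 = (ϖ ^ 2 * ν * μ / 2 : ℂ) • (1 : A) + (ϖ * ν : ℂ) • q 0 := by
    simp [W, e1]
  rw [e2, e3]
  change (1 / ϖ) • (_ - p 0 * (((ϖ * μ * ((1 : ℝ) : ℂ)) • 1 + q 1) - q 0)) = _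
  rw [e1]
  have e4 : ϖ⁻¹ * (ϖ ^ 2 * ν * μ / 2) = Real.pi * Complex.I * (ν * μ) := by
    rw [hϖ]
    field_simp
  have e5 := congrArg (algebraMap ℂ A) e4
  have e6 : algebraMap ℂ A ϖ⁻¹ * algebraMap ℂ A ϖ = 1 := by
    rw [← map_mul, inv_mul_cancel₀ hϖ0, map_one]
  rw [map_mul] at e5
  simp only [Algebra.smul_def, one_div, Complex.ofReal_one, mul_one, mul_zero, map_mul,
    sub_zero, add_zero, add_sub_cancel_right] at e5 ⊢
  linear_combination e5 + (algebraMap ℂ A ν * q 0 - algebraMap ℂ A μ * p 0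
    + ∑' n : ℤ, algebraMap ℂ A (-n) * (b n * d (-n))) * e6

end ContouCarrere

end FourierSums

/-! ### The formula on a small circle -/

section LocalSymbol

namespace ContouCarrere

theorem unitZPow_coe {A : Type*} [CommRing A] (u : Aˣ) (n : ℤ) :
    unitZPow (u : A) n = ((u ^ n : Aˣ) : A) := by
  unfold unitZPow
  split_ifs with h
  · lift n to ℕ using h
    simp
  · obtain ⟨m, rfl⟩ : ∃ m : ℕ, n = -(m : ℤ) := ⟨n.natAbs, by omega⟩
    simp

/-- In `m = j t > N L` either `j > N` or `t > L`, and either way `α j ^ t = 0`. -/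
theorem dlogCoeff_eq_zero {A : Type*} [CommRing A] {α : ℕ → A} {N L m : ℕ}
    (hαL : ∀ j, 0 < j → α j ^ L = 0) (hαN : ∀ j, N < j → α j = 0) (hm : N * L < m) :
    dlogCoeff α m = 0 := by
  refine Finset.sum_eq_zero fun j hj => ?_
  rw [Nat.mem_divisors] at hj
  obtain ⟨⟨t, rfl⟩, hm0⟩ := hj
  have hj0 : 0 < j := Nat.pos_of_ne_zero fun h => hm0 (by simp [h])
  have ht0 : t ≠ 0 := fun h => hm0 (by simp [h])
  rw [Nat.mul_div_cancel_left t hj0]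
  rcases lt_or_ge N j with h | h
  · rw [hαN j h, zero_pow ht0, mul_zero]
  · have : L < t := by
      by_contra h'
      have := Nat.mul_le_mul h (not_lt.1 h')
      omega
    rw [pow_eq_zero_of_le this.le (hαL j hj0), mul_zero]

/-- The coefficient of `z ^ n` in the logarithm of
`∏_{j < 0} (1 - a_j z ^ j) * ∏_{j > 0} (1 - a_j z ^ j)`. -/
noncomputable def logCoeff {A : Type*} [CommRing A] [Algebra ℂ A] (a : ℤ → A) (n : ℤ) : A :=
  -((n.natAbs : ℂ)⁻¹ • dlogCoeff (fun j => a (n.sign * j)) n.natAbs)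

section LogCoeff

variable {A : Type*} [CommRing A] [Algebra ℂ A] (a : ℤ → A)

theorem logCoeff_zero : logCoeff a 0 = 0 := by simp [logCoeff]

theorem logCoeff_natCast (n : ℕ) :
    logCoeff a n = (n : ℂ)⁻¹ • -dlogCoeff (fun j => a j) n := by
  rcases Nat.eq_zero_or_pos n with rfl | h
  · simp [logCoeff]
  · rw [logCoeff, Int.natAbs_natCast, Int.sign_natCast_of_ne_zero h.ne', smul_neg]
    simp only [one_mul]

theorem logCoeff_neg_natCast (n : ℕ) :
    logCoeff a (-(n : ℤ)) = -((n : ℂ)⁻¹ • dlogCoeff (fun j => a (-(j : ℤ))) n) := by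
  rcases Nat.eq_zero_or_pos n with rfl | h
  · simp [logCoeff]
  · rw [logCoeff, Int.natAbs_neg, Int.natAbs_natCast, Int.sign_neg,
      Int.sign_natCast_of_ne_zero h.ne']
    simp only [neg_mul, one_mul]

end LogCoeff

theorem sum_range_succ_eq_sum_Icc {B : Type*} [AddCommMonoid B] (F : ℕ → B) (M : ℕ) :
    ∑ n ∈ Finset.range M, F (n + 1) = ∑ n ∈ Finset.Icc 1 M, F n := by
  rw [Finset.range_eq_Ico, Finset.sum_Ico_add' F]
  rfl

variable {A : Type*} [NormedCommRing A] [NormedAlgebra ℂ A] [Module.Finite ℂ A]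
  {X : Type*} [TopologicalSpace X]

/-- A function with a product expansion is, near the centre, `a_0 z ^ ν` times the exponential of an
absolutely convergent Laurent series without constant term. -/
theorem HasProductExpansion.exists_eq_exp [IsLocalRing A] {f : X → A} {x : OpenPartialHomeomorph X ℂ} {ν : ℤ}
    {a : ℤ → A} (h : HasProductExpansion f x ν a) :
    IsUnit (a 0) ∧ (∃ N L : ℕ, (∀ j : ℕ, 0 < j → a (-(j : ℤ)) ^ L = 0) ∧
      ∀ j : ℕ, N < j → a (-(j : ℤ)) = 0) ∧
    ∃ K : ℝ, 0 < K ∧ ∀ z : ℂ, z ≠ 0 → ‖z‖ * K < 1 →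
      (Summable fun n : ℤ => (|(n : ℝ)| + 1) * (‖z‖ ^ n * ‖logCoeff a n‖)) ∧
      f (x.symm z) = z ^ ν • (a 0 * NormedSpace.exp (∑' n : ℤ, z ^ n • logCoeff a n)) := by
  have : CompleteSpace A := FiniteDimensional.complete ℂ A
  obtain ⟨ha0, hneg, N, hN, hev⟩ := h.exists_eq_mul
  obtain ⟨L, hL, hm⟩ := exists_maximalIdeal_pow_eq_bot A
  have hαL (j : ℕ) (hj : 0 < j) : a (-(j : ℤ)) ^ L = 0 := by
    simpa [hm] using Ideal.pow_mem_pow (hneg (-(j : ℤ)) (by omega)) L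
  have hαN (j : ℕ) (hj : N < j) : a (-(j : ℤ)) = 0 := hN _ (by omega)
  refine ⟨ha0, ⟨N, L, hαL, hαN⟩, ?_⟩
  rw [eventually_nhdsWithin_iff, Metric.eventually_nhds_iff_ball] at hev
  obtain ⟨ε, hε, hball⟩ := hev
  have hz₀ : ((ε / 2 : ℝ) : ℂ) ≠ 0 := by
    rw [Complex.ofReal_ne_zero]
    positivity
  -- Convergence at the single point `ε / 2` bounds the coefficients of the positive product.
  obtain ⟨w₀, hw₀, -⟩ := hball ((ε / 2 : ℝ) : ℂ) (by
    rw [mem_ball_zero_iff, Complex.norm_real, Real.norm_of_nonneg (by positivity)]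
    linarith) hz₀
  obtain ⟨K, hK, hKd, hexp⟩ := exists_posProduct_eq_exp a hz₀ hw₀.summable
  -- The condition `‖z‖ * max K ε⁻¹ < 1` puts `z` both in the disc of convergence of the logarithm
  -- and in the ball where the factorization of `f` holds.
  refine ⟨max K ε⁻¹, by positivity, fun z hz hzK => ?_⟩
  have hz1 : ‖z‖ * K < 1 :=
    (mul_le_mul_of_nonneg_left (le_max_left _ _) (norm_nonneg z)).trans_lt hzK
  have hz2 : ‖z‖ < ε := by
    have := (mul_le_mul_of_nonneg_left (le_max_right K ε⁻¹) (norm_nonneg z)).trans_lt hzK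
    rwa [← div_eq_mul_inv, div_lt_one hε] at this
  obtain ⟨w, hw, hfw⟩ := hball z (by simpa using hz2) hz
  set M := N * L
  have hzero (n : ℕ) (hn : n ∉ Finset.range M) : logCoeff a (-((n : ℤ) + 1)) = 0 := by
    rw [Finset.mem_range] at hn
    have := logCoeff_neg_natCast a (n + 1)
    push_cast at this
    rw [this, dlogCoeff_eq_zero hαL hαN (by omega), smul_zero, neg_zero]
  have hcK (n : ℕ) : ‖logCoeff a n‖ ≤ 1 * K ^ n := by
    rw [logCoeff_natCast, norm_smul, norm_inv, Complex.norm_natCast, norm_neg]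
    exact mul_le_mul (Nat.cast_inv_le_one n) (hKd n) (norm_nonneg _) zero_le_one
  constructor
  · refine Summable.of_nat_of_neg_add_one ?_ ?_
    · have h1 := (summable_pow_mul_geometric_of_norm_lt_one 1
        (by rwa [Real.norm_of_nonneg (by positivity)] : ‖‖z‖ * K‖ < 1)).add
          (summable_geometric_of_lt_one (by positivity) hz1)
      refine h1.of_nonneg_of_le (fun n => by positivity) fun n => ?_
      rw [pow_one, ← add_one_mul, mul_pow, zpow_natCast]
      push_cast
      rw [Nat.abs_cast]
      gcongr
      simpa using hcK n
    · refine summable_of_ne_finset_zero (s := Finset.range M) fun n hn => ?_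
      rw [hzero n hn, norm_zero, mul_zero, mul_zero]
  · have h1 : HasSum (fun n : ℕ => z ^ (n : ℤ) • logCoeff a n)
        (∑' n : ℕ, z ^ n • ((n : ℂ)⁻¹ • -dlogCoeff (fun j => a j) n)) := by
      have h2' : Summable fun n : ℕ => z ^ n • logCoeff a n :=
        (summable_norm_pow_smul hcK (by linarith) hz1).of_norm
      have h2 := h2'.hasSum
      simp only [logCoeff_natCast, zpow_natCast] at h2 ⊢
      exact h2
    have h3 : HasSum (fun n : ℕ => z ^ (-((n : ℤ) + 1)) • logCoeff a (-((n : ℤ) + 1)))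
        (-∑ m ∈ Finset.Icc 1 M,
          z⁻¹ ^ m • ((m : ℂ)⁻¹ • dlogCoeff (fun j => a (-(j : ℤ))) m)) := by
      rw [← sum_range_succ_eq_sum_Icc (fun m : ℕ =>
        z⁻¹ ^ m • ((m : ℂ)⁻¹ • dlogCoeff (fun j => a (-(j : ℤ))) m)), ← Finset.sum_neg_distrib]
      refine hasSum_of_hasSum_of_eq (F := fun n : ℕ => -(z⁻¹ ^ (n + 1) • (((n + 1 : ℕ) : ℂ)⁻¹ •
        dlogCoeff (fun j => a (-(j : ℤ))) (n + 1)))) (hasSum_sum_of_ne_finset_zero fun n hn => ?_)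
        fun n => ?_
      · have h5 := logCoeff_neg_natCast a (n + 1)
        rw [Nat.cast_add_one, hzero n hn] at h5
        rw [← smul_neg, ← h5, smul_zero]
      · have h5 := logCoeff_neg_natCast a (n + 1)
        rw [Nat.cast_add_one] at h5
        rw [h5, smul_neg, zpow_neg, inv_pow, ← Nat.cast_add_one, zpow_natCast]
    have h6 := HasSum.of_nat_of_neg_add_one (f := fun n : ℤ => z ^ n • logCoeff a n) h1 h3
    rw [h6.tsum_eq, exp_add', ← hexp z w hz1 hw,
      ← prod_one_sub_eq_exp hL hαL hαN le_rfl, hfw]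
    simp only [zpow_neg, zpow_natCast, inv_pow, smul_mul_assoc]
    ring_nf

/-- `dlog` along a small circle. -/
theorem dlogAlong_circle {f : X → A} {x : OpenPartialHomeomorph X ℂ} {ν : ℤ} {a : ℤ → A} {r : ℝ}
    (hr : 0 < r) (ha0 : IsUnit (a 0))
    (hs : Summable fun n : ℤ => (|(n : ℝ)| + 1) * (r ^ n * ‖logCoeff a n‖))
    (hf : ∀ t, f (x.symm (circlePath r t)) = circlePath r t ^ ν •
      (a 0 * NormedSpace.exp (∑' n : ℤ, circlePath r t ^ n • logCoeff a n))) (t : ℝ) :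
    dlogAlong f (fun t => x.symm (circlePath r t)) t = circleDlog r ν (logCoeff a) t := by
  have : CompleteSpace A := FiniteDimensional.complete ℂ A
  have h1 := (hasDerivAt_circlePath_zpow hr ν t).smul
    ((hasDerivAt_exp (hasDerivAt_fourierSum hr hs t)).const_mul (a 0))
  have h2 : HasDerivAt (fun t => f (x.symm (circlePath r t)))
      (f (x.symm (circlePath r t)) * circleDlog r ν (logCoeff a) t) t := by
    simp_rw [hf]
    refine h1.congr_deriv ?_
    change _ • (a 0 * (NormedSpace.exp (fourierSum r (logCoeff a) t) * _)) +
      _ • (a 0 * NormedSpace.exp (fourierSum r (logCoeff a) t)) =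
      (_ • (a 0 * NormedSpace.exp (fourierSum r (logCoeff a) t))) * _
    rw [circleDlog]
    simp only [Algebra.smul_def, map_mul]
    ring
  have h3 : IsUnit (f (x.symm (circlePath r t))) := by
    rw [hf, Algebra.smul_def]
    exact ((zpow_ne_zero ν (circlePath_ne_zero hr t)).isUnit.map _).mul
      (ha0.mul (.of_mul_eq_one _ (exp_mul_exp_neg _)))
  rw [dlogAlong, derivA_eq h2, mul_right_comm, Ring.mul_inverse_cancel _ h3, one_mul]

/-- In each term one of the two factors belongs to negative powers, so only `|n| ≤ M` contributes.
Positive and negative `n` give the two sums, with opposite signs. -/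
theorem tsum_logCoeff_mul_logCoeff {A : Type*} [NormedCommRing A] [NormedAlgebra ℂ A]
    {a b : ℤ → A} {M : ℕ}
    (ha : ∀ m, M < m → dlogCoeff (fun j => a (-(j : ℤ))) m = 0)
    (hb : ∀ m, M < m → dlogCoeff (fun j => b (-(j : ℤ))) m = 0) :
    ∑' n : ℤ, (-n : ℂ) • (logCoeff a n * logCoeff b (-n))
      = -∑ n ∈ Finset.Icc 1 M, (n : ℂ)⁻¹ •
          (dlogCoeff (fun j => a j) n * dlogCoeff (fun j => b (-(j : ℤ))) n)
        + ∑ n ∈ Finset.Icc 1 M, (n : ℂ)⁻¹ •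
          (dlogCoeff (fun j => b j) n * dlogCoeff (fun j => a (-(j : ℤ))) n) := by
  have hc (n : ℕ) : (n : ℂ) * (n : ℂ)⁻¹ * (n : ℂ)⁻¹ = (n : ℂ)⁻¹ := by
    rcases Nat.eq_zero_or_pos n with rfl | h
    · simp
    · have : (n : ℂ) ≠ 0 := by exact_mod_cast h.ne'
      field_simp
  let P : ℕ → A := fun n => -((n : ℂ)⁻¹ •
    (dlogCoeff (fun j => a j) n * dlogCoeff (fun j => b (-(j : ℤ))) n))
  let Q : ℕ → A := fun n => (n : ℂ)⁻¹ •
    (dlogCoeff (fun j => b j) n * dlogCoeff (fun j => a (-(j : ℤ))) n)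
  have h1 (n : ℕ) : (-((n : ℤ) : ℂ)) • (logCoeff a (n : ℤ) * logCoeff b (-(n : ℤ))) = P n := by
    simp only [P]
    have e3 := congrArg (algebraMap ℂ A) (hc n)
    rw [logCoeff_natCast, logCoeff_neg_natCast]
    simp only [Algebra.smul_def, map_mul, map_neg, Int.cast_natCast] at e3 ⊢
    linear_combination
      -(dlogCoeff (fun j => a j) n * dlogCoeff (fun j => b (-(j : ℤ))) n) * e3
  have h2 (n : ℕ) : (-((-((n : ℤ) + 1) : ℤ) : ℂ)) •
      (logCoeff a (-((n : ℤ) + 1)) * logCoeff b (-(-((n : ℤ) + 1)))) = Q (n + 1) := by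
    have e1 := logCoeff_neg_natCast a (n + 1)
    have e2 := logCoeff_natCast b (n + 1)
    have e3 := hc (n + 1)
    simp only [Q]
    rw [← e3]
    push_cast at e1 e2 ⊢
    rw [neg_neg, neg_neg, e1, e2]
    simp only [Algebra.smul_def, map_mul]
    ring_nf
  have hP0 : P 0 = 0 := by simp [P]
  have hP (n : ℕ) (hn : n ∉ Finset.range (M + 1)) : P n = 0 := by
    rw [Finset.mem_range] at hn
    simp only [P]
    rw [hb n (by omega), mul_zero, smul_zero, neg_zero]
  have hQ (n : ℕ) (hn : n ∉ Finset.range M) : Q (n + 1) = 0 := by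
    rw [Finset.mem_range] at hn
    simp only [Q]
    rw [ha (n + 1) (by omega), mul_zero, smul_zero]
  have h3 := HasSum.of_nat_of_neg_add_one
    (f := fun n : ℤ => (-n : ℂ) • (logCoeff a n * logCoeff b (-n)))
    (hasSum_of_hasSum_of_eq (hasSum_sum_of_ne_finset_zero hP) h1)
    (hasSum_of_hasSum_of_eq (hasSum_sum_of_ne_finset_zero hQ) h2)
  rw [h3.tsum_eq, Finset.sum_range_succ', hP0, add_zero, sum_range_succ_eq_sum_Icc,
    sum_range_succ_eq_sum_Icc, Finset.sum_neg_distrib]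

/-- The formula for a small circle. -/
theorem exp_iteratedIntegral_circleDlog {ν μ : ℤ} {a b : ℤ → A} {r : ℝ} (hr : 0 < r)
    (ha0 : IsUnit (a 0)) (hb0 : IsUnit (b 0))
    (ha : ∃ N L : ℕ, (∀ j : ℕ, 0 < j → a (-(j : ℤ)) ^ L = 0) ∧
      ∀ j : ℕ, N < j → a (-(j : ℤ)) = 0)
    (hb : ∃ N L : ℕ, (∀ j : ℕ, 0 < j → b (-(j : ℤ)) ^ L = 0) ∧
      ∀ j : ℕ, N < j → b (-(j : ℤ)) = 0)
    (hsa : Summable fun n : ℤ => (|(n : ℝ)| + 1) * (r ^ n * ‖logCoeff a n‖))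
    (hsb : Summable fun n : ℤ => (|(n : ℝ)| + 1) * (r ^ n * ‖logCoeff b n‖)) {u v : Aˣ}
    (hu : (u : A) = (r : ℂ) ^ ν • (a 0 * NormedSpace.exp (fourierSum r (logCoeff a) 0)))
    (hv : (v : A) = (r : ℂ) ^ μ • (b 0 * NormedSpace.exp (fourierSum r (logCoeff b) 0))) :
    NormedSpace.exp ((1 / (2 * (Real.pi : ℂ) * Complex.I)) •
        iteratedIntegral (circleDlog r ν (logCoeff a)) (circleDlog r μ (logCoeff b)))
      = ((v ^ ν * (u ^ μ)⁻¹ : Aˣ) : A) * ccSymbol ν a μ b := by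
  have : CompleteSpace A := FiniteDimensional.complete ℂ A
  obtain ⟨Na, La, haL, haN⟩ := ha
  obtain ⟨Nb, Lb, hbL, hbN⟩ := hb
  set M := max (Na * La) (Nb * Lb)
  rw [iteratedIntegral_circleDlog hr ν μ hsa hsb (logCoeff_zero a) (logCoeff_zero b),
    tsum_logCoeff_mul_logCoeff
      (fun m hm => dlogCoeff_eq_zero haL haN ((le_max_left _ _).trans_lt hm))
      (fun m hm => dlogCoeff_eq_zero hbL hbN ((le_max_right _ _).trans_lt hm))]
  have hD1 := exp_neg_sum_dlogCoeff_mul (α := fun j => a j) hbL hbN (le_max_right _ _ : _ ≤ M)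
  have hD2 := exp_neg_sum_dlogCoeff_mul (α := fun j => b j) haL haN (le_max_left _ _ : _ ≤ M)
  rw [doubleProduct_swap] at hD2
  set s1 := ∑ n ∈ Finset.Icc 1 M, (n : ℂ)⁻¹ •
    (dlogCoeff (fun j => a j) n * dlogCoeff (fun j => b (-(j : ℤ))) n)
  set s2 := ∑ n ∈ Finset.Icc 1 M, (n : ℂ)⁻¹ •
    (dlogCoeff (fun j => b j) n * dlogCoeff (fun j => a (-(j : ℤ))) n)
  set p := fourierSum r (logCoeff a) 0
  set q := fourierSum r (logCoeff b) 0
  let E : A → Aˣ := fun y => ⟨NormedSpace.exp y, NormedSpace.exp (-y), exp_mul_exp_neg y, by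
    rw [mul_comm, exp_mul_exp_neg]⟩
  -- The radius as a unit of `A`: it enters `v ^ ν * (u ^ μ)⁻¹` with exponent `μ ν - ν μ = 0`.
  let ρ : Aˣ := Units.map (algebraMap ℂ A).toMonoidHom
    (Units.mk0 (r : ℂ) (Complex.ofReal_ne_zero.2 hr.ne'))
  obtain ⟨α, hα⟩ := ha0
  obtain ⟨β, hβ⟩ := hb0
  have hρ (n : ℤ) : ((ρ ^ n : Aˣ) : A) = algebraMap ℂ A ((r : ℂ) ^ n) := by
    rw [← map_zpow, Units.coe_map, Units.val_zpow_eq_zpow_val]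
    rfl
  have hu' : u = ρ ^ ν * (α * E p) := by
    ext
    rw [hu, Units.val_mul, hρ, Algebra.smul_def, ← hα]
    rfl
  have hv' : v = ρ ^ μ * (β * E q) := by
    ext
    rw [hv, Units.val_mul, hρ, Algebra.smul_def, ← hβ]
    rfl
  -- The sign of the symbol: `exp (πi)` raised to the power `ν μ`.
  have e1 : NormedSpace.exp ((Real.pi * Complex.I * (ν * μ) : ℂ) • (1 : A))
      = (((-1) ^ (ν * μ) : Aˣ) : A) := by
    rw [← exp_intCast_mul (ν * μ) (algebraMap ℂ A (Real.pi * Complex.I)) (-1)]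
    · congr 1
      rw [Algebra.smul_def, mul_one, mul_comm (Real.pi * Complex.I : ℂ), map_mul]
      simp
    · rw [exp_algebraMap, Complex.exp_pi_mul_I]
      simp
  have hint (n : ℤ) (y : A) : NormedSpace.exp ((n : ℂ) • y) = ((E y ^ n : Aˣ) : A) := by
    rw [← exp_intCast_mul n y (E y) rfl, Algebra.smul_def, map_intCast]
  have hD1' : doubleProduct (fun j : ℕ+ => a (j : ℤ)) (fun k : ℕ+ => b (-(k : ℤ))) = (E (-s1) : A) :=
    hD1.symm
  have hD2' : doubleProduct (fun j : ℕ+ => a (-(j : ℤ))) (fun k : ℕ+ => b (k : ℤ)) = (E (-s2) : A) :=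
    hD2.symm
  have hE2 : E (-s2) = (E s2)⁻¹ := by
    ext
    rfl
  rw [sub_eq_add_neg, ← neg_smul, exp_add', exp_add', exp_add', exp_add', e1, hint, ← Int.cast_neg,
    hint, ccSymbol, hD1', hD2', ← hα, ← hβ, unitZPow_coe, unitZPow_coe,
    ← Units.val_mul (β ^ ν), Ring.inverse_unit, show (-1 : A) = ((-1 : Aˣ) : A) by simp, unitZPow_coe]
  change ((((-1) ^ (ν * μ) : Aˣ) : A) * ((E q ^ ν : Aˣ) : A) * ((E p ^ (-μ) : Aˣ) : A)) *
    ((E (-s1) : A) * (E s2 : A)) = _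
  simp only [← Units.val_mul]
  congr 1
  rw [hu', hv', hE2]
  -- Additive notation turns an identity between integer powers in the abelian group of units into
  -- linear algebra over `ℤ`.
  apply Additive.ofMul.injective
  simp only [ofMul_mul, ofMul_inv, ofMul_zpow]
  module

end ContouCarrere

end LocalSymbol

/-! ### Piecewise smooth paths and integrability -/

section PiecewisePaths

namespace ContouCarrere

variable {X : Type*} [TopologicalSpace X] [ChartedSpace ℂ X]

/-- The path `γ` is continuously differentiable on `s`, in the preferred coordinates of `X`. -/
def IsChartC1On (γ : ℝ → X) (s : Set ℝ) : Prop :=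
  ContinuousOn γ s ∧
    ∀ t ∈ s, ContDiffWithinAt ℝ 1 (fun t' => chartAt ℂ (γ t) (γ t')) s t

/-- The path `γ` is continuously differentiable on each interval of a partition of `[0, 1]`. -/
def IsPiecewiseChartC1 (γ : ℝ → X) : Prop :=
  ∃ (n : ℕ) (a : ℕ → ℝ), a 0 = 0 ∧ a n = 1 ∧
    ∀ k < n, a k ≤ a (k + 1) ∧ IsChartC1On γ (Icc (a k) (a (k + 1)))

theorem IsPiecewiseC1.isPiecewiseChartC1 {P Q : X} {γ : Path P Q} (h : IsPiecewiseC1 γ) :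
    IsPiecewiseChartC1 γ.extend := by
  obtain ⟨n, t, ht, h0, h1, hC⟩ := h
  refine ⟨n, fun k => t (Fin.ofNat (n + 1) k), ?_, ?_, fun k hk => ?_⟩
  · simpa using h0
  · have e : Fin.ofNat (n + 1) n = Fin.last n := Fin.ext (Nat.mod_eq_of_lt n.lt_succ_self)
    simp only [e, h1]
  · have e1 : Fin.ofNat (n + 1) k = (⟨k, hk⟩ : Fin n).castSucc := by
      ext
      simp; omega
    have e2 : Fin.ofNat (n + 1) (k + 1) = (⟨k, hk⟩ : Fin n).succ := by
      ext
      simp; omega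
    simp only [e1, e2]
    refine ⟨ht (Fin.castSucc_lt_succ).le, (hC ⟨k, hk⟩).continuousOn, fun u hu => ?_⟩
    have h2 := (contMDiffWithinAt_iff.1 (hC ⟨k, hk⟩ u hu)).2
    simpa [Function.comp_def, chartAt_self_eq] using h2

theorem IsPiecewiseChartC1.isAlmostDifferentiable {γ : ℝ → X} (h : IsPiecewiseChartC1 γ) :
    IsAlmostDifferentiable γ := by
  obtain ⟨n, a, h0, h1, hC⟩ := h
  refine ⟨range a, countable_range a, fun t ht => ?_⟩
  -- The least `k` with `t < a k` locates `t` strictly between two consecutive breakpoints.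
  have hex : ∃ k, k ≤ n ∧ t < a k := ⟨n, le_rfl, h1 ▸ ht.1.2⟩
  obtain ⟨hk, htk⟩ := Nat.find_spec hex
  have hmin := fun m => Nat.find_min hex (m := m)
  rcases h' : Nat.find hex with _ | k
  · rw [h', h0] at htk
    exact absurd htk (not_lt.2 ht.1.1.le)
  · rw [h'] at hk htk hmin
    have h2 : a k < t := by
      refine lt_of_le_of_ne (not_lt.1 fun h3 => hmin k k.lt_succ_self ⟨by omega, h3⟩) fun h3 => ?_
      exact ht.2 ⟨k, h3⟩
    exact (((hC k hk).2.2 t ⟨h2.le, htk.le⟩).contDiffAt (Icc_mem_nhds h2 htk)).differentiableAt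
      (by simp)

variable {A : Type*} [NormedCommRing A] [NormedAlgebra ℂ A] [Module.Finite ℂ A]
  [IsManifold 𝓘(ℂ) ω X]

theorem analyticAt_comp_chartAt_symm {f : X → A} {p : X} (hf : ∀ᶠ x in 𝓝 p, ChartDiff f x) :
    AnalyticAt ℂ (fun z => f ((chartAt ℂ p).symm z)) (chartAt ℂ p p) := by
  have : CompleteSpace A := FiniteDimensional.complete ℂ A
  rw [Complex.analyticAt_iff_eventually_differentiableAt]
  filter_upwards [eventually_chartAt_symm hf,
    (chartAt ℂ p).open_target.mem_nhds (mem_chart_target ℂ p)] with z h1 h2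
  have h3 := h1.hasChartDeriv.hasDerivAt_symm (IsManifold.chart_mem_maximalAtlas p)
    ((chartAt ℂ p).map_target h2)
  rw [(chartAt ℂ p).right_inv h2] at h3
  exact h3.differentiableAt

theorem IsChartC1On.contDiffOn_comp {γ : ℝ → X} {s : Set ℝ} (h : IsChartC1On γ s) {f : X → A}
    (hf : ∀ t ∈ s, ∀ᶠ x in 𝓝 (γ t), ChartDiff f x) : ContDiffOn ℝ 1 (fun t => f (γ t)) s := by
  have : CompleteSpace A := FiniteDimensional.complete ℂ A
  intro t ht
  have h1 : ContDiffAt ℝ 1 (fun z => f ((chartAt ℂ (γ t)).symm z)) (chartAt ℂ (γ t) (γ t)) :=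
    ((analyticAt_comp_chartAt_symm (hf t ht)).contDiffAt (n := 1)).restrict_scalars ℝ
  refine (h1.comp_contDiffWithinAt t (h.2 t ht)).congr_of_eventuallyEq ?_ ?_
  · filter_upwards [(h.1 t ht).eventually
      ((chartAt ℂ (γ t)).open_source.mem_nhds (mem_chart_source ℂ _))] with t' ht'
    simp [(chartAt ℂ (γ t)).left_inv ht']
  · simp [(chartAt ℂ (γ t)).left_inv (mem_chart_source ℂ _)]

/-- `dlogAlong` uses the two-sided derivative, which may be wrong at the ends; on the open interval
it agrees with the one-sided version, which is continuous up to the ends. -/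
theorem IsChartC1On.intervalIntegrable_dlogAlong {γ : ℝ → X} {c d : ℝ} (hcd : c ≤ d)
    (h : IsChartC1On γ (Icc c d)) {f : X → A}
    (hf : ∀ t ∈ Icc c d, ∀ᶠ x in 𝓝 (γ t), ChartDiff f x ∧ IsUnit (f x)) :
    IntervalIntegrable (dlogAlong f γ) MeasureTheory.volume c d := by
  have : CompleteSpace A := FiniteDimensional.complete ℂ A
  rcases hcd.eq_or_lt with rfl | hlt
  · exact IntervalIntegrable.refl
  have h1 := h.contDiffOn_comp fun t ht => (hf t ht).mono fun x hx => hx.1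
  have h2 := h1.continuousOn_derivWithin (uniqueDiffOn_Icc hlt) le_rfl
  have h3 : ContinuousOn (fun t => Ring.inverse (f (γ t))) (Icc c d) := by
    intro t ht
    obtain ⟨u, hu⟩ := (hf t ht).self_of_nhds.2
    have h4 := NormedRing.inverse_continuousAt u
    rw [hu] at h4
    exact ContinuousAt.comp_continuousWithinAt (f := fun t => f (γ t)) h4 (h1.continuousOn t ht)
  have h5 : IntervalIntegrable (fun t => derivWithin (fun t => f (γ t)) (Icc c d) t *
      Ring.inverse (f (γ t))) MeasureTheory.volume c d :=
    (h2.mul h3).intervalIntegrable_of_Icc hcd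
  refine h5.congr_uIoo fun t ht => ?_
  rw [uIoo_of_le hcd] at ht
  have h6 := ((h1 t (Ioo_subset_Icc_self ht)).differentiableWithinAt (by simp)).hasDerivWithinAt
  simp only [dlogAlong]
  rw [derivA_eq (h6.hasDerivAt (Icc_mem_nhds ht.1 ht.2))]

theorem IsPiecewiseChartC1.intervalIntegrable_dlogAlong {γ : ℝ → X} (h : IsPiecewiseChartC1 γ)
    {f : X → A} (hf : ∀ t, ∀ᶠ x in 𝓝 (γ t), ChartDiff f x ∧ IsUnit (f x)) :
    IntervalIntegrable (dlogAlong f γ) MeasureTheory.volume 0 1 := by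
  obtain ⟨n, a, h0, h1, hC⟩ := h
  rw [← h0, ← h1]
  exact IntervalIntegrable.trans_iterate fun k hk =>
    (hC k hk).2.intervalIntegrable_dlogAlong (hC k hk).1 fun t _ => hf t

/-- A circle in a coordinate is continuously differentiable. -/
theorem isPiecewiseChartC1_circle {x : OpenPartialHomeomorph X ℂ}
    (hx : x ∈ IsManifold.maximalAtlas 𝓘(ℂ) ω X) {r : ℝ} (hr : 0 < r)
    (hr' : Metric.closedBall (0 : ℂ) r ⊆ x.target) {γ : ℝ → X}
    (hγ : ∀ t ∈ Icc (0 : ℝ) 1, γ t = x.symm (circlePath r t)) : IsPiecewiseChartC1 γ := by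
  have hmem (t : ℝ) : circlePath r t ∈ x.target :=
    hr' (by rw [mem_closedBall_zero_iff, norm_circlePath hr])
  refine ⟨1, Nat.cast, by simp, by simp, fun k hk => ?_⟩
  obtain rfl : k = 0 := by omega
  simp only [Nat.cast_zero, zero_add, Nat.cast_one]
  refine ⟨zero_le_one, ?_, fun t ht => ?_⟩
  · refine ContinuousOn.congr ?_ hγ
    exact x.continuousOn_symm.comp (continuous_circlePath r).continuousOn fun t _ => hmem t
  · have h1 : ContDiffAt ℂ ω (fun z => chartAt ℂ (γ t) (x.symm z)) (circlePath r t) := by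
      have h2 := contDiffAt_transition (p := γ t)
        (IsManifold.chart_mem_maximalAtlas (γ t)) hx (mem_chart_source ℂ _)
        (by rw [hγ t ht]; exact x.map_target (hmem t))
      rwa [hγ t ht, x.right_inv (hmem t), ← hγ t ht] at h2
    have h3 : ContDiff ℝ 1 (circlePath r) := by
      have := Complex.ofRealCLM.contDiff (n := 1)
      exact contDiff_const.mul ((contDiff_const.mul this).cexp)
    have h4 := ((h1.of_le (m := 1) le_top).restrict_scalars ℝ).comp t h3.contDiffAt
    refine h4.contDiffWithinAt.congr (fun t' ht' => ?_) ?_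
    · simp [hγ t' ht']
    · simp [hγ t ht]

end ContouCarrere

end PiecewisePaths

/-! ### Laurent and product expansions of meromorphic functions -/

section LaurentExpansions

namespace ContouCarrere

theorem eq_finBasis_sum {A : Type*} [CommRing A] [Algebra ℂ A] [Module.Finite ℂ A] (h : ℂ → A) :
    h = fun z => ∑ i, (Module.finBasis ℂ A).coord i (h z) • Module.finBasis ℂ A i := by
  funext z
  simp only [Module.Basis.coord_apply, (Module.finBasis ℂ A).sum_repr]

variable {A : Type*} [NormedCommRing A] [NormedAlgebra ℂ A] [Module.Finite ℂ A]

theorem analyticAt_of_forall_linearMap {h : ℂ → A} {z₀ : ℂ}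
    (hh : ∀ φ : A →ₗ[ℂ] ℂ, AnalyticAt ℂ (fun z => φ (h z)) z₀) : AnalyticAt ℂ h z₀ := by
  rw [eq_finBasis_sum h]
  exact Finset.analyticAt_fun_sum _ fun i _ => (hh _).smul analyticAt_const

theorem meromorphicAt_of_forall_linearMap {h : ℂ → A} {z₀ : ℂ}
    (hh : ∀ φ : A →ₗ[ℂ] ℂ, MeromorphicAt (fun z => φ (h z)) z₀) : MeromorphicAt h z₀ := by
  rw [eq_finBasis_sum h]
  exact MeromorphicAt.fun_sum fun i _ => (hh _).smul (MeromorphicAt.const _ _)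

variable {X : Type*} [TopologicalSpace X]

theorem exists_isLaurentExpansion {f : X → A} {x : OpenPartialHomeomorph X ℂ}
    (hf : MeromorphicAt (fun z => f (x.symm z)) 0) :
    ∃ F : LaurentSeries A, IsLaurentExpansion f x F := by
  obtain ⟨n, p, hp⟩ := hf
  rw [hasFPowerSeriesAt_iff] at hp
  refine ⟨HahnSeries.single (-(n : ℤ)) 1 *
    HahnSeries.ofPowerSeries ℤ A (PowerSeries.mk p.coeff), fun φ => ?_⟩
  filter_upwards [eventually_nhdsWithin_of_eventually_nhds hp, self_mem_nhdsWithin] with z h1 hz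
  have h2 : EvalsTo (HahnSeries.ofPowerSeries ℤ A (PowerSeries.mk p.coeff)) z
      (z ^ n • f (x.symm z)) := by
    unfold EvalsTo
    rw [← (Nat.cast_injective (R := ℤ)).hasSum_iff]
    · refine hasSum_of_hasSum_of_eq (by simpa using h1) fun k => ?_
      simp [coeff_ofPowerSeries]
    · intro k hk
      have : k < 0 := by
        by_contra h
        exact hk ⟨k.toNat, by simpa using h⟩
      rw [coeff_ofPowerSeries, if_pos this, smul_zero]
  have h3 := evalsMul_single hz (-(n : ℤ)) (1 : A) _ _ h2
  rw [smul_mul_smul_comm, one_mul, zpow_neg, zpow_natCast,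
    inv_mul_cancel₀ (pow_ne_zero n hz), one_smul] at h3
  have h4 := h3.mapL (φ.toContinuousLinearMap)
  refine hasSum_of_hasSum_of_eq h4 fun k => ?_
  simp [mul_comm]

/-- The order `ν` is the least index whose coefficient is a unit. One exists, since otherwise the
residue of `f` would vanish at points near the centre, where `f` is a unit. -/
theorem exists_hasProductExpansion [IsLocalRing A] {f : X → A} {x : OpenPartialHomeomorph X ℂ}
    (hf : MeromorphicAt (fun z => f (x.symm z)) 0)
    (hu : ∀ᶠ z in 𝓝[≠] (0 : ℂ), IsUnit (f (x.symm z))) :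
    ∃ ν a, HasProductExpansion f x ν a := by
  obtain ⟨F, hF⟩ := exists_isLaurentExpansion hf
  obtain ⟨z, hz, hz'⟩ := ((hF (residueMap A).toLinearMap).and hu).exists
  rw [isUnit_iff_residueMap_ne_zero] at hz'
  have hex : ∃ n : ℤ, IsUnit (F.coeff n) := by
    by_contra! h
    refine hz' (hz.unique (hasSum_of_hasSum_of_eq hasSum_zero fun n => ?_))
    have := h n
    rw [isUnit_iff_residueMap_ne_zero, not_not] at this
    simp [this]
  obtain ⟨ν, hν, hmin⟩ := Int.exists_least_of_bdd ⟨F.order, fun n hn =>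
    HahnSeries.order_le_of_coeff_ne_zero hn.ne_zero⟩ hex
  obtain ⟨L, hL, hm⟩ := exists_maximalIdeal_pow_eq_bot A
  obtain ⟨a, ha⟩ := exists_isProductExpansion hL hm F ν hν fun n hn => by
    rw [IsLocalRing.mem_maximalIdeal, mem_nonunits_iff]
    exact fun h => absurd (hmin n h) (not_le.2 hn)
  exact ⟨ν, a, F, hF, ha⟩

variable [ChartedSpace ℂ X] [IsManifold 𝓘(ℂ) ω X]

theorem eventually_chartDiff_of_notMem_zerosAndPoles {f : X → A} {p : X}
    (hp : p ∉ zerosAndPoles f) : ∀ᶠ x in 𝓝 p, ChartDiff f x ∧ IsUnit (f x) := by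
  have : CompleteSpace A := FiniteDimensional.complete ℂ A
  obtain ⟨h1, h2⟩ : HolomorphicNear f p ∧ IsUnit (f p) := by simpa [zerosAndPoles] using hp
  have h3 := analyticAt_of_forall_linearMap h1
  have h4 : ∀ᶠ x in 𝓝 p, ChartDiff f x := by
    apply eventually_of_chartAt_symm
    filter_upwards [h3.eventually_analyticAt,
      (chartAt ℂ p).open_target.mem_nhds (mem_chart_target ℂ p)] with z h5 h6
    refine (hasChartDeriv_of_hasDerivAt_symm (D := deriv (fun z => f ((chartAt ℂ p).symm z)) z)
      (IsManifold.chart_mem_maximalAtlas p) ((chartAt ℂ p).map_target h6) ?_).chartDiff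
    rw [(chartAt ℂ p).right_inv h6]
    exact h5.differentiableAt.hasDerivAt
  have h7 : ContinuousAt f p := h4.self_of_nhds.hasChartDeriv.continuousAt
  exact h4.and (h7.eventually (Units.isOpen.mem_nhds h2))

theorem IsMeromorphic.meromorphicAt_symm {f : X → A} (hf : IsMeromorphic f) {s : X}
    {x : OpenPartialHomeomorph X ℂ} (hx : IsUniformizer x s) :
    MeromorphicAt (fun z => f (x.symm z)) 0 := by
  obtain ⟨hx, hs, h0⟩ := hx
  have h1 := meromorphicAt_of_forall_linearMap (hf s).1
  have h2 := contDiffAt_transition (IsManifold.chart_mem_maximalAtlas s) hx (mem_chart_source ℂ s) hs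
  have hs' : x.symm 0 = s := by rw [← h0, x.left_inv hs]
  rw [h0] at h2
  have h3 : MeromorphicAt (fun z => f ((chartAt ℂ s).symm z)) (chartAt ℂ s (x.symm 0)) := by
    rwa [hs']
  refine (h3.comp_analyticAt (g := fun z => chartAt ℂ s (x.symm z)) h2.analyticAt).congr ?_
  have h4 : ContinuousAt x.symm 0 := x.continuousAt_symm (h0 ▸ x.map_source hs)
  refine eventually_nhdsWithin_of_eventually_nhds ?_
  filter_upwards [h4.eventually ((chartAt ℂ s).open_source.mem_nhds
    (by rw [hs']; exact mem_chart_source ℂ s))] with z hz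
  simp [(chartAt ℂ s).left_inv hz]

end ContouCarrere

end LaurentExpansions

/-! ### From the small circle to an arbitrary loop -/

section LoopFormula

namespace ContouCarrere

section Congruence

variable {A : Type*} [CommRing A] [Algebra ℂ A] [Module.Finite ℂ A]

theorem dlogAlong_congr {X : Type*} {f : X → A} {γ γ' : ℝ → X} {t : ℝ} (h : γ =ᶠ[𝓝 t] γ') :
    dlogAlong f γ t = dlogAlong f γ' t := by
  unfold dlogAlong derivA
  rw [h.self_of_nhds]
  congr 1
  refine Finset.sum_congr rfl fun i _ => ?_
  congr 1
  exact EventuallyEq.deriv_eq (h.mono fun u hu => by simp only [hu])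

theorem integralA_congr {u v : ℝ → A} {c d : ℝ} (hcd : c ≤ d) (h : EqOn u v (Ioo c d)) :
    integralA u c d = integralA v c d := by
  unfold integralA
  refine Finset.sum_congr rfl fun i _ => ?_
  congr 1
  exact intervalIntegral.integral_congr_uIoo fun t ht => by
    rw [uIoo_of_le hcd] at ht
    simp only [h ht]

/-- Only the open interval is required: `rowPath` is constant beyond `[0, 1]`, so at the endpoints
its derivative need not be that of the circle. -/
theorem iteratedIntegral_congr {u u' v v' : ℝ → A} (hu : EqOn u u' (Ioo 0 1))
    (hv : EqOn v v' (Ioo 0 1)) : iteratedIntegral u v = iteratedIntegral u' v' := by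
  unfold iteratedIntegral
  refine integralA_congr zero_le_one fun t ht => ?_
  rw [hv ht, integralA_congr ht.1.le fun t' ht' => hu ⟨ht'.1, ht'.2.trans ht.2⟩]

end Congruence

/-- The homotopy between the circles of radius `r` and `r'` in the coordinate `x`. -/
noncomputable def circleHomotopy {X : Type*} [TopologicalSpace X] (x : OpenPartialHomeomorph X ℂ)
    (r r' : ℝ) (p : I × I) : X :=
  x.symm (circlePath ((1 - (p.1 : ℝ)) * r + p.1 * r') p.2)

section CircleHomotopy

variable {X : Type*} [TopologicalSpace X] {x : OpenPartialHomeomorph X ℂ} {r r' : ℝ}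

theorem circleHomotopy_radius_pos (hr : 0 < r) (hr' : 0 < r') (u : I) :
    0 < (1 - (u : ℝ)) * r + u * r' := by
  rcases u.2.1.eq_or_lt with h | h
  · rw [← h]
    simpa using hr
  · have := u.2.2
    have h1 : 0 ≤ (1 - (u : ℝ)) * r := mul_nonneg (by linarith) hr.le
    have h2 : 0 < (u : ℝ) * r' := mul_pos h hr'
    linarith

theorem circleHomotopy_mem (hr' : 0 < r') (hrr' : r' ≤ r) (p : I × I) :
    circlePath ((1 - (p.1 : ℝ)) * r + p.1 * r') p.2 ∈ Metric.closedBall (0 : ℂ) r ∧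
      circlePath ((1 - (p.1 : ℝ)) * r + p.1 * r') p.2 ≠ 0 := by
  have h := circleHomotopy_radius_pos (hr'.trans_le hrr') hr' p.1
  refine ⟨?_, circlePath_ne_zero h _⟩
  rw [mem_closedBall_zero_iff, norm_circlePath h]
  nlinarith [p.1.2.1]

theorem continuous_circleHomotopy (hr' : 0 < r') (hrr' : r' ≤ r)
    (hx : Metric.closedBall (0 : ℂ) r ⊆ x.target) : Continuous (circleHomotopy x r r') := by
  refine x.continuousOn_symm.comp_continuous ?_ fun p => hx (circleHomotopy_mem hr' hrr' p).1
  unfold circlePath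
  fun_prop

end CircleHomotopy

variable {A : Type*} [NormedCommRing A] [NormedAlgebra ℂ A] [Module.Finite ℂ A]

/-- After division by `2πi` the correction exponentiates to `exp Λg ^ ν * exp Λf ^ (-μ)`, which is
the ratio of the prefactors at the two base points. -/
theorem exp_iteratedIntegral_of_eq_add {ν μ : ℤ} {u v U V : Aˣ} {Λf Λg S S' c : A}
    (hu : (u : A) = U * NormedSpace.exp Λf) (hv : (v : A) = V * NormedSpace.exp Λg)
    (hS : S' = S + (2 * Real.pi * Complex.I * ν : ℂ) • Λg - (2 * Real.pi * Complex.I * μ : ℂ) • Λf)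
    (h : NormedSpace.exp ((1 / (2 * (Real.pi : ℂ) * Complex.I)) • S')
      = ((v ^ ν * (u ^ μ)⁻¹ : Aˣ) : A) * c) :
    NormedSpace.exp ((1 / (2 * (Real.pi : ℂ) * Complex.I)) • S)
      = ((V ^ ν * (U ^ μ)⁻¹ : Aˣ) : A) * c := by
  have : CompleteSpace A := FiniteDimensional.complete ℂ A
  let E : A → Aˣ := fun y => ⟨NormedSpace.exp y, NormedSpace.exp (-y), exp_mul_exp_neg y, by
    rw [mul_comm, exp_mul_exp_neg]⟩
  have hu' : u = U * E Λf := Units.ext hu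
  have hv' : v = V * E Λg := Units.ext hv
  have h2 : (2 * (Real.pi : ℂ) * Complex.I) ≠ 0 := Complex.two_pi_I_ne_zero
  have h1 : (1 / (2 * (Real.pi : ℂ) * Complex.I)) • S
      = (1 / (2 * (Real.pi : ℂ) * Complex.I)) • S' + (((-ν : ℤ) : A) * Λg + (μ : A) * Λf) := by
    rw [hS, smul_sub, smul_add, smul_smul, smul_smul, ← mul_assoc _ _ (ν : ℂ),
      ← mul_assoc _ _ (μ : ℂ), one_div_mul_cancel h2, one_mul, one_mul]
    simp only [Algebra.smul_def, map_intCast, Int.cast_neg]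
    ring
  rw [h1, exp_add', exp_add', h, exp_intCast_mul _ Λg (E Λg) rfl, exp_intCast_mul _ Λf (E Λf) rfl,
    mul_right_comm, ← Units.val_mul, ← Units.val_mul]
  congr 2
  rw [hu', hv']
  apply Additive.ofMul.injective
  simp only [ofMul_mul, ofMul_inv, ofMul_zpow]
  module

variable {X : Type*} [TopologicalSpace X] [ChartedSpace ℂ X] [IsManifold 𝓘(ℂ) ω X]

/-- The formula for a loop that is freely homotopic to a small circle. -/
theorem exp_iteratedIntegral_loop [IsLocalRing A] {f g : X → A} {x : OpenPartialHomeomorph X ℂ}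
    (hx : x ∈ IsManifold.maximalAtlas 𝓘(ℂ) ω X) {P : X} {γ : Path P P} (hγ : IsPiecewiseC1 γ)
    (hγs : GoesOnceAround x (zerosAndPoles f ∪ zerosAndPoles g) γ) {ν μ : ℤ} {a b : ℤ → A}
    (hfa : HasProductExpansion f x ν a) (hgb : HasProductExpansion g x μ b) :
    NormedSpace.exp ((1 / (2 * (Real.pi : ℂ) * Complex.I)) •
        iteratedIntegral (dlogAlong f γ.extend) (dlogAlong g γ.extend))
      = unitZPow (g P) ν * Ring.inverse (unitZPow (f P) μ) * ccSymbol ν a μ b := by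
  have : CompleteSpace A := FiniteDimensional.complete ℂ A
  obtain ⟨r, hr, hball, hD, H, hH0, hH1, hloop, hHD⟩ := hγs
  obtain ⟨ha0, ha, Ka, hKa, hexpa⟩ := hfa.exists_eq_exp
  obtain ⟨hb0, hb, Kb, hKb, hexpb⟩ := hgb.exists_eq_exp
  have hregf {p : X} (hp : p ∉ zerosAndPoles f ∪ zerosAndPoles g) :
      ∀ᶠ x in 𝓝 p, ChartDiff f x ∧ IsUnit (f x) :=
    eventually_chartDiff_of_notMem_zerosAndPoles fun h => hp (.inl h)
  have hregg {p : X} (hp : p ∉ zerosAndPoles f ∪ zerosAndPoles g) :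
      ∀ᶠ x in 𝓝 p, ChartDiff g x ∧ IsUnit (g x) :=
    eventually_chartDiff_of_notMem_zerosAndPoles fun h => hp (.inr h)
  -- The circle given by the hypothesis may lie outside the region where the logarithms converge, so
  -- it is shrunk. The summand `1` makes `r' * Ka` and `r' * Kb` strictly less than `1`.
  set r' : ℝ := min r (Ka + Kb + 1)⁻¹
  have hr' : 0 < r' := by positivity
  have hr1 : r' * (Ka + Kb + 1) ≤ 1 := by
    rw [← le_div_iff₀ (by positivity), one_div]
    exact min_le_right _ _
  have hra : r' * Ka < 1 := by nlinarith
  have hrb : r' * Kb < 1 := by nlinarith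
  have hrr' : r' ≤ r := min_le_left _ _
  set H' := circleHomotopy x r r'
  have hH'c : Continuous H' := continuous_circleHomotopy hr' hrr' hball
  have hH'D (p : I × I) : H' p ∉ zerosAndPoles f ∪ zerosAndPoles g :=
    hD _ (circleHomotopy_mem hr' hrr' p).1 (circleHomotopy_mem hr' hrr' p).2
  have e0 : rowPath H 0 = γ.extend := funext fun t => hH0 _
  have e1 : rowPath H 1 = rowPath H' 0 := funext fun t => by
    simp only [rowPath, hH1, H', circleHomotopy, circlePath]
    simp
  have e2 (t : ℝ) (ht : t ∈ Icc (0 : ℝ) 1) : rowPath H' 0 t = x.symm (circlePath r t) := by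
    simp [rowPath, H', circleHomotopy, projIcc_of_mem zero_le_one ht]
  have e3 (t : ℝ) (ht : t ∈ Icc (0 : ℝ) 1) : rowPath H' 1 t = x.symm (circlePath r' t) := by
    simp [rowPath, H', circleHomotopy, projIcc_of_mem zero_le_one ht]
  have p0 : IsPiecewiseChartC1 (rowPath H 0) := e0 ▸ hγ.isPiecewiseChartC1
  have p1 : IsPiecewiseChartC1 (rowPath H' 0) := isPiecewiseChartC1_circle hx hr hball e2
  have p2 : IsPiecewiseChartC1 (rowPath H' 1) := isPiecewiseChartC1_circle hx hr'
    ((Metric.closedBall_subset_closedBall hrr').trans hball) e3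
  have hHD' (p : I × I) : H p ∉ zerosAndPoles f ∪ zerosAndPoles g := hHD p.1 p.2
  have hloop' (u : I) : H' (u, 0) = H' (u, 1) := by
    simp [H', circleHomotopy, circlePath_zero, circlePath_one]
  obtain ⟨Λf, Λg, hf1, hg1, hpf1, hpg1, hi1⟩ := exists_iteratedIntegral_eq_of_homotopy
    (H := H) (f := f) (g := g) H.continuous hloop (fun p => hregf (hHD' p))
    (fun p => hregg (hHD' p))
    p0.isAlmostDifferentiable (e1 ▸ p1.isAlmostDifferentiable)
    (p0.intervalIntegrable_dlogAlong fun t => hregf (hHD' _))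
    (e1 ▸ p1.intervalIntegrable_dlogAlong fun t => hregf (hH'D _))
    (p0.intervalIntegrable_dlogAlong fun t => hregg (hHD' _))
    (e1 ▸ p1.intervalIntegrable_dlogAlong fun t => hregg (hH'D _))
  -- A second application, to the shrinking of the circle; the changes of base values and of
  -- iterated integrals are then composed.
  obtain ⟨Λf', Λg', hf2, hg2, hpf2, hpg2, hi2⟩ := exists_iteratedIntegral_eq_of_homotopy
    (H := H') (f := f) (g := g) hH'c hloop' (fun p => hregf (hH'D p)) (fun p => hregg (hH'D p))
    p1.isAlmostDifferentiable p2.isAlmostDifferentiable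
    (p1.intervalIntegrable_dlogAlong fun t => hregf (hH'D _))
    (p2.intervalIntegrable_dlogAlong fun t => hregf (hH'D _))
    (p1.intervalIntegrable_dlogAlong fun t => hregg (hH'D _))
    (p2.intervalIntegrable_dlogAlong fun t => hregg (hH'D _))
  rw [e1] at hpf1 hpg1 hi1
  have hn (t : ℝ) : ‖circlePath r' t‖ = r' := norm_circlePath hr' t
  have hsa := (hexpa (circlePath r' 0) (circlePath_ne_zero hr' 0) (by rwa [hn])).1
  have hsb := (hexpb (circlePath r' 0) (circlePath_ne_zero hr' 0) (by rwa [hn])).1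
  rw [hn] at hsa hsb
  have hfa' (t : ℝ) := (hexpa (circlePath r' t) (circlePath_ne_zero hr' t) (by rwa [hn])).2
  have hgb' (t : ℝ) := (hexpb (circlePath r' t) (circlePath_ne_zero hr' t) (by rwa [hn])).2
  have e4 (t : ℝ) (ht : t ∈ Ioo (0 : ℝ) 1) :
      rowPath H' 1 =ᶠ[𝓝 t] fun t => x.symm (circlePath r' t) := by
    filter_upwards [Icc_mem_nhds ht.1 ht.2] with t' ht' using e3 t' ht'
  have d1 : EqOn (dlogAlong f (rowPath H' 1)) (circleDlog r' ν (logCoeff a)) (Ioo 0 1) :=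
    fun t ht => (dlogAlong_congr (e4 t ht)).trans (dlogAlong_circle hr' ha0 hsa hfa' t)
  have d2 : EqOn (dlogAlong g (rowPath H' 1)) (circleDlog r' μ (logCoeff b)) (Ioo 0 1) :=
    fun t ht => (dlogAlong_congr (e4 t ht)).trans (dlogAlong_circle hr' hb0 hsb hgb' t)
  have i1 : ∫ t in (0 : ℝ)..1, dlogAlong f (rowPath H' 1) t
      = (2 * Real.pi * Complex.I * ν : ℂ) • 1 := by
    rw [intervalIntegral.integral_congr_uIoo (by rwa [uIoo_of_le zero_le_one]),
      integral_circleDlog hr' ν hsa, fourierSum_one, add_sub_cancel_right]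
    simp
  have i2 : ∫ t in (0 : ℝ)..1, dlogAlong g (rowPath H' 1) t
      = (2 * Real.pi * Complex.I * μ : ℂ) • 1 := by
    rw [intervalIntegral.integral_congr_uIoo (by rwa [uIoo_of_le zero_le_one]),
      integral_circleDlog hr' μ hsb, fourierSum_one, add_sub_cancel_right]
    simp
  -- All loops involved share the periods of the small circle, `2πi ν` and `2πi μ`, so both
  -- corrections have the same coefficients and `Λf`, `Λg` simply add to `Λf'`, `Λg'`.
  rw [iteratedIntegral_congr d1 d2, hi1, hpf2, hpg2, hpf1, hpg1, hpf2, hpg2, i1, i2, e0] at hi2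
  have hP (F : X → A) : F (H (0, 0)) = F P := by rw [hH0, γ.source]
  have hH'00 : H' (0, 0) = H (1, 0) := by
    rw [hH1]
    simp [H', circleHomotopy, circlePath]
  have hH'10 : H' (1, 0) = x.symm (circlePath r' 0) := by
    simp [H', circleHomotopy]
  rw [hP f] at hf1
  rw [hP g] at hg1
  rw [hH'00, hf1, mul_assoc, ← exp_add'] at hf2
  rw [hH'00, hg1, mul_assoc, ← exp_add'] at hg2
  obtain ⟨U, hU⟩ : IsUnit (f P) := hP f ▸ (hregf (hHD' (0, 0))).self_of_nhds.2
  obtain ⟨V, hV⟩ : IsUnit (g P) := hP g ▸ (hregg (hHD' (0, 0))).self_of_nhds.2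
  obtain ⟨u, hu⟩ := (hregf (hH'D (1, 0))).self_of_nhds.2
  obtain ⟨v, hv⟩ := (hregg (hH'D (1, 0))).self_of_nhds.2
  have hu' := hu.trans (congrArg f hH'10)
  have hv' := hv.trans (congrArg g hH'10)
  have key := exp_iteratedIntegral_circleDlog (u := u) (v := v) (ν := ν) (μ := μ) hr' ha0 hb0 ha hb
    hsa hsb (by rw [hu', hfa', circlePath_zero, fourierSum, circlePath_zero])
    (by rw [hv', hgb', circlePath_zero, fourierSum, circlePath_zero])
  rw [← hu, ← hU] at hf2
  rw [← hv, ← hV] at hg2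
  rw [exp_iteratedIntegral_of_eq_add hf2 hg2 ?_ key, ← hU, ← hV, unitZPow_coe, unitZPow_coe,
    Ring.inverse_unit, Units.val_mul]
  rw [hi2]
  simp only [smul_add, smul_mul_assoc, one_mul]
  abel

end ContouCarrere

end LoopFormula

/-! ### The main theorem -/

theorem mainTheorem1
    {A : Type*} [CommRing A] [IsLocalRing A] [Algebra ℂ A] [Module.Finite ℂ A]
    {X : Type*} [TopologicalSpace X] [T2Space X] [ConnectedSpace X]
    [ChartedSpace ℂ X] [IsManifold 𝓘(ℂ) ω X]
    (f g : X → A)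
    (hf : ContouCarrere.IsInvertibleMeromorphic f)
    (hg : ContouCarrere.IsInvertibleMeromorphic g)
    (s : X)
    (hs : s ∈ ContouCarrere.zerosAndPoles f ∪ ContouCarrere.zerosAndPoles g)
    (x : OpenPartialHomeomorph X ℂ) (hx : ContouCarrere.IsUniformizer x s)
    (P : X) (γ : Path P P) (hγ : ContouCarrere.IsPiecewiseC1 γ)
    (hγs : ContouCarrere.GoesOnceAround x
      (ContouCarrere.zerosAndPoles f ∪ ContouCarrere.zerosAndPoles g) γ) :
    (∃ (ν : ℤ) (a : ℤ → A), ContouCarrere.HasProductExpansion f x ν a) ∧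
    (∃ (μ : ℤ) (b : ℤ → A), ContouCarrere.HasProductExpansion g x μ b) ∧
    ∀ (ν : ℤ) (a : ℤ → A) (μ : ℤ) (b : ℤ → A),
      ContouCarrere.HasProductExpansion f x ν a →
      ContouCarrere.HasProductExpansion g x μ b →
      (ContouCarrere.expA ((1 / (2 * (Real.pi : ℂ) * Complex.I)) •
          ContouCarrere.iteratedIntegral
            (ContouCarrere.dlogAlong f γ.extend) (ContouCarrere.dlogAlong g γ.extend)) =
        ContouCarrere.unitZPow (g P) ν * Ring.inverse (ContouCarrere.unitZPow (f P) μ) *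
          ContouCarrere.ccSymbol ν a μ b) ∧
      (f P = 1 → g P = 1 →
        ContouCarrere.expA ((1 / (2 * (Real.pi : ℂ) * Complex.I)) •
          ContouCarrere.iteratedIntegral
            (ContouCarrere.dlogAlong f γ.extend) (ContouCarrere.dlogAlong g γ.extend)) =
        ContouCarrere.ccSymbol ν a μ b) := by
  -- The statement involves no norm. One is induced by the left regular representation, which is
  -- faithful, from an operator norm on matrices.
  let φ : A →ₐ[ℂ] Matrix _ _ ℂ := Algebra.leftMulMatrix (Module.finBasis ℂ A)
  let : NormedRing (Matrix (Fin (Module.finrank ℂ A)) (Fin (Module.finrank ℂ A)) ℂ) :=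
    Matrix.linftyOpNormedRing
  let : NormedAlgebra ℂ (Matrix (Fin (Module.finrank ℂ A)) (Fin (Module.finrank ℂ A)) ℂ) :=
    Matrix.linftyOpNormedAlgebra
  let : NormedCommRing A :=
    NormedCommRing.induced A _ φ (Algebra.leftMulMatrix_injective _)
  let : NormedAlgebra ℂ A := NormedAlgebra.induced ℂ A _ φ
  -- The disc bounded by the circle contains no zero or pole besides its centre, so `f` and `g` are
  -- units at all nearby points other than `s`.
  have hu : ∀ᶠ z in 𝓝[≠] (0 : ℂ), IsUnit (f (x.symm z)) ∧ IsUnit (g (x.symm z)) := by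
    obtain ⟨r, hr, -, hD, -⟩ := hγs
    filter_upwards [nhdsWithin_le_nhds (Metric.closedBall_mem_nhds (0 : ℂ) hr),
      self_mem_nhdsWithin] with z hz hz0
    have h := hD z hz hz0
    simp only [ContouCarrere.zerosAndPoles, mem_union, mem_ofPred_eq, not_or, not_not] at h
    exact ⟨h.1.2, h.2.2⟩
  refine ⟨ContouCarrere.exists_hasProductExpansion (hf.1.meromorphicAt_symm hx)
      (hu.mono fun z h => h.1),
    ContouCarrere.exists_hasProductExpansion (hg.1.meromorphicAt_symm hx)
      (hu.mono fun z h => h.2), fun ν a μ b hfa hgb => ?_⟩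
  have h := ContouCarrere.exp_iteratedIntegral_loop hx.1 hγ hγs hfa hgb
  rw [ContouCarrere.expA_eq_exp]
  refine ⟨h, fun hfP hgP => ?_⟩
  have h1 (n : ℤ) : ContouCarrere.unitZPow (1 : A) n = 1 := by
    simpa using ContouCarrere.unitZPow_coe (1 : Aˣ) n
  rw [h, hfP, hgP, h1, h1, Ring.inverse_one, one_mul, one_mul]
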